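/- Let $M$ be a connected smooth ($C^\infty$) surface with a smooth pseudo-Riemannian metric $g$ of arbitrary signature (positive definite, negative definite or indefinite), and let $H=\tfrac12 g^{ij}p_ip_j\colon T^*M\to\mathbb R$ be its kinetic energy. Let $F\colon T^*M\to\mathbb R$ be a function which in the canonical coordinates $(x,y,p_x,p_y)$ of every local coordinate system $(x,y)$ of $M$ has the form $a(x,y)p_x^2+b(x,y)p_xp_y+c(x,y)p_y^2$ with smooth $a,b,c$. Suppose that $F$ is an integral of the geodesic flow of $g$, i.e. $\{H,F\}=0$ for the standard Poisson bracket on $T^*M$, and that $F$ is nontrivial, i.e. $F\neq k\cdot H$ for every constant $k\in\mathbb R$. Then there is an open dense subset $U\subseteq M$ such that in a neighbourhood of every point of $U$ there exist smooth coordinates $(x,y)$ in which $g$ and $F$ have one of the following forms: - (Liouville) $g=(X(x)-Y(y))(dx^2\pm dy^2)$ and $F=\dfrac{X(x)p_y^2\pm Y(y)p_x^2}{X(x)-Y(y)}$, with smooth functions $X,Y$ of one variable and the same sign $\pm$ in both formulas; if this sign is $-$, the formula holds for $F$ or for $-F$. - (Complex-Liouville) $g=\operatorname{Im}(h)\,dx\,dy$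 and $F=p_x^2-p_y^2+2\,\dfrac{\operatorname{Re}(h)}{\operatorname{Im}(h)}\,p_xp_y$, where $h$ is a holomorphic function of $z=x+iy$. - (Jordan-block) $g=(1+xY'(y))\,dx\,dy$ and, for $F$ or for $-F$, the formula $p_x^2-2\,\dfrac{Y(y)}{1+xY'(y)}\,p_xp_y$, with a smooth function $Y$ of one variable. The denominators $X(x)-Y(y)$, $\operatorname{Im}(h)$, $1+xY'(y)$ do not vanish in these neighbourhoods. -/

import Mathlib

open Set Topology
open scoped Manifold ContDiff

namespace Dini

/-- The coordinate plane. -/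
abbrev Plane : Type := EuclideanSpace ℝ (Fin 2)

noncomputable section

section Manifold

variable {M : Type*} [TopologicalSpace M] [ChartedSpace Plane M]

/-- For a chart `φ = (x, y)` and a point with coordinates `q`, the tangent vector
`v₀ ∂/∂x + v₁ ∂/∂y` at that point. -/
def tangentVec (φ : OpenPartialHomeomorph M Plane) (q v : Plane) :
    TangentSpace (𝓡 2) (φ.symm q) :=
  mfderiv (𝓡 2) (𝓡 2) φ.symm q v

/-- For a chart `φ = (x, y)` and a point with coordinates `q`, the covector
`P₀ dx + P₁ dy` at that point. -/
def covec (φ : OpenPartialHomeomorph M Plane) (q P : Plane) :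
    Module.Dual ℝ (TangentSpace (𝓡 2) (φ.symm q)) :=
  ∑ i : Fin 2, P i •
    ((EuclideanSpace.proj i : Plane →L[ℝ] ℝ).toLinearMap ∘ₗ
      (mfderiv (𝓡 2) (𝓡 2) φ (φ.symm q)).toLinearMap :
        TangentSpace (𝓡 2) (φ.symm q) →ₗ[ℝ] ℝ)

/-- A real function on the cotangent bundle of `M`. -/
abbrev CotangentFunction (M : Type*) [TopologicalSpace M] [ChartedSpace Plane M] : Type _ :=
  ∀ p : M, Module.Dual ℝ (TangentSpace (𝓡 2) p) → ℝ

/-- The expression of a function on the cotangent bundle in the canonical coordinates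
`(x, y, p_x, p_y) = (q 0, q 1, P 0, P 1)` induced by the chart `φ = (x, y)`. -/
def inCoords (F : CotangentFunction M) (φ : OpenPartialHomeomorph M Plane) (q P : Plane) : ℝ :=
  F (φ.symm q) (covec φ q P)

/-- The canonical Poisson bracket of two functions of `(q, P)`. -/
def poissonBracket (A B : Plane → Plane → ℝ) (q P : Plane) : ℝ :=
  ∑ i : Fin 2,
    (fderiv ℝ (fun q' => A q' P) q (EuclideanSpace.single i 1) *
        fderiv ℝ (fun P' => B q P') P (EuclideanSpace.single i 1) -
      fderiv ℝ (fun P' => A q P') P (EuclideanSpace.single i 1) *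
        fderiv ℝ (fun q' => B q' P) q (EuclideanSpace.single i 1))

/-- `F` is (smooth and) quadratic in momenta: in the canonical coordinates of every smooth chart it
is `a(x,y) p_x² + b(x,y) p_x p_y + c(x,y) p_y²` with smooth coefficients. -/
def IsQuadraticInMomenta (F : CotangentFunction M) : Prop :=
  ∀ φ ∈ IsManifold.maximalAtlas (𝓡 2) ∞ M, ∃ a b c : Plane → ℝ,
    ContDiffOn ℝ ∞ a φ.target ∧ ContDiffOn ℝ ∞ b φ.target ∧ ContDiffOn ℝ ∞ c φ.target ∧
    ∀ q ∈ φ.target, ∀ P : Plane,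
      inCoords F φ q P = a q * P 0 ^ 2 + b q * (P 0 * P 1) + c q * P 1 ^ 2

/-- A smooth metric of arbitrary signature on a surface. -/
structure PseudoRiemannianMetric (M : Type*) [TopologicalSpace M] [ChartedSpace Plane M] where
  /-- The bilinear form on every tangent space. -/
  form : ∀ p : M, LinearMap.BilinForm ℝ (TangentSpace (𝓡 2) p)
  symm : ∀ p, (form p).IsSymm
  nondegenerate : ∀ p, (form p).Nondegenerate
  smooth : ∀ φ ∈ IsManifold.maximalAtlas (𝓡 2) ∞ M, ∀ i j : Fin 2,
    ContDiffOn ℝ ∞ (fun q => form (φ.symm q)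
      (tangentVec φ q (EuclideanSpace.single i 1))
      (tangentVec φ q (EuclideanSpace.single j 1))) φ.target

instance (p : M) : FiniteDimensional ℝ (TangentSpace (𝓡 2) p) :=
  inferInstanceAs (FiniteDimensional ℝ Plane)

namespace PseudoRiemannianMetric

/-- The line element `ds²` in the chart `φ = (x, y)` at the point with coordinates `q`, as a
quadratic form in `(dx, dy) = (v 0, v 1)`. -/
def lineElement (g : PseudoRiemannianMetric M) (φ : OpenPartialHomeomorph M Plane)
    (q v : Plane) : ℝ :=
  g.form (φ.symm q) (tangentVec φ q v) (tangentVec φ q v)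

/-- The kinetic energy `H = ½ g^{ij} p_i p_j`, i.e. `½ ξ(ξ♯)` where `g(ξ♯, ·) = ξ`. -/
def hamiltonian (g : PseudoRiemannianMetric M) : CotangentFunction M := fun p ξ =>
  1 / 2 * ξ (((g.form p).toDual (g.nondegenerate p)).symm ξ)

/-- `F` is an integral of the geodesic flow of `g`: `{H, F} = 0`. -/
def IsIntegral (g : PseudoRiemannianMetric M) (F : CotangentFunction M) : Prop :=
  ∀ φ ∈ IsManifold.maximalAtlas (𝓡 2) ∞ M, ∀ q ∈ φ.target, ∀ P : Plane,
    poissonBracket (inCoords g.hamiltonian φ) (inCoords F φ) q P = 0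

/-- `F` is nontrivial: it is not a constant multiple of `H`. -/
def IsNontrivial (g : PseudoRiemannianMetric M) (F : CotangentFunction M) : Prop :=
  ∀ k : ℝ, F ≠ fun p ξ => k * g.hamiltonian p ξ

end PseudoRiemannianMetric

end Manifold

/-! The normal forms: `ds q v` is a line element and `F q P` a function of `(x, y, p_x, p_y)`, for
`q = (x, y)` in the coordinate domain `D`, `v = (dx, dy)` and `P = (p_x, p_y)`. -/

/-- `ds² = (X(x) - Y(y)) (dx² + s dy²)` and `F = (X(x) p_y² + s Y(y) p_x²) / (X(x) - Y(y))`, where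
`s` stands for the sign `±1`. -/
def IsLiouville (s : ℝ) (D : Set Plane) (ds F : Plane → Plane → ℝ) : Prop :=
  ∃ X Y : ℝ → ℝ,
    ContDiffOn ℝ ∞ X ((fun q : Plane => q 0) '' D) ∧
    ContDiffOn ℝ ∞ Y ((fun q : Plane => q 1) '' D) ∧
    ∀ q ∈ D, X (q 0) - Y (q 1) ≠ 0 ∧
      (∀ v : Plane, ds q v = (X (q 0) - Y (q 1)) * (v 0 ^ 2 + s * v 1 ^ 2)) ∧
      (∀ P : Plane, F q P =
        (X (q 0) * P 1 ^ 2 + s * Y (q 1) * P 0 ^ 2) / (X (q 0) - Y (q 1)))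

/-- `ds² = Im(h) dx dy` and `F = p_x² - p_y² + 2 (Re h / Im h) p_x p_y` with `h` holomorphic in
`x + i y`. -/
def IsComplexLiouville (D : Set Plane) (ds F : Plane → Plane → ℝ) : Prop :=
  ∃ h : ℂ → ℂ,
    DifferentiableOn ℂ h ((fun q : Plane => (⟨q 0, q 1⟩ : ℂ)) '' D) ∧
    ∀ q ∈ D, (h ⟨q 0, q 1⟩).im ≠ 0 ∧
      (∀ v : Plane, ds q v = (h ⟨q 0, q 1⟩).im * (v 0 * v 1)) ∧
      (∀ P : Plane, F q P = P 0 ^ 2 - P 1 ^ 2 +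
        2 * ((h ⟨q 0, q 1⟩).re / (h ⟨q 0, q 1⟩).im) * (P 0 * P 1))

/-- `ds² = (1 + x Y'(y)) dx dy` and `F = p_x² - 2 (Y(y) / (1 + x Y'(y))) p_x p_y`. -/
def IsJordanBlock (D : Set Plane) (ds F : Plane → Plane → ℝ) : Prop :=
  ∃ Y : ℝ → ℝ,
    ContDiffOn ℝ ∞ Y ((fun q : Plane => q 1) '' D) ∧
    ∀ q ∈ D, 1 + q 0 * deriv Y (q 1) ≠ 0 ∧
      (∀ v : Plane, ds q v = (1 + q 0 * deriv Y (q 1)) * (v 0 * v 1)) ∧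
      (∀ P : Plane, F q P = P 0 ^ 2 -
        2 * (Y (q 1) / (1 + q 0 * deriv Y (q 1))) * (P 0 * P 1))

end

end Dini

/-! In a chart, H and F are quadratic forms in the momenta with smooth coefficients, and {H,F} is a
cubic in the momenta whose four coefficients make up `Commute`. H is nondegenerate, so it has two
isotropic covector directions: real ones in indefinite signature, complex conjugate ones in definite
signature.

The key fact is `closed_of_isotropic`. If a one-form θ, real or complex, satisfies H(θ) = 0 and F(θ)
= n with n a nonzero constant, then its graph is a common level set of two commuting functions whose
momentum gradients are independent. The graph is therefore Lagrangian, that is, dθ = 0. An isotropic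
form on which F does not vanish can be rescaled locally to F = ±1 (to F = 1 in the complex case),
and so becomes the differential of a function. The coordinates of the normal forms arise in this
way.

In indefinite signature the values of F on the two isotropic directions decide the case. If both are
nonzero with the same sign, the null coordinates give Liouville coordinates by half-sum and
half-difference. If the signs are opposite, the null coordinates are kept and {H,F} = 0 becomes the
Cauchy–Riemann system (`null_equations`). If one value vanishes identically on a disc and the other
does not vanish there, only one null coordinate is obtained by normalization. The other is built
explicitly in `exists_jordanBlock_of_chart`, and the Jordan block results. In definite signature the
real and imaginary parts of a primitive of the normalized complex isotropic form are Liouville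
coordinates.

If F vanishes on all isotropic directions over a disc, then F is pointwise a multiple of H, and the
bracket forces the factor to be constant (`exists_const_of_proportional`). This contradicts
nontriviality, because F = kH on a nonempty open set spreads to all of M. Indeed F − kH is again an
integral, the equation for quadratic integrals is of finite type, and prolongation gives unique
continuation (`eq_zero_of_eq_zero`); connectedness does the rest (`eq_of_eqOn`). So every nonempty
open set contains a point with a normal form. The set of such points is open because a normal form
holds on a whole chart. -/

namespace Dini

/-! ### Partial derivatives on the plane -/

section PartialDerivatives

variable {E : Type*} [NormedAddCommGroup E] [NormedSpace ℝ E]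

/-- The partial derivative with respect to the `i`-th coordinate. -/
noncomputable def pd (i : Fin 2) (f : Plane → E) (q : Plane) : E :=
  fderiv ℝ f q (EuclideanSpace.single i 1)

variable {Ω : Set Plane} {q : Plane} {i j : Fin 2}

lemma differentiableAt_of_contDiffOn {f : Plane → E} (hf : ContDiffOn ℝ ∞ f Ω) (hΩ : IsOpen Ω)
    (hq : q ∈ Ω) : DifferentiableAt ℝ f q :=
  (hf.contDiffAt (hΩ.mem_nhds hq)).differentiableAt (by simp)

lemma contDiffOn_pd {f : Plane → E} (hf : ContDiffOn ℝ ∞ f Ω) (hΩ : IsOpen Ω) (i : Fin 2) :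
    ContDiffOn ℝ ∞ (pd i f) Ω :=
  (hf.fderiv_of_isOpen hΩ (by simp)).clm_apply contDiffOn_const

lemma pd_congr {f g : Plane → E} (h : EqOn f g Ω) (hΩ : IsOpen Ω) (hq : q ∈ Ω) (i : Fin 2) :
    pd i f q = pd i g q := by
  rw [pd, pd, Filter.EventuallyEq.fderiv_eq (h.eventuallyEq_of_mem (hΩ.mem_nhds hq))]

lemma pd_const (c : E) : pd i (fun _ : Plane => c) q = 0 := by simp [pd]

lemma pd_add {f g : Plane → E} (hf : DifferentiableAt ℝ f q) (hg : DifferentiableAt ℝ g q) :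
    pd i (fun x => f x + g x) q = pd i f q + pd i g q := by
  simp [pd, fderiv_fun_add hf hg]

lemma pd_const_smul {f : Plane → E} (hf : DifferentiableAt ℝ f q) (k : ℝ) :
    pd i (fun x => k • f x) q = k • pd i f q := by
  simp [pd, fderiv_fun_const_smul hf]

lemma pd_mul {A : Type*} [NormedCommRing A] [NormedAlgebra ℝ A] {f g : Plane → A}
    (hf : DifferentiableAt ℝ f q) (hg : DifferentiableAt ℝ g q) :
    pd i (fun x => f x * g x) q = pd i f q * g q + f q * pd i g q := by
  simp [pd, fderiv_fun_mul hf hg]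
  ring

lemma pd_comm {f : Plane → E} (hf : ContDiffOn ℝ ∞ f Ω) (hΩ : IsOpen Ω) (hq : q ∈ Ω)
    (i j : Fin 2) : pd i (pd j f) q = pd j (pd i f) q := by
  have hd : DifferentiableAt ℝ (fderiv ℝ f) q :=
    differentiableAt_of_contDiffOn (hf.fderiv_of_isOpen hΩ (by simp)) hΩ hq
  have hs : IsSymmSndFDerivAt ℝ f q :=
    (hf.contDiffAt (hΩ.mem_nhds hq)).isSymmSndFDerivAt
      (by simpa using ENat.LEInfty.out (m := 2))
  have key (k l : Fin 2) : pd k (pd l f) q =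
      fderiv ℝ (fderiv ℝ f) q (EuclideanSpace.single k 1) (EuclideanSpace.single l 1) := by
    have := (hd.hasFDerivAt.clm_apply
      (hasFDerivAt_const (EuclideanSpace.single l (1 : ℝ)) q)).fderiv
    unfold pd
    rw [this]
    simp
  rw [key, key, hs]

lemma fderiv_apply_eq_pd (f : Plane → E) (q v : Plane) :
    fderiv ℝ f q v = v 0 • pd 0 f q + v 1 • pd 1 f q := by
  have hv : v = v 0 • EuclideanSpace.single 0 1 + v 1 • EuclideanSpace.single 1 1 := by
    ext k; fin_cases k <;> simp
  conv_lhs => rw [hv]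
  simp [pd]

/-- The derivative of a binary quadratic form with variable coefficients and arguments. -/
lemma pd_quadratic {A : Type*} [NormedCommRing A] [NormedAlgebra ℝ A] {a b c u v : Plane → A}
    (ha : DifferentiableAt ℝ a q) (hb : DifferentiableAt ℝ b q) (hc : DifferentiableAt ℝ c q)
    (hu : DifferentiableAt ℝ u q) (hv : DifferentiableAt ℝ v q) :
    pd i (fun x => a x * u x ^ 2 + b x * (u x * v x) + c x * v x ^ 2) q =
      pd i a q * u q ^ 2 + pd i b q * (u q * v q) + pd i c q * v q ^ 2 +
        (2 * a q * u q + b q * v q) * pd i u q + (b q * u q + 2 * c q * v q) * pd i v q := by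
  have h (w : Plane → A) : (fun x => w x ^ 2) = fun x => w x * w x := by ext; ring
  rw [pd_add (by fun_prop) (by fun_prop), pd_add (by fun_prop) (by fun_prop),
    pd_mul ha (by fun_prop), pd_mul hb (by fun_prop), pd_mul hc (by fun_prop), h u, h v,
    pd_mul hu hu, pd_mul hv hv, pd_mul hu hv]
  ring

end PartialDerivatives

/-- A closed smooth one-form on a convex open set has a smooth primitive. -/
theorem exists_primitive {Ω : Set Plane} (hΩ : IsOpen Ω) (hconv : Convex ℝ Ω) {u v : Plane → ℝ}
    (hu : ContDiffOn ℝ ∞ u Ω) (hv : ContDiffOn ℝ ∞ v Ω)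
    (hclosed : ∀ q ∈ Ω, pd 0 v q = pd 1 u q) :
    ∃ W : Plane → ℝ, ContDiffOn ℝ ∞ W Ω ∧ ∀ q ∈ Ω, pd 0 W q = u q ∧ pd 1 W q = v q := by
  set α : Plane → Plane →L[ℝ] ℝ := fun q =>
    u q • (EuclideanSpace.proj 0 : Plane →L[ℝ] ℝ) +
      v q • (EuclideanSpace.proj 1 : Plane →L[ℝ] ℝ) with hα
  have hαs : ContDiffOn ℝ ∞ α Ω :=
    (hu.smul contDiffOn_const).add (hv.smul contDiffOn_const)
  obtain ⟨W, hW⟩ := hconv.exists_forall_hasFDerivAt_of_fderiv_symmetric hΩ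
    (hαs.differentiableOn (by simp)) (by
      intro q hq x y
      have hu' := differentiableAt_of_contDiffOn hu hΩ hq
      have hv' := differentiableAt_of_contDiffOn hv hΩ hq
      have : fderiv ℝ α q =
          (fderiv ℝ u q).smulRight (EuclideanSpace.proj 0 : Plane →L[ℝ] ℝ) +
          (fderiv ℝ v q).smulRight (EuclideanSpace.proj 1 : Plane →L[ℝ] ℝ) :=
        ((hu'.hasFDerivAt.smul_const _).add (hv'.hasFDerivAt.smul_const _)).fderiv
      rw [this]
      simp [fderiv_apply_eq_pd u, fderiv_apply_eq_pd v, hclosed q hq]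
      ring)
  have hfd : EqOn (fderiv ℝ W) α Ω := fun q hq => (hW q hq).fderiv
  refine ⟨W, ?_, fun q hq => ?_⟩
  · rw [contDiffOn_infty_iff_fderiv_of_isOpen hΩ]
    exact ⟨fun q hq => (hW q hq).differentiableAt.differentiableWithinAt, hαs.congr hfd⟩
  · simp [pd, hfd hq, hα]

/-- A function on a convex open set with vanishing `i`-th partial derivative does not depend on
the `i`-th coordinate. -/
theorem eq_of_pd_eq_zero {Ω : Set Plane} (hΩ : IsOpen Ω) (hconv : Convex ℝ Ω) {f : Plane → ℝ}
    (hf : DifferentiableOn ℝ f Ω) (i : Fin 2) (hd : ∀ q ∈ Ω, pd i f q = 0) {p q : Plane}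
    (hp : p ∈ Ω) (hq : q ∈ Ω) (hpq : ∀ j, j ≠ i → p j = q j) : f p = f q := by
  have hqp : q - p = (q i - p i) • EuclideanSpace.single i (1 : ℝ) := by
    ext j
    by_cases h : j = i
    · subst h; simp
    · simp [hpq j h, h]
  have hmem (t : ℝ) (ht : t ∈ Icc (0 : ℝ) 1) : p + t • (q - p) ∈ Ω :=
    hconv.add_smul_sub_mem hp hq ht
  have hder (t : ℝ) (ht : t ∈ Icc (0 : ℝ) 1) :
      HasDerivAt (fun t : ℝ => f (p + t • (q - p))) 0 t := by
    have h1 : HasDerivAt (fun t : ℝ => p + t • (q - p)) (q - p) t := by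
      simpa using ((hasDerivAt_id t).smul_const (q - p)).const_add p
    have h2 := ((hf.differentiableAt (hΩ.mem_nhds (hmem t ht))).hasFDerivAt).comp_hasDerivAt t h1
    have h3 : fderiv ℝ f (p + t • (q - p)) (q - p) = 0 := by
      rw [hqp, map_smul, ← hqp]
      have := hd _ (hmem t ht)
      rw [pd] at this
      rw [this, smul_zero]
    rwa [h3] at h2
  have := constant_of_has_deriv_right_zero
    (fun t ht => (hder t ht).continuousAt.continuousWithinAt)
    (fun t ht => (hder t (Ico_subset_Icc_self ht)).hasDerivWithinAt) 1 (by simp)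
  simpa using this.symm

/-! ### Differentially closed systems of functions -/

/-- The functions which are combinations of members of `S` with coefficients smooth on `Ω`. -/
inductive SmoothSpan (Ω : Set Plane) (S : Set (Plane → ℝ)) : (Plane → ℝ) → Prop
  | mem {f} (hf : f ∈ S) : SmoothSpan Ω S f
  | add {f g} (hf : SmoothSpan Ω S f) (hg : SmoothSpan Ω S g) :
      SmoothSpan Ω S (fun q => f q + g q)
  | mul {f k} (hf : SmoothSpan Ω S f) (hk : ContDiffOn ℝ ∞ k Ω) :
      SmoothSpan Ω S (fun q => f q * k q)
  | congr {f g} (hf : SmoothSpan Ω S f) (hfg : ∀ q ∈ Ω, g q = f q) : SmoothSpan Ω S g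

namespace SmoothSpan

variable {Ω : Set Plane} {S T : Set (Plane → ℝ)} {f g : Plane → ℝ}

lemma contDiffOn (hf : SmoothSpan Ω S f) (hS : ∀ u ∈ S, ContDiffOn ℝ ∞ u Ω) :
    ContDiffOn ℝ ∞ f Ω := by
  induction hf with
  | mem h => exact hS _ h
  | add _ _ h1 h2 => exact h1.add h2
  | mul _ hk h => exact h.mul hk
  | congr _ hfg h => exact ContDiffOn.congr h hfg

lemma mono (hf : SmoothSpan Ω S f) (hST : S ⊆ T) : SmoothSpan Ω T f := by
  induction hf with
  | mem h => exact .mem (hST h)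
  | add _ _ h1 h2 => exact h1.add h2
  | mul _ hk h => exact h.mul hk
  | congr _ hfg h => exact h.congr hfg

/-- The product rule also differentiates the coefficients, which leaves undifferentiated members of
`S`; hence the requirement `S ⊆ T`. It is thus enough to differentiate generators. -/
lemma pd (hf : SmoothSpan Ω S f) (hΩ : IsOpen Ω) (hS : ∀ u ∈ S, ContDiffOn ℝ ∞ u Ω)
    (hST : S ⊆ T) (i : Fin 2) (hd : ∀ u ∈ S, SmoothSpan Ω T (pd i u)) :
    SmoothSpan Ω T (pd i f) := by
  induction hf with
  | mem h => exact hd _ h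
  | add hf hg h1 h2 =>
    refine (h1.add h2).congr fun q hq => pd_add ?_ ?_
    · exact differentiableAt_of_contDiffOn (hf.contDiffOn hS) hΩ hq
    · exact differentiableAt_of_contDiffOn (hg.contDiffOn hS) hΩ hq
  | mul hf hk h =>
    refine ((h.mul hk).add ((hf.mono hST).mul (contDiffOn_pd hk hΩ i))).congr
      fun q hq => pd_mul ?_ ?_
    · exact differentiableAt_of_contDiffOn (hf.contDiffOn hS) hΩ hq
    · exact differentiableAt_of_contDiffOn hk hΩ hq
  | congr _ hfg h => exact h.congr fun q hq => pd_congr hfg hΩ hq i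

/-- Smooth coefficients are bounded on a compact set, so membership in the span becomes the linear
estimate needed for Grönwall's inequality. -/
lemma exists_bound (hf : SmoothSpan Ω S f) {K : Set Plane} (hK : IsCompact K) (hKΩ : K ⊆ Ω)
    {N : Plane → ℝ} (hN : ∀ u ∈ S, ∀ q ∈ K, |u q| ≤ N q) :
    ∃ c : ℝ, ∀ q ∈ K, |f q| ≤ c * N q := by
  induction hf with
  | mem h => exact ⟨1, fun q hq => by simpa using hN _ h q hq⟩
  | add _ _ h1 h2 =>
    obtain ⟨c, hc⟩ := h1
    obtain ⟨d, hd⟩ := h2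
    refine ⟨c + d, fun q hq => (abs_add_le _ _).trans ?_⟩
    linarith [hc q hq, hd q hq]
  | @mul f k _ hk h =>
    obtain ⟨c, hc⟩ := h
    obtain ⟨d, hd⟩ := hK.exists_bound_of_continuousOn (hk.continuousOn.mono hKΩ)
    refine ⟨c * d, fun q hq => ?_⟩
    have h1 := hc q hq
    have h2 : |k q| ≤ d := hd q hq
    calc |f q * k q| = |f q| * |k q| := abs_mul _ _
      _ ≤ (c * N q) * d := mul_le_mul h1 h2 (abs_nonneg _) ((abs_nonneg _).trans h1)
      _ = _ := by ring
  | congr _ hfg h =>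
    obtain ⟨c, hc⟩ := h
    exact ⟨c, fun q hq => by rw [hfg q (hKΩ hq)]; exact hc q hq⟩

end SmoothSpan

/-- If the derivatives of finitely many functions on a convex open set are smooth combinations of
these functions, and all of them vanish at one point, then they vanish identically. -/
theorem eq_zero_of_pd_mem_smoothSpan {ι : Type*} [Fintype ι] {Ω : Set Plane} (hΩ : IsOpen Ω)
    (hconv : Convex ℝ Ω) {u : ι → Plane → ℝ} (hu : ∀ k, ContDiffOn ℝ ∞ (u k) Ω)
    (hd : ∀ k i, SmoothSpan Ω (range u) (pd i (u k))) {p : Plane} (hp : p ∈ Ω)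
    (h0 : ∀ k, u k p = 0) {q : Plane} (hq : q ∈ Ω) (k : ι) : u k q = 0 := by
  set γ : ℝ → Plane := fun t => p + t • (q - p) with hγ
  have hmem (t : ℝ) (ht : t ∈ Icc (0 : ℝ) 1) : γ t ∈ Ω := hconv.add_smul_sub_mem hp hq ht
  have hγd (t : ℝ) : HasDerivAt γ (q - p) t := by
    show HasDerivAt (fun t : ℝ => p + t • (q - p)) _ _
    simpa using ((hasDerivAt_id t).smul_const (q - p)).const_add p
  have hγc : Continuous γ := continuous_iff_continuousAt.2 fun t => (hγd t).continuousAt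
  set K : Set Plane := γ '' Icc 0 1 with hKdef
  have hK : IsCompact K := isCompact_Icc.image hγc
  have hKΩ : K ⊆ Ω := by rintro _ ⟨t, ht, rfl⟩; exact hmem t ht
  set N : Plane → ℝ := fun x => ‖fun k => u k x‖ with hNdef
  have hbd (k : ι) (i : Fin 2) : ∃ c : ℝ, ∀ x ∈ K, |pd i (u k) x| ≤ c * N x := by
    refine (hd k i).exists_bound hK hKΩ ?_
    rintro _ ⟨l, rfl⟩ x -
    exact norm_le_pi_norm (fun k => u k x) l
  choose c hc using hbd
  set v := q - p with hv
  have hder (t : ℝ) (ht : t ∈ Icc (0 : ℝ) 1) : HasDerivAt (fun t k => u k (γ t))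
      (fun k => v 0 * pd 0 (u k) (γ t) + v 1 * pd 1 (u k) (γ t)) t := by
    rw [hasDerivAt_pi]
    intro k
    have h2 := (differentiableAt_of_contDiffOn (hu k) hΩ
      (hmem t ht)).hasFDerivAt.comp_hasDerivAt t (hγd t)
    rwa [fderiv_apply_eq_pd] at h2
  have hcnn (k : ι) (i : Fin 2) (x) (hx : x ∈ K) : |pd i (u k) x| ≤ |c k i| * N x :=
    (hc k i x hx).trans (mul_le_mul_of_nonneg_right (le_abs_self _) (norm_nonneg _))
  set C : ℝ := ∑ k, (|v 0| * |c k 0| + |v 1| * |c k 1|) with hC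
  have hbound (t : ℝ) (ht : t ∈ Icc (0 : ℝ) 1) :
      ‖fun k => v 0 * pd 0 (u k) (γ t) + v 1 * pd 1 (u k) (γ t)‖ ≤
        C * ‖fun k => u k (γ t)‖ := by
    have hxK : γ t ∈ K := mem_image_of_mem _ ht
    have hC0 : 0 ≤ C := Finset.sum_nonneg fun k _ => by positivity
    rw [pi_norm_le_iff_of_nonneg (by positivity)]
    intro k
    have hk : |v 0| * |c k 0| + |v 1| * |c k 1| ≤ C :=
      Finset.single_le_sum (f := fun k => |v 0| * |c k 0| + |v 1| * |c k 1|)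
        (fun k _ => by positivity) (Finset.mem_univ k)
    calc ‖v 0 * pd 0 (u k) (γ t) + v 1 * pd 1 (u k) (γ t)‖
        ≤ |v 0| * |pd 0 (u k) (γ t)| + |v 1| * |pd 1 (u k) (γ t)| := by
          rw [← abs_mul, ← abs_mul]; exact abs_add_le _ _
      _ ≤ |v 0| * (|c k 0| * N (γ t)) + |v 1| * (|c k 1| * N (γ t)) := by
          gcongr
          · exact hcnn k 0 _ hxK
          · exact hcnn k 1 _ hxK
      _ = (|v 0| * |c k 0| + |v 1| * |c k 1|) * N (γ t) := by ring
      _ ≤ C * N (γ t) := mul_le_mul_of_nonneg_right hk (norm_nonneg _)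
  -- Grönwall along the segment from `p` to `q`: the vector of all unknowns satisfies ‖U'‖ ≤ C‖U‖
  -- and starts at zero.
  have := eq_zero_of_abs_deriv_le_mul_abs_self_of_eq_zero_right
    (f := fun t k => u k (γ t))
    (fun t ht => (hder t ht).continuousAt.continuousWithinAt)
    (fun t ht => (hder t (Ico_subset_Icc_self ht)).hasDerivWithinAt)
    (by ext k; simp [hγ, h0 k]) (fun t ht => hbound t (Ico_subset_Icc_self ht)) 1 (by simp)
  simpa [hγ, hv] using congrFun this k

/-! ### Pairs of commuting quadratic functions -/

/-- At the point `q`, the quadratic functions `A p_x² + B p_x p_y + C p_y²` and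
`a p_x² + b p_x p_y + c p_y²` have vanishing Poisson bracket. -/
def Commute (A B C a b c : Plane → ℝ) (q : Plane) : Prop :=
  2 * a q * pd 0 A q + b q * pd 1 A q - 2 * A q * pd 0 a q - B q * pd 1 a q = 0 ∧
  2 * a q * pd 0 B q + b q * pd 0 A q + b q * pd 1 B q + 2 * c q * pd 1 A q
    - 2 * A q * pd 0 b q - B q * pd 0 a q - B q * pd 1 b q - 2 * C q * pd 1 a q = 0 ∧
  2 * a q * pd 0 C q + b q * pd 0 B q + b q * pd 1 C q + 2 * c q * pd 1 B q
    - 2 * A q * pd 0 c q - B q * pd 0 b q - B q * pd 1 c q - 2 * C q * pd 1 b q = 0 ∧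
  b q * pd 0 C q + 2 * c q * pd 1 C q - B q * pd 0 c q - 2 * C q * pd 1 c q = 0

/-- A smooth nondegenerate quadratic function with coefficients `A, B, C` and a smooth quadratic
function with coefficients `a, b, c` whose Poisson bracket vanishes. -/
structure IsKillingPair (Ω : Set Plane) (A B C a b c : Plane → ℝ) : Prop where
  isOpen : IsOpen Ω
  hA : ContDiffOn ℝ ∞ A Ω
  hB : ContDiffOn ℝ ∞ B Ω
  hC : ContDiffOn ℝ ∞ C Ω
  ha : ContDiffOn ℝ ∞ a Ω
  hb : ContDiffOn ℝ ∞ b Ω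
  hc : ContDiffOn ℝ ∞ c Ω
  disc_ne : ∀ q ∈ Ω, 4 * A q * C q - B q ^ 2 ≠ 0
  commute : ∀ q ∈ Ω, Commute A B C a b c q

lemma fderiv_momenta (a b c : ℝ) (P : Plane) (i : Fin 2) :
    fderiv ℝ (fun P : Plane => a * P 0 ^ 2 + b * (P 0 * P 1) + c * P 1 ^ 2) P
      (EuclideanSpace.single i 1) =
      (2 * a * P 0 + b * P 1) * EuclideanSpace.single i (1 : ℝ) 0 +
        (b * P 0 + 2 * c * P 1) * EuclideanSpace.single i (1 : ℝ) 1 := by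
  have h (j : Fin 2) : HasFDerivAt (fun P : Plane => P j)
      (EuclideanSpace.proj j : Plane →L[ℝ] ℝ) P :=
    (EuclideanSpace.proj j : Plane →L[ℝ] ℝ).hasFDerivAt
  have hp (j : Fin 2) : pd i (fun P : Plane => P j) P = EuclideanSpace.single i (1 : ℝ) j := by
    simp [pd, (h j).fderiv]
  have := pd_quadratic (i := i) (q := P) (differentiableAt_const a) (differentiableAt_const b)
    (differentiableAt_const c) (h 0).differentiableAt (h 1).differentiableAt
  rw [pd] at this
  rw [this, hp, hp, pd_const, pd_const, pd_const]
  ring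

lemma commute_of_poissonBracket {Ω : Set Plane} (hΩ : IsOpen Ω) {A B C a b c : Plane → ℝ}
    (hA : ContDiffOn ℝ ∞ A Ω) (hB : ContDiffOn ℝ ∞ B Ω) (hC : ContDiffOn ℝ ∞ C Ω)
    (ha : ContDiffOn ℝ ∞ a Ω) (hb : ContDiffOn ℝ ∞ b Ω) (hc : ContDiffOn ℝ ∞ c Ω)
    {H F : Plane → Plane → ℝ}
    (hH : ∀ q ∈ Ω, ∀ P : Plane, H q P = A q * P 0 ^ 2 + B q * (P 0 * P 1) + C q * P 1 ^ 2)
    (hF : ∀ q ∈ Ω, ∀ P : Plane, F q P = a q * P 0 ^ 2 + b q * (P 0 * P 1) + c q * P 1 ^ 2)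
    {q : Plane} (hq : q ∈ Ω) (h0 : ∀ P, poissonBracket H F q P = 0) :
    Commute A B C a b c q := by
  have hpos {H : Plane → Plane → ℝ} {A B C : Plane → ℝ} (hA : ContDiffOn ℝ ∞ A Ω)
      (hB : ContDiffOn ℝ ∞ B Ω) (hC : ContDiffOn ℝ ∞ C Ω)
      (hH : ∀ q ∈ Ω, ∀ P : Plane, H q P = A q * P 0 ^ 2 + B q * (P 0 * P 1) + C q * P 1 ^ 2)
      (i : Fin 2) (P : Plane) : fderiv ℝ (fun q' => H q' P) q (EuclideanSpace.single i 1) =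
        pd i A q * P 0 ^ 2 + pd i B q * (P 0 * P 1) + pd i C q * P 1 ^ 2 := by
    have := pd_congr (fun x hx => hH x hx P) hΩ hq i
    rw [pd] at this
    rw [this, pd_quadratic (differentiableAt_of_contDiffOn hA hΩ hq)
      (differentiableAt_of_contDiffOn hB hΩ hq) (differentiableAt_of_contDiffOn hC hΩ hq)
      (differentiableAt_const _) (differentiableAt_const _), pd_const, pd_const]
    ring
  have hmom {H : Plane → Plane → ℝ} {A B C : Plane → ℝ}
      (hH : ∀ q ∈ Ω, ∀ P : Plane, H q P = A q * P 0 ^ 2 + B q * (P 0 * P 1) + C q * P 1 ^ 2)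
      (i : Fin 2) (P : Plane) : fderiv ℝ (fun P' => H q P') P (EuclideanSpace.single i 1) =
      (2 * A q * P 0 + B q * P 1) * EuclideanSpace.single i (1 : ℝ) 0 +
        (B q * P 0 + 2 * C q * P 1) * EuclideanSpace.single i (1 : ℝ) 1 := by
    rw [← fderiv_momenta]
    congr 2
    ext P
    exact hH q hq P
  have key (x y : ℝ) := h0 !₂[x, y]
  simp only [poissonBracket, Fin.sum_univ_two, hpos hA hB hC hH, hpos ha hb hc hF, hmom hH,
    hmom hF] at key
  simp at key
  -- The bracket is a binary cubic in the momenta. The values at (1,0) and (0,1) give the outer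
  -- coefficients; those at (1,1) and (1,−1) then give the two middle ones.
  have k1 := key 1 0
  have k2 := key 0 1
  have k3 := key 1 1
  have k4 := key 1 (-1)
  simp only [Commute]
  refine ⟨?_, ?_, ?_, ?_⟩
  · linear_combination k1
  · linear_combination (k3 - k4) / 2 - k2
  · linear_combination (k3 + k4) / 2 - k1
  · linear_combination k2

/-! ### Operations on Killing pairs, and unique continuation by prolongation. -/

namespace IsKillingPair

variable {Ω : Set Plane} {A B C a b c : Plane → ℝ}

lemma mono (h : IsKillingPair Ω A B C a b c) {Ω' : Set Plane} (ho : IsOpen Ω') (hs : Ω' ⊆ Ω) :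
    IsKillingPair Ω' A B C a b c :=
  ⟨ho, h.hA.mono hs, h.hB.mono hs, h.hC.mono hs, h.ha.mono hs, h.hb.mono hs, h.hc.mono hs,
    fun q hq => h.disc_ne q (hs hq), fun q hq => h.commute q (hs hq)⟩

lemma const_mul (h : IsKillingPair Ω A B C a b c) (k : ℝ) :
    IsKillingPair Ω A B C (fun q => k * a q) (fun q => k * b q) (fun q => k * c q) := by
  refine ⟨h.isOpen, h.hA, h.hB, h.hC, contDiffOn_const.mul h.ha, contDiffOn_const.mul h.hb,
    contDiffOn_const.mul h.hc, h.disc_ne, fun q hq => ?_⟩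
  have hd {f : Plane → ℝ} (hf : ContDiffOn ℝ ∞ f Ω) (i : Fin 2) :
      pd i (fun q => k * f q) q = k * pd i f q :=
    pd_const_smul (differentiableAt_of_contDiffOn hf h.isOpen hq) k
  obtain ⟨h1, h2, h3, h4⟩ := h.commute q hq
  simp only [Commute, hd h.ha, hd h.hb, hd h.hc]
  refine ⟨?_, ?_, ?_, ?_⟩
  · linear_combination k * h1
  · linear_combination k * h2
  · linear_combination k * h3
  · linear_combination k * h4

/-- Adding a multiple of the nondegenerate function preserves the vanishing bracket. -/
lemma add_mul (h : IsKillingPair Ω A B C a b c) (k : ℝ) :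
    IsKillingPair Ω A B C (fun q => a q + k * A q) (fun q => b q + k * B q)
      (fun q => c q + k * C q) := by
  refine ⟨h.isOpen, h.hA, h.hB, h.hC, h.ha.add (contDiffOn_const.mul h.hA),
    h.hb.add (contDiffOn_const.mul h.hB), h.hc.add (contDiffOn_const.mul h.hC), h.disc_ne,
    fun q hq => ?_⟩
  have hd {f g : Plane → ℝ} (hf : ContDiffOn ℝ ∞ f Ω) (hg : ContDiffOn ℝ ∞ g Ω) (i : Fin 2) :
      pd i (fun q => f q + k * g q) q = pd i f q + k * pd i g q := by
    have hf := differentiableAt_of_contDiffOn hf h.isOpen hq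
    have hg := differentiableAt_of_contDiffOn hg h.isOpen hq
    rw [pd_add hf (by fun_prop)]
    congr 1
    exact pd_const_smul hg k
  obtain ⟨h1, h2, h3, h4⟩ := h.commute q hq
  simp only [Commute, hd h.ha h.hA, hd h.hb h.hB, hd h.hc h.hC]
  refine ⟨?_, ?_, ?_, ?_⟩
  · linear_combination h1
  · linear_combination h2
  · linear_combination h3
  · linear_combination h4

/-- The second function of a Killing pair, evaluated on the image of the constant vector
`(v₀, v₁)` under the (rescaled) metric. -/
def lowered (A B C a b c : Plane → ℝ) (v₀ v₁ : ℝ) (q : Plane) : ℝ :=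
  a q * (2 * C q * v₀ - B q * v₁) ^ 2 +
    b q * ((2 * C q * v₀ - B q * v₁) * (2 * A q * v₁ - B q * v₀)) +
    c q * (2 * A q * v₁ - B q * v₀) ^ 2

lemma lowered_contDiffOn (h : IsKillingPair Ω A B C a b c) (v₀ v₁ : ℝ) :
    ContDiffOn ℝ ∞ (lowered A B C a b c v₀ v₁) Ω := by
  have := h.hA; have := h.hB; have := h.hC; have := h.ha; have := h.hb; have := h.hc
  unfold lowered
  fun_prop

/-- This is the Killing equation contracted three times with a constant vector: the derivative of
K(v,v) in the direction v contains no derivative of the integral's coefficients. -/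
lemma lowered_derivative_mem (h : IsKillingPair Ω A B C a b c) (v₀ v₁ : ℝ) :
    SmoothSpan Ω {a, b, c} (fun q => v₀ * pd 0 (lowered A B C a b c v₀ v₁) q +
      v₁ * pd 1 (lowered A B C a b c v₀ v₁) q) := by
  set p : Plane → ℝ := fun q => 2 * C q * v₀ - B q * v₁ with hp
  set r : Plane → ℝ := fun q => 2 * A q * v₁ - B q * v₀ with hr
  have hA := h.hA; have hB := h.hB; have hC := h.hC
  have ha := h.ha; have hb := h.hb; have hc := h.hc
  have hps : ContDiffOn ℝ ∞ p Ω := by fun_prop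
  have hrs : ContDiffOn ℝ ∞ r Ω := by fun_prop
  have hpd {f : Plane → ℝ} (hf : ContDiffOn ℝ ∞ f Ω) (i : Fin 2) := contDiffOn_pd hf h.isOpen i
  have hA0 := hpd hA 0; have hA1 := hpd hA 1; have hB0 := hpd hB 0; have hB1 := hpd hB 1
  have hC0 := hpd hC 0; have hC1 := hpd hC 1
  have hp0 := hpd hps 0; have hp1 := hpd hps 1; have hr0 := hpd hrs 0; have hr1 := hpd hrs 1
  -- The derivative along `v` equals the momentum gradient of F at `(p, r)` paired with `(s, t)`.
  -- The quotients come from the bracket relation, the other terms from differentiating `p` and `r`.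
  set s : Plane → ℝ := fun q =>
    (pd 0 A q * p q ^ 2 + pd 0 B q * (p q * r q) + pd 0 C q * r q ^ 2) /
      (4 * A q * C q - B q ^ 2) + v₀ * pd 0 p q + v₁ * pd 1 p q with hs
  set t : Plane → ℝ := fun q =>
    (pd 1 A q * p q ^ 2 + pd 1 B q * (p q * r q) + pd 1 C q * r q ^ 2) /
      (4 * A q * C q - B q ^ 2) + v₀ * pd 0 r q + v₁ * pd 1 r q with ht
  have hD : ContDiffOn ℝ ∞ (fun q => 4 * A q * C q - B q ^ 2) Ω := by fun_prop
  have hss : ContDiffOn ℝ ∞ s Ω :=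
    (((by fun_prop : ContDiffOn ℝ ∞ (fun q => pd 0 A q * p q ^ 2 + pd 0 B q * (p q * r q) +
      pd 0 C q * r q ^ 2) Ω).div hD h.disc_ne).add (contDiffOn_const.mul hp0)).add
      (contDiffOn_const.mul hp1)
  have hts : ContDiffOn ℝ ∞ t Ω :=
    (((by fun_prop : ContDiffOn ℝ ∞ (fun q => pd 1 A q * p q ^ 2 + pd 1 B q * (p q * r q) +
      pd 1 C q * r q ^ 2) Ω).div hD h.disc_ne).add (contDiffOn_const.mul hr0)).add
      (contDiffOn_const.mul hr1)
  have sa : SmoothSpan Ω {a, b, c} a := .mem (by simp)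
  have sb : SmoothSpan Ω {a, b, c} b := .mem (by simp)
  have sc : SmoothSpan Ω {a, b, c} c := .mem (by simp)
  refine (((sa.mul (k := fun q => 2 * p q * s q) (by fun_prop)).add
    (sb.mul (k := fun q => r q * s q + p q * t q) (by fun_prop))).add
    (sc.mul (k := fun q => 2 * r q * t q) (by fun_prop))).congr fun q hq => ?_
  have dif {f : Plane → ℝ} (hf : ContDiffOn ℝ ∞ f Ω) :=
    differentiableAt_of_contDiffOn hf h.isOpen hq
  have hl (i : Fin 2) := pd_quadratic (i := i) (dif ha) (dif hb) (dif hc) (dif hps) (dif hrs)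
  have e : lowered A B C a b c v₀ v₁ =
      fun x => a x * p x ^ 2 + b x * (p x * r x) + c x * r x ^ 2 := rfl
  rw [e, hl, hl]
  obtain ⟨h1, h2, h3, h4⟩ := h.commute q hq
  have hne := h.disc_ne q hq
  have ep : p q = 2 * C q * v₀ - B q * v₁ := rfl
  have er : r q = 2 * A q * v₁ - B q * v₀ := rfl
  simp only [hs, ht]
  have key : (v₀ * (pd 0 a q * p q ^ 2 + pd 0 b q * (p q * r q) + pd 0 c q * r q ^ 2) +
      v₁ * (pd 1 a q * p q ^ 2 + pd 1 b q * (p q * r q) + pd 1 c q * r q ^ 2)) =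
      ((pd 0 A q * p q ^ 2 + pd 0 B q * (p q * r q) + pd 0 C q * r q ^ 2) *
        (2 * a q * p q + b q * r q) +
      (pd 1 A q * p q ^ 2 + pd 1 B q * (p q * r q) + pd 1 C q * r q ^ 2) *
        (b q * p q + 2 * c q * r q)) / (4 * A q * C q - B q ^ 2) := by
    rw [eq_div_iff hne]
    -- The momentum gradient of H at `(p, r)` is the discriminant times `v`, because `(p, r)` is the
    -- adjugate of the Hessian of H applied to `v`. The derivative of F along `v` is thus one half
    -- of the bracket.
    have hv0 : v₀ * (4 * A q * C q - B q ^ 2) = 2 * A q * p q + B q * r q := by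
      rw [ep, er]; ring
    have hv1 : v₁ * (4 * A q * C q - B q ^ 2) = B q * p q + 2 * C q * r q := by
      rw [ep, er]; ring
    linear_combination (pd 0 a q * p q ^ 2 + pd 0 b q * (p q * r q) + pd 0 c q * r q ^ 2) * hv0 +
      (pd 1 a q * p q ^ 2 + pd 1 b q * (p q * r q) + pd 1 c q * r q ^ 2) * hv1
      - p q ^ 3 * h1 - p q ^ 2 * r q * h2 - p q * r q ^ 2 * h3 - r q ^ 3 * h4
  linear_combination key

/-- Unique continuation: the second function of a Killing pair on a convex open set vanishes if it
vanishes on a nonempty open subset. -/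
theorem eq_zero_of_eq_zero (h : IsKillingPair Ω A B C a b c) (hconv : Convex ℝ Ω) {O : Set Plane}
    (hO : IsOpen O) (hOΩ : O ⊆ Ω) (hne : O.Nonempty)
    (h0 : ∀ q ∈ O, a q = 0 ∧ b q = 0 ∧ c q = 0) :
    ∀ q ∈ Ω, a q = 0 ∧ b q = 0 ∧ c q = 0 := by
  have hA := h.hA; have hB := h.hB; have hC := h.hC
  have ha := h.ha; have hb := h.hb; have hc := h.hc
  have hΩ := h.isOpen
  set K : Plane → ℝ := lowered A B C a b c 1 0 with hK
  set L : Plane → ℝ := lowered A B C a b c 0 1 with hL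
  set J : Plane → ℝ := fun q => -2 * a q * B q * C q + b q / 2 * (4 * A q * C q + B q ^ 2)
    - 2 * c q * A q * B q with hJ
  have hKs : ContDiffOn ℝ ∞ K Ω := h.lowered_contDiffOn 1 0
  have hLs : ContDiffOn ℝ ∞ L Ω := h.lowered_contDiffOn 0 1
  have hJs : ContDiffOn ℝ ∞ J Ω := by fun_prop
  have hD : ContDiffOn ℝ ∞ (fun q => (4 * A q * C q - B q ^ 2) ^ 2) Ω := by fun_prop
  have hD0 : ∀ q ∈ Ω, (4 * A q * C q - B q ^ 2) ^ 2 ≠ 0 := fun q hq =>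
    pow_ne_zero 2 (h.disc_ne q hq)
  -- `K`, `J`, `L` are the components of F with lowered indices, rescaled. Raising the indices again
  -- recovers `a, b, c` at the cost of the squared discriminant.
  have inv : ∀ q ∈ Ω,
      a q = K q * (4 * A q ^ 2 / (4 * A q * C q - B q ^ 2) ^ 2) +
        L q * (B q ^ 2 / (4 * A q * C q - B q ^ 2) ^ 2) +
        J q * (4 * A q * B q / (4 * A q * C q - B q ^ 2) ^ 2) ∧
      b q = K q * (4 * A q * B q / (4 * A q * C q - B q ^ 2) ^ 2) +
        L q * (4 * B q * C q / (4 * A q * C q - B q ^ 2) ^ 2) +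
        J q * ((8 * A q * C q + 2 * B q ^ 2) / (4 * A q * C q - B q ^ 2) ^ 2) ∧
      c q = K q * (B q ^ 2 / (4 * A q * C q - B q ^ 2) ^ 2) +
        L q * (4 * C q ^ 2 / (4 * A q * C q - B q ^ 2) ^ 2) +
        J q * (4 * B q * C q / (4 * A q * C q - B q ^ 2) ^ 2) := by
    intro q hq
    have := hD0 q hq
    simp only [hK, hL, hJ, lowered]
    refine ⟨?_, ?_, ?_⟩ <;> (simp only [mul_div_assoc', ← add_div]; rw [eq_div_iff this]; ring)
  have span_abc (f : Plane → ℝ) (hf : SmoothSpan Ω {a, b, c} f) : SmoothSpan Ω {K, L, J} f := by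
    have sK : SmoothSpan Ω {K, L, J} K := .mem (by simp)
    have sL : SmoothSpan Ω {K, L, J} L := .mem (by simp)
    have sJ : SmoothSpan Ω {K, L, J} J := .mem (by simp)
    induction hf with
    | mem hf =>
      rcases hf with rfl | rfl | rfl
      · exact (((sK.mul (.div (by fun_prop) hD hD0)).add (sL.mul (.div (by fun_prop) hD hD0))).add
          (sJ.mul (.div (by fun_prop) hD hD0))).congr fun q hq => (inv q hq).1
      · exact (((sK.mul (.div (by fun_prop) hD hD0)).add (sL.mul (.div (by fun_prop) hD hD0))).add
          (sJ.mul (.div (by fun_prop) hD hD0))).congr fun q hq => (inv q hq).2.1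
      · exact (((sK.mul (.div (by fun_prop) hD hD0)).add (sL.mul (.div (by fun_prop) hD hD0))).add
          (sJ.mul (.div (by fun_prop) hD hD0))).congr fun q hq => (inv q hq).2.2
    | add _ _ h1 h2 => exact h1.add h2
    | mul _ hk h => exact h.mul hk
    | congr _ hfg h => exact h.congr hfg
  have lin (v w : ℝ) : lowered A B C a b c v w =
      fun q => v ^ 2 * K q + (2 * v * w * J q + w ^ 2 * L q) := by
    ext q
    simp only [hK, hL, hJ, lowered]
    ring
  have linpd (v w : ℝ) (i : Fin 2) (q : Plane) (hq : q ∈ Ω) :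
      pd i (lowered A B C a b c v w) q =
        v ^ 2 * pd i K q + (2 * v * w * pd i J q + w ^ 2 * pd i L q) := by
    have dif {f : Plane → ℝ} (hf : ContDiffOn ℝ ∞ f Ω) :=
      differentiableAt_of_contDiffOn hf hΩ hq
    have hk {f : Plane → ℝ} (hf : ContDiffOn ℝ ∞ f Ω) (k : ℝ) :
      pd i (fun q => k * f q) q = k * pd i f q := pd_const_smul (dif hf) k
    have d1 := dif hKs; have d2 := dif hJs; have d3 := dif hLs
    rw [lin, pd_add (by fun_prop) (by fun_prop), pd_add (by fun_prop) (by fun_prop), hk hKs,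
      hk hJs, hk hLs]
  -- the symbol of the Killing equation
  set S₀ : Set (Plane → ℝ) := {K, L, J} with hS₀
  have E (v w : ℝ) := span_abc _ (h.lowered_derivative_mem v w)
  have K0 : SmoothSpan Ω S₀ (pd 0 K) := (E 1 0).congr fun q hq => by
    rw [linpd _ _ _ q hq, linpd _ _ _ q hq]; ring
  have L1 : SmoothSpan Ω S₀ (pd 1 L) := (E 0 1).congr fun q hq => by
    rw [linpd _ _ _ q hq, linpd _ _ _ q hq]; ring
  have half : ContDiffOn ℝ ∞ (fun _ : Plane => (1 / 2 : ℝ)) Ω := contDiffOn_const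
  have neg : ContDiffOn ℝ ∞ (fun _ : Plane => (-1 : ℝ)) Ω := contDiffOn_const
  have neg2 : ContDiffOn ℝ ∞ (fun _ : Plane => (-2 : ℝ)) Ω := contDiffOn_const
  -- The contracted Killing equation is a cubic in (v, w); its values at (1,1) and (1,−1), together
  -- with the outer coefficients, isolate the mixed ones.
  have KJ : SmoothSpan Ω S₀ (fun q => pd 1 K q + 2 * pd 0 J q) :=
    ((((E 1 1).add ((E 1 (-1)).mul neg)).mul half).add (L1.mul neg)).congr fun q hq => by
      simp only [linpd _ _ _ q hq]; ring
  have LJ : SmoothSpan Ω S₀ (fun q => pd 0 L q + 2 * pd 1 J q) :=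
    ((((E 1 1).add (E 1 (-1))).mul half).add (K0.mul neg)).congr fun q hq => by
      simp only [linpd _ _ _ q hq]; ring
  -- prolongation
  have hJ0 := contDiffOn_pd hJs hΩ 0
  have hJ1 := contDiffOn_pd hJs hΩ 1
  have hJ10 := contDiffOn_pd hJ0 hΩ 1
  -- Modulo order zero, the first derivatives of `K` and `L` are zero or multiples of those of `J`.
  -- The derivatives of `J` and its mixed second derivative are therefore the only further unknowns,
  -- and six functions form a closed system.
  set S₁ : Set (Plane → ℝ) := {K, L, J, pd 0 J, pd 1 J} with hS₁
  set S₂ : Set (Plane → ℝ) := {K, L, J, pd 0 J, pd 1 J, pd 1 (pd 0 J)} with hS₂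
  have h01 : S₀ ⊆ S₁ := by rintro f (rfl | rfl | rfl) <;> simp [hS₁]
  have h12 : S₁ ⊆ S₂ := by rintro f (rfl | rfl | rfl | rfl | rfl) <;> simp [hS₂]
  have smooth₂ : ∀ u ∈ S₂, ContDiffOn ℝ ∞ u Ω := by
    rintro f (rfl | rfl | rfl | rfl | rfl | rfl) <;> assumption
  have smooth₁ : ∀ u ∈ S₁, ContDiffOn ℝ ∞ u Ω := fun u hu => smooth₂ u (h12 hu)
  have smooth₀ : ∀ u ∈ S₀, ContDiffOn ℝ ∞ u Ω := fun u hu => smooth₁ u (h01 hu)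
  have mJ0 : SmoothSpan Ω S₁ (pd 0 J) := .mem (by simp [hS₁])
  have mJ1 : SmoothSpan Ω S₁ (pd 1 J) := .mem (by simp [hS₁])
  have K1 : SmoothSpan Ω S₁ (pd 1 K) :=
    ((KJ.mono h01).add (mJ0.mul neg2)).congr fun q hq => by ring
  have L0 : SmoothSpan Ω S₁ (pd 0 L) :=
    ((LJ.mono h01).add (mJ1.mul neg2)).congr fun q hq => by ring
  have d01 (i : Fin 2) : ∀ u ∈ S₀, SmoothSpan Ω S₁ (pd i u) := by
    rintro f (rfl | rfl | rfl) <;> fin_cases i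
    exacts [K0.mono h01, K1, L0, L1.mono h01, mJ0, mJ1]
  have D01 {f : Plane → ℝ} (hf : SmoothSpan Ω S₀ f) (i : Fin 2) : SmoothSpan Ω S₁ (pd i f) :=
    hf.pd hΩ smooth₀ h01 i (d01 i)
  have hadd {f g : Plane → ℝ} (hf : ContDiffOn ℝ ∞ f Ω) (hg : ContDiffOn ℝ ∞ g Ω) (i : Fin 2)
      (q : Plane) (hq : q ∈ Ω) : pd i (fun q => f q + 2 * g q) q = pd i f q + 2 * pd i g q := by
    have hf := differentiableAt_of_contDiffOn hf hΩ hq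
    have hg := differentiableAt_of_contDiffOn hg hΩ hq
    rw [pd_add hf (by fun_prop)]
    congr 1
    exact pd_const_smul hg 2
  -- Symmetry of second derivatives: 2∂₀∂₀J = ∂₀(∂₁K + 2∂₀J) − ∂₁(∂₀K), and both brackets are of
  -- order zero. The case of ∂₁∂₁J is the same with `L`.
  have J00 : SmoothSpan Ω S₁ (pd 0 (pd 0 J)) :=
    (((D01 KJ 0).add ((D01 K0 1).mul neg)).mul half).congr fun q hq => by
      rw [hadd (contDiffOn_pd hKs hΩ 1) hJ0 0 q hq, pd_comm hKs hΩ hq 1 0]; ring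
  have J11 : SmoothSpan Ω S₁ (pd 1 (pd 1 J)) :=
    (((D01 LJ 1).add ((D01 L1 0).mul neg)).mul half).congr fun q hq => by
      rw [hadd (contDiffOn_pd hLs hΩ 0) hJ1 1 q hq, pd_comm hLs hΩ hq 1 0]; ring
  have mR : SmoothSpan Ω S₂ (pd 1 (pd 0 J)) := .mem (by simp [hS₂])
  have J01 : SmoothSpan Ω S₂ (pd 0 (pd 1 J)) := mR.congr fun q hq => pd_comm hJs hΩ hq 0 1
  have d12 (i : Fin 2) : ∀ u ∈ S₁, SmoothSpan Ω S₂ (pd i u) := by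
    rintro f (rfl | rfl | rfl | rfl | rfl)
    · exact (d01 i _ (by simp [hS₀])).mono h12
    · exact (d01 i _ (by simp [hS₀])).mono h12
    · exact (d01 i _ (by simp [hS₀])).mono h12
    · fin_cases i
      exacts [J00.mono h12, mR]
    · fin_cases i
      exacts [J01, J11.mono h12]
  have D12 {f : Plane → ℝ} (hf : SmoothSpan Ω S₁ f) (i : Fin 2) : SmoothSpan Ω S₂ (pd i f) :=
    hf.pd hΩ smooth₁ h12 i (d12 i)
  have d22 (i : Fin 2) : ∀ u ∈ S₂, SmoothSpan Ω S₂ (pd i u) := by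
    rintro f (rfl | rfl | rfl | rfl | rfl | rfl)
    iterate 5 exact d12 i _ (by simp [hS₁])
    fin_cases i
    -- Third derivatives of `J` with two equal indices come from differentiating ∂₀∂₀J or ∂₁∂₁J, so
    -- the prolongation stops here.
    · exact (D12 J00 1).congr fun q hq => pd_comm hJ0 hΩ hq 0 1
    · refine (D12 J11 0).congr fun q hq => ?_
      have e : EqOn (pd 1 (pd 0 J)) (pd 0 (pd 1 J)) Ω := fun x hx => pd_comm hJs hΩ hx 1 0
      exact (pd_congr e hΩ hq 1).trans (pd_comm hJ1 hΩ hq 1 0)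
  -- vanishing at a point
  obtain ⟨p, hp⟩ := hne
  have zpd {f : Plane → ℝ} (hf : ∀ q ∈ O, f q = 0) (i : Fin 2) : ∀ q ∈ O, pd i f q = 0 :=
    fun q hq => (pd_congr (g := fun _ => 0) hf hO hq i).trans (pd_const 0)
  have zK : ∀ q ∈ O, K q = 0 := fun q hq => by simp [hK, lowered, h0 q hq]
  have zL : ∀ q ∈ O, L q = 0 := fun q hq => by simp [hL, lowered, h0 q hq]
  have zJ : ∀ q ∈ O, J q = 0 := fun q hq => by simp [hJ, h0 q hq]
  have z : ∀ u ∈ S₂, u p = 0 := by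
    rintro f (rfl | rfl | rfl | rfl | rfl | rfl)
    exacts [zK p hp, zL p hp, zJ p hp, zpd zJ 0 p hp, zpd zJ 1 p hp, zpd (zpd zJ 0) 1 p hp]
  have fin : S₂.Finite := by simp [hS₂]
  have : Fintype S₂ := fin.fintype
  have hr : range (fun u : S₂ => (u : Plane → ℝ)) = S₂ := Subtype.range_coe
  intro q hq
  have main (f : Plane → ℝ) (hf : f ∈ S₂) : f q = 0 :=
    eq_zero_of_pd_mem_smoothSpan hΩ hconv (u := fun u : S₂ => (u : Plane → ℝ))
      (fun u => smooth₂ u u.2) (fun u i => by rw [hr]; exact d22 i u u.2) (hOΩ hp)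
      (fun u => z u u.2) hq ⟨f, hf⟩
  have e1 := main K (by simp [hS₂])
  have e2 := main L (by simp [hS₂])
  have e3 := main J (by simp [hS₂])
  obtain ⟨i1, i2, i3⟩ := inv q hq
  rw [i1, i2, i3, e1, e2, e3]
  simp

end IsKillingPair

/-! ### Algebra of two binary quadratic forms at a point. -/

section Algebra

variable {𝕜 : Type*} [Field 𝕜]

/-- By Euler's identity, pairing the momentum gradients of H and F with the covector gives 0 and 2n.
If the gradients were dependent, that of H would vanish. Nondegeneracy would then make the covector
zero, and n = 0. -/
lemma gradients_independent [CharZero 𝕜] {A B C a b c u v n : 𝕜}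
    (hD : 4 * A * C - B ^ 2 ≠ 0) (hn : n ≠ 0)
    (hH : A * u ^ 2 + B * (u * v) + C * v ^ 2 = 0)
    (hF : a * u ^ 2 + b * (u * v) + c * v ^ 2 = n) :
    (2 * A * u + B * v) * (b * u + 2 * c * v) - (B * u + 2 * C * v) * (2 * a * u + b * v) ≠ 0 := by
  intro h
  have hv : B * u + 2 * C * v = 0 := by
    have : n * (B * u + 2 * C * v) * 2 = 0 := by
      linear_combination (-u) * h + 2 * (b * u + 2 * c * v) * hH - 2 * (B * u + 2 * C * v) * hF
    simpa [hn] using this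
  have hu : 2 * A * u + B * v = 0 := by
    have : n * (2 * A * u + B * v) * 2 = 0 := by
      linear_combination v * h + 2 * (2 * a * u + b * v) * hH - 2 * (2 * A * u + B * v) * hF
    simpa [hn] using this
  have u0 : u = 0 := by
    have : (4 * A * C - B ^ 2) * u = 0 := by linear_combination 2 * C * hu - B * hv
    simpa [hD] using this
  have v0 : v = 0 := by
    have : (4 * A * C - B ^ 2) * v = 0 := by linear_combination 2 * A * hv - B * hu
    simpa [hD] using this
  exact hn (by rw [← hF, u0, v0]; ring)

/-- If two quadratic forms vanish on the two distinct isotropic lines of the first one, they are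
proportional. -/
lemma proportional_of_isotropic [CharZero 𝕜] {A B C a b c s : 𝕜} (hs : s ^ 2 = B ^ 2 - 4 * A * C)
    (hs0 : s ≠ 0) (ht : B + s ≠ 0)
    (h1 : a * (B + s) ^ 2 - 2 * b * (B + s) * A + 4 * c * A ^ 2 = 0)
    (h2 : 4 * a * C ^ 2 - 2 * b * C * (B + s) + c * (B + s) ^ 2 = 0) :
    a * B = b * A ∧ a * C = c * A ∧ b * C = c * B := by
  have e1 : a * C = c * A := by
    have : (a * C - c * A) * (2 * s * (B + s)) = 0 := by
      linear_combination C * h1 - A * h2 + (a * C - c * A) * hs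
    simpa [hs0, ht, sub_eq_zero] using this
  refine ⟨?_, e1, ?_⟩
  · have : (a * B - b * A) * (2 * (B + s)) = 0 := by
      linear_combination h1 - a * hs + 4 * A * e1
    simpa [ht, sub_eq_zero] using this
  · have : (b * C - c * B) * (2 * (B + s)) = 0 := by
      linear_combination -h2 + c * hs + 4 * C * e1
    simpa [ht, sub_eq_zero] using this

end Algebra

/-- In the definite case one complex isotropic covector suffices, since a real form vanishing there
also vanishes at its conjugate. The real and imaginary parts supply the two equations. -/
lemma proportional_of_complex_isotropic {A B C a b c r : ℝ} (hr : r ^ 2 = 4 * A * C - B ^ 2)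
    (hr0 : r ≠ 0)
    (h : (a : ℂ) * (B + r * Complex.I) ^ 2 - 2 * b * (B + r * Complex.I) * A + 4 * c * A ^ 2 = 0) :
    a * B = b * A ∧ a * C = c * A ∧ b * C = c * B := by
  have hre := congrArg Complex.re h
  have him := congrArg Complex.im h
  simp [pow_two] at hre him
  have hA : A ≠ 0 := by
    rintro rfl
    have : 0 < r ^ 2 := by positivity
    nlinarith [sq_nonneg B]
  have e1 : a * B = b * A := by
    have : (a * B - b * A) * (2 * r) = 0 := by linear_combination him
    simpa [hr0, sub_eq_zero] using this
  have e2 : a * C = c * A := by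
    have : (a * C - c * A) * (4 * A) = 0 := by linear_combination -hre - a * hr + 2 * B * e1
    simpa [hA, sub_eq_zero] using this
  refine ⟨e1, e2, ?_⟩
  have : (b * C - c * B) * A = 0 := by linear_combination B * e2 - C * e1
  simpa [hA, sub_eq_zero] using this

lemma pd_clm {E E' : Type*} [NormedAddCommGroup E] [NormedSpace ℝ E] [NormedAddCommGroup E']
    [NormedSpace ℝ E'] (l : E →L[ℝ] E') {f : Plane → E} {q : Plane}
    (hf : DifferentiableAt ℝ f q) (i : Fin 2) : pd i (fun x => l (f x)) q = l (pd i f q) := by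
  have := (l.hasFDerivAt.comp q hf.hasFDerivAt).fderiv
  simp only [Function.comp_def] at this
  simp [pd, this]

/-- The quadratic form with coefficients `a, b, c`. -/
def quad {A : Type*} [CommRing A] (a b c u v : A) : A := a * u ^ 2 + b * (u * v) + c * v ^ 2

/-! ### Closed isotropic forms and constancy of the proportionality factor. -/

namespace IsKillingPair

variable {Ω : Set Plane} {A B C a b c : Plane → ℝ}

/-- A one-form (real or complex) which is isotropic for the first function of a Killing pair and
on which the second function is a nonzero constant is closed: its graph is a Lagrangian level set
of two commuting functions. -/
theorem closed_of_isotropic (h : IsKillingPair Ω A B C a b c) {𝕜 : Type*} [RCLike 𝕜]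
    {u v : Plane → 𝕜} (hu : ContDiffOn ℝ ∞ u Ω) (hv : ContDiffOn ℝ ∞ v Ω) {n : 𝕜} (hn : n ≠ 0)
    (hH : ∀ q ∈ Ω, quad (A q : 𝕜) (B q) (C q) (u q) (v q) = 0)
    (hF : ∀ q ∈ Ω, quad (a q : 𝕜) (b q) (c q) (u q) (v q) = n) {q : Plane} (hq : q ∈ Ω) :
    pd 0 v q = pd 1 u q := by
  have hd {f : Plane → ℝ} (hf : ContDiffOn ℝ ∞ f Ω) : DifferentiableAt ℝ f q :=
    differentiableAt_of_contDiffOn hf h.isOpen hq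
  have hdc {f : Plane → ℝ} (hf : ContDiffOn ℝ ∞ f Ω) :
      DifferentiableAt ℝ (fun x => (f x : 𝕜)) q :=
    (RCLike.ofRealCLM (K := 𝕜)).differentiableAt.comp q (hd hf)
  have hpc {f : Plane → ℝ} (hf : ContDiffOn ℝ ∞ f Ω) (i : Fin 2) :
      pd i (fun x => (f x : 𝕜)) q = ((pd i f q : ℝ) : 𝕜) :=
    pd_clm (RCLike.ofRealCLM (K := 𝕜)) (hd hf) i
  have hu' := differentiableAt_of_contDiffOn hu h.isOpen hq
  have hv' := differentiableAt_of_contDiffOn hv h.isOpen hq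
  have dH (i : Fin 2) := (pd_quadratic (i := i) (hdc h.hA) (hdc h.hB) (hdc h.hC) hu' hv').symm.trans
    ((pd_congr (g := fun _ => 0) hH h.isOpen hq i).trans (pd_const 0))
  have dF (i : Fin 2) := (pd_quadratic (i := i) (hdc h.ha) (hdc h.hb) (hdc h.hc) hu' hv').symm.trans
    ((pd_congr (g := fun _ => n) hF h.isOpen hq i).trans (pd_const n))
  simp only [hpc h.hA, hpc h.hB, hpc h.hC, hpc h.ha, hpc h.hb, hpc h.hc] at dH dF
  have hne : (4 * (A q : 𝕜) * C q - (B q : 𝕜) ^ 2) ≠ 0 := by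
    exact_mod_cast h.disc_ne q hq
  have hind := gradients_independent hne hn (hH q hq) (hF q hq)
  obtain ⟨h1, h2, h3, h4⟩ := h.commute q hq
  have c1 := congrArg (fun x : ℝ => (x : 𝕜)) h1
  have c2 := congrArg (fun x : ℝ => (x : 𝕜)) h2
  have c3 := congrArg (fun x : ℝ => (x : 𝕜)) h3
  have c4 := congrArg (fun x : ℝ => (x : 𝕜)) h4
  push_cast at c1 c2 c3 c4
  -- Differentiate H(θ) = 0 and F(θ) = n and subtract the bracket evaluated at θ. What remains is
  -- the determinant of the momentum gradients times ∂₀v − ∂₁u.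
  refine sub_eq_zero.1 ((mul_eq_zero.1 ?_).resolve_left hind)
  linear_combination u q ^ 3 * c1 + u q ^ 2 * v q * c2 + u q * v q ^ 2 * c3 + v q ^ 3 * c4
    - (2 * (a q : 𝕜) * u q + b q * v q) * dH 0 - ((b q : 𝕜) * u q + 2 * c q * v q) * dH 1
    + (2 * (A q : 𝕜) * u q + B q * v q) * dF 0 + ((B q : 𝕜) * u q + 2 * C q * v q) * dF 1

/-- If the two functions of a Killing pair are proportional at every point of a convex open set,
then the factor is constant. -/
theorem exists_const_of_proportional (h : IsKillingPair Ω A B C a b c) (hconv : Convex ℝ Ω)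
    (hp : ∀ q ∈ Ω, a q * B q = b q * A q ∧ a q * C q = c q * A q ∧ b q * C q = c q * B q) :
    ∃ k : ℝ, ∀ q ∈ Ω, a q = k * A q ∧ b q = k * B q ∧ c q = k * C q := by
  rcases Ω.eq_empty_or_nonempty with rfl | ⟨p, hpΩ⟩
  · exact ⟨0, by simp⟩
  have hA := h.hA; have hB := h.hB; have hC := h.hC
  have ha := h.ha; have hb := h.hb; have hc := h.hc
  -- Half the trace of F relative to H: a division-free choice of the factor, smooth even where
  -- single coefficients of H vanish.
  set l : Plane → ℝ := fun q =>
    (2 * a q * C q - b q * B q + 2 * c q * A q) / (4 * A q * C q - B q ^ 2) with hl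
  have hls : ContDiffOn ℝ ∞ l Ω := .div (by fun_prop) (by fun_prop) h.disc_ne
  have el : ∀ q ∈ Ω, a q = l q * A q ∧ b q = l q * B q ∧ c q = l q * C q := by
    intro q hq
    obtain ⟨h1, h2, h3⟩ := hp q hq
    have := h.disc_ne q hq
    simp only [hl]
    refine ⟨?_, ?_, ?_⟩ <;> rw [div_mul_eq_mul_div, eq_div_iff this]
    · linear_combination -B q * h1 + 2 * A q * h2
    · linear_combination -2 * C q * h1 + 2 * A q * h3
    · linear_combination -2 * C q * h2 + B q * h3
  have hd : ∀ q ∈ Ω, ∀ i, pd i l q = 0 := by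
    intro q hq
    have hdf {f : Plane → ℝ} (hf : ContDiffOn ℝ ∞ f Ω) : DifferentiableAt ℝ f q :=
      differentiableAt_of_contDiffOn hf h.isOpen hq
    have da (i : Fin 2) := (pd_congr (fun x hx => (el x hx).1) h.isOpen hq i).trans
      (pd_mul (hdf hls) (hdf hA))
    have db (i : Fin 2) := (pd_congr (fun x hx => (el x hx).2.1) h.isOpen hq i).trans
      (pd_mul (hdf hls) (hdf hB))
    have dc (i : Fin 2) := (pd_congr (fun x hx => (el x hx).2.2) h.isOpen hq i).trans
      (pd_mul (hdf hls) (hdf hC))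
    obtain ⟨h1, h2, h3, h4⟩ := h.commute q hq
    obtain ⟨e1, e2, e3⟩ := el q hq
    rw [e1, e2, da, da] at h1
    rw [e1, e2, e3, da, da, db, db] at h2
    rw [e1, e2, e3, db, db, dc, dc] at h3
    rw [e2, e3, dc, dc] at h4
    have hD := h.disc_ne q hq
    -- `(x, y)` is the momentum gradient of H at dl. For F = lH the bracket is, up to sign, H·(x p₀
    -- + y p₁), and a product of polynomials vanishes only if a factor does. Nondegeneracy then
    -- gives dl = 0.
    set x := 2 * A q * pd 0 l q + B q * pd 1 l q with hx
    set y := B q * pd 0 l q + 2 * C q * pd 1 l q with hy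
    have k1 : A q * x = 0 := by rw [hx]; linear_combination -h1
    have k2 : B q * x + A q * y = 0 := by rw [hx, hy]; linear_combination -h2
    have k3 : C q * x + B q * y = 0 := by rw [hx, hy]; linear_combination -h3
    have k4 : C q * y = 0 := by rw [hy]; linear_combination -h4
    have x0 : x = 0 := by
      by_contra hne
      have A0 : A q = 0 := by simpa [hne] using k1
      have B0 : B q = 0 := by simpa [hne, A0] using k2
      exact hD (by rw [A0, B0]; ring)
    have y0 : y = 0 := by
      by_contra hne
      have C0 : C q = 0 := by simpa [hne] using k4
      have B0 : B q = 0 := by simpa [hne, C0] using k3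
      exact hD (by rw [C0, B0]; ring)
    have l0 : (4 * A q * C q - B q ^ 2) * pd 0 l q = 0 := by
      linear_combination 2 * C q * (hx.symm.trans x0) - B q * (hy.symm.trans y0)
    have l1 : (4 * A q * C q - B q ^ 2) * pd 1 l q = 0 := by
      linear_combination 2 * A q * (hy.symm.trans y0) - B q * (hx.symm.trans x0)
    intro i
    fin_cases i
    · simpa [hD] using l0
    · simpa [hD] using l1
  have hconst : ∀ q ∈ Ω, l q = l p := fun q hq =>
    h.isOpen.is_const_of_fderiv_eq_zero (𝕜 := ℝ) hconv.isPreconnected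
      (hls.differentiableOn (by simp))
      (fun x hx => by
        ext v
        have := fderiv_apply_eq_pd l x v
        simpa [hd x hx] using this) hq hpΩ
  exact ⟨l p, fun q hq => by rw [← hconst q hq]; exact el q hq⟩

end IsKillingPair

lemma pd_div {f g : Plane → ℝ} {q : Plane} (hf : DifferentiableAt ℝ f q)
    (hg : DifferentiableAt ℝ g q) (h0 : g q ≠ 0) (i : Fin 2) :
    pd i (fun x => f x / g x) q = (pd i f q * g q - f q * pd i g q) / g q ^ 2 := by
  have h : HasFDerivAt (fun x => f x * (g x)⁻¹)
      (f q • (-(g q ^ 2)⁻¹ • fderiv ℝ g q) + (g q)⁻¹ • fderiv ℝ f q) q :=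
    hf.hasFDerivAt.mul ((hasDerivAt_inv h0).comp_hasFDerivAt q hg.hasFDerivAt)
  simp only [div_eq_mul_inv]
  rw [pd, h.fderiv]
  simp [pd]
  field_simp
  ring

/-! ### Charts -/

/-- The map of the plane with components `x` and `y`. -/
noncomputable def pairMap (x y : Plane → ℝ) (q : Plane) : Plane := !₂[x q, y q]

lemma contDiffOn_pairMap {x y : Plane → ℝ} {O : Set Plane} (hx : ContDiffOn ℝ ∞ x O)
    (hy : ContDiffOn ℝ ∞ y O) : ContDiffOn ℝ ∞ (pairMap x y) O := by
  rw [contDiffOn_euclidean]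
  intro i
  fin_cases i
  · simpa [pairMap] using hx
  · simpa [pairMap] using hy

lemma fderiv_pairMap {x y : Plane → ℝ} {q : Plane} (hx : DifferentiableAt ℝ x q)
    (hy : DifferentiableAt ℝ y q) (v : Plane) :
    fderiv ℝ (pairMap x y) q v = !₂[fderiv ℝ x q v, fderiv ℝ y q v] := by
  have hd : DifferentiableAt ℝ (pairMap x y) q := by
    rw [differentiableAt_euclidean]
    intro i
    fin_cases i
    · simpa [pairMap] using hx
    · simpa [pairMap] using hy
  have h (i : Fin 2) := ((EuclideanSpace.proj i : Plane →L[ℝ] ℝ).hasFDerivAt.comp q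
    hd.hasFDerivAt).fderiv
  have h0 : fderiv ℝ x q = _ := h 0
  have h1 : fderiv ℝ y q = _ := h 1
  ext i
  fin_cases i
  · simp [h0]
  · simp [h1]

/-- The inverse function theorem for a pair of functions with independent differentials. -/
lemma exists_local_coordinates {x y : Plane → ℝ} {O : Set Plane} (hO : IsOpen O)
    (hx : ContDiffOn ℝ ∞ x O) (hy : ContDiffOn ℝ ∞ y O) {p : Plane} (hp : p ∈ O)
    (hdet : pd 0 x p * pd 1 y p - pd 1 x p * pd 0 y p ≠ 0) :
    ∃ e : OpenPartialHomeomorph Plane Plane, ∃ r > 0, e.source ⊆ O ∧ p ∈ e.source ∧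
      ⇑e = pairMap x y ∧ e.target = Metric.ball (pairMap x y p) r ∧
      ContDiffOn ℝ ∞ e.symm e.target := by
  have hs := contDiffOn_pairMap hx hy
  have equiv (q : Plane) (hq : q ∈ O)
      (hdet : pd 0 x q * pd 1 y q - pd 1 x q * pd 0 y q ≠ 0) :
      ∃ f' : Plane ≃L[ℝ] Plane, HasFDerivAt (pairMap x y) (f' : Plane →L[ℝ] Plane) q := by
    have hx' := differentiableAt_of_contDiffOn hx hO hq
    have hy' := differentiableAt_of_contDiffOn hy hO hq
    have hinj : Function.Injective (fderiv ℝ (pairMap x y) q : Plane →ₗ[ℝ] Plane) := by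
      rw [injective_iff_map_eq_zero]
      intro v hv
      have hv : fderiv ℝ (pairMap x y) q v = 0 := hv
      rw [fderiv_pairMap hx' hy', fderiv_apply_eq_pd, fderiv_apply_eq_pd] at hv
      have e0 := congrArg (fun w : Plane => w 0) hv
      have e1 := congrArg (fun w : Plane => w 1) hv
      simp at e0 e1
      have v0 : (pd 0 x q * pd 1 y q - pd 1 x q * pd 0 y q) * v 0 = 0 := by
        linear_combination pd 1 y q * e0 - pd 1 x q * e1
      have v1 : (pd 0 x q * pd 1 y q - pd 1 x q * pd 0 y q) * v 1 = 0 := by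
        linear_combination pd 0 x q * e1 - pd 0 y q * e0
      ext i
      fin_cases i
      · simpa [hdet] using v0
      · simpa [hdet] using v1
    refine ⟨(LinearEquiv.ofInjectiveEndo _ hinj).toContinuousLinearEquiv, ?_⟩
    have := (differentiableAt_of_contDiffOn hs hO hq).hasFDerivAt
    exact this
  -- Smoothness of the inverse on the whole target needs an invertible derivative at every point of
  -- the source, not only at `p`.
  set O' : Set Plane := {q ∈ O | pd 0 x q * pd 1 y q - pd 1 x q * pd 0 y q ≠ 0} with hO'
  have hO'o : IsOpen O' := by
    have hc : ContinuousOn (fun q => pd 0 x q * pd 1 y q - pd 1 x q * pd 0 y q) O := by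
      have := (contDiffOn_pd hx hO 0).continuousOn
      have := (contDiffOn_pd hx hO 1).continuousOn
      have := (contDiffOn_pd hy hO 0).continuousOn
      have := (contDiffOn_pd hy hO 1).continuousOn
      fun_prop
    exact hc.isOpen_inter_preimage hO isOpen_compl_singleton
  obtain ⟨f', hf'⟩ := equiv p hp hdet
  have hcd := hs.contDiffAt (hO.mem_nhds hp)
  set e₀ := hcd.toOpenPartialHomeomorph (pairMap x y) hf' (by simp) with he₀
  set e₁ := e₀.restrOpen O' hO'o with he₁
  have hpe : p ∈ e₁.source := by
    simp only [he₁, OpenPartialHomeomorph.restrOpen_source]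
    exact ⟨hcd.mem_toOpenPartialHomeomorph_source hf' (by simp), hp, hdet⟩
  have hcoe : ⇑e₁ = pairMap x y := rfl
  have hsrc : e₁.source ⊆ O' := by
    simp only [he₁, OpenPartialHomeomorph.restrOpen_source]
    exact inter_subset_right
  obtain ⟨r, hr, hball⟩ := Metric.isOpen_iff.1 e₁.open_target _ (e₁.map_source hpe)
  -- Shrinking on the side of the target makes the coordinate domain a disc, as the convexity
  -- arguments require.
  set e₂ := (e₁.symm.restrOpen (Metric.ball (e₁ p) r) Metric.isOpen_ball).symm with he₂
  have ht : e₂.target = Metric.ball (e₁ p) r := by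
    simp only [he₂, OpenPartialHomeomorph.symm_target, OpenPartialHomeomorph.restrOpen_source,
      OpenPartialHomeomorph.symm_source]
    exact inter_eq_self_of_subset_right hball
  have hcoe₂ : ⇑e₂ = pairMap x y := rfl
  have hsymm : ⇑e₂.symm = ⇑e₁.symm := rfl
  have hsrc₂ : e₂.source ⊆ O' := by
    intro q hq
    have h1 := e₂.map_source hq
    rw [ht] at h1
    have h2 := e₁.map_target (hball h1)
    rw [← hsymm, e₂.left_inv hq] at h2
    exact hsrc h2
  refine ⟨e₂, r, hr, fun q hq => (hsrc₂ hq).1, ?_, hcoe₂, ht, fun q hq => ?_⟩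
  · have h1 : e₁ p ∈ e₂.target := by rw [ht]; exact Metric.mem_ball_self hr
    have h2 := e₂.map_target h1
    rwa [hsymm, e₁.left_inv hpe] at h2
  · have hq' := e₂.map_target hq
    obtain ⟨f', hf'⟩ := equiv _ (hsrc₂ hq').1 (hsrc₂ hq').2
    exact (e₂.contDiffAt_symm hq hf' (hs.contDiffAt (hO.mem_nhds (hsrc₂ hq').1))).contDiffWithinAt

/-! ### Covectors, the metric and the Hamiltonian in a chart. -/

section Manifold

variable {M : Type*} [TopologicalSpace M] [ChartedSpace Plane M] 
  {φ : OpenPartialHomeomorph M Plane}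

lemma mdifferentiable_of_mem_maximalAtlas (hφ : φ ∈ IsManifold.maximalAtlas (𝓡 2) ∞ M) :
    φ.MDifferentiable (𝓡 2) (𝓡 2) :=
  ⟨(contMDiffOn_of_mem_maximalAtlas hφ).mdifferentiableOn (by simp),
    (contMDiffOn_symm_of_mem_maximalAtlas hφ).mdifferentiableOn (by simp)⟩

/-- The derivative of a chart, as a map to the plane. -/
noncomputable def chartDeriv (φ : OpenPartialHomeomorph M Plane) (p : M) :
    TangentSpace (𝓡 2) p →L[ℝ] Plane :=
  mfderiv (𝓡 2) (𝓡 2) φ p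

/-- The derivative of the inverse of a chart, as a map from the plane. -/
noncomputable def chartSymmDeriv (φ : OpenPartialHomeomorph M Plane) (q : Plane) :
    Plane →L[ℝ] TangentSpace (𝓡 2) (φ.symm q) :=
  mfderiv (𝓡 2) (𝓡 2) φ.symm q

lemma covec_apply (φ : OpenPartialHomeomorph M Plane) (q P : Plane)
    (w : TangentSpace (𝓡 2) (φ.symm q)) : covec φ q P w =
      P 0 * chartDeriv φ (φ.symm q) w 0 + P 1 * chartDeriv φ (φ.symm q) w 1 := by
  simp only [covec, Fin.sum_univ_two, LinearMap.add_apply, LinearMap.smul_apply, smul_eq_mul]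
  rfl

lemma chartDeriv_tangentVec (hφ : φ ∈ IsManifold.maximalAtlas (𝓡 2) ∞ M) {q : Plane}
    (hq : q ∈ φ.target) (v : Plane) : chartDeriv φ (φ.symm q) (tangentVec φ q v) = v :=
  congrArg (fun l => l v) ((mdifferentiable_of_mem_maximalAtlas hφ).comp_symm_deriv hq)

lemma tangentVec_chartDeriv (hφ : φ ∈ IsManifold.maximalAtlas (𝓡 2) ∞ M) {q : Plane}
    (hq : q ∈ φ.target) (w : TangentSpace (𝓡 2) (φ.symm q)) :
    tangentVec φ q (chartDeriv φ (φ.symm q) w) = w := by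
  have h := (mdifferentiable_of_mem_maximalAtlas hφ).symm_comp_deriv (φ.map_target hq)
  rw [φ.right_inv hq] at h
  exact congrArg (fun l => l w) h

lemma covec_tangentVec (hφ : φ ∈ IsManifold.maximalAtlas (𝓡 2) ∞ M) {q : Plane}
    (hq : q ∈ φ.target) (P v : Plane) :
    covec φ q P (tangentVec φ q v) = P 0 * v 0 + P 1 * v 1 := by
  rw [covec_apply, chartDeriv_tangentVec hφ hq]

lemma tangentVec_eq_add (φ : OpenPartialHomeomorph M Plane) (q v : Plane) : tangentVec φ q v =
    v 0 • tangentVec φ q (EuclideanSpace.single 0 1) +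
      v 1 • tangentVec φ q (EuclideanSpace.single 1 1) := by
  have hv : v = v 0 • EuclideanSpace.single 0 1 + v 1 • EuclideanSpace.single 1 1 := by
    ext k; fin_cases k <;> simp
  change chartSymmDeriv φ q v = v 0 • chartSymmDeriv φ q _ + v 1 • chartSymmDeriv φ q _
  rw [← map_smul, ← map_smul, ← map_add, ← hv]

lemma covec_surjective (hφ : φ ∈ IsManifold.maximalAtlas (𝓡 2) ∞ M) {q : Plane}
    (hq : q ∈ φ.target) : Function.Surjective (covec φ q) := by
  intro ξ
  refine ⟨!₂[ξ (tangentVec φ q (EuclideanSpace.single 0 1)),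
    ξ (tangentVec φ q (EuclideanSpace.single 1 1))], ?_⟩
  refine LinearMap.ext fun w => ?_
  obtain ⟨v, rfl⟩ : ∃ v, tangentVec φ q v = w := ⟨_, tangentVec_chartDeriv hφ hq w⟩
  rw [covec_tangentVec hφ hq, tangentVec_eq_add φ q v, map_add, map_smul, map_smul]
  simp
  ring

/-- The expression of a metric and of its Hamiltonian in a chart. -/
theorem exists_hamiltonian_coefficients (g : PseudoRiemannianMetric M)
    (hφ : φ ∈ IsManifold.maximalAtlas (𝓡 2) ∞ M) :
    ∃ A B C : Plane → ℝ, ContDiffOn ℝ ∞ A φ.target ∧ ContDiffOn ℝ ∞ B φ.target ∧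
      ContDiffOn ℝ ∞ C φ.target ∧ (∀ q ∈ φ.target, 4 * A q * C q - B q ^ 2 ≠ 0) ∧
      (∀ q ∈ φ.target, ∀ P : Plane, inCoords g.hamiltonian φ q P =
        A q * P 0 ^ 2 + B q * (P 0 * P 1) + C q * P 1 ^ 2) ∧
      (∀ q ∈ φ.target, ∀ v : Plane, g.lineElement φ q v =
        (2 * C q * v 0 ^ 2 - 2 * B q * (v 0 * v 1) + 2 * A q * v 1 ^ 2) /
          (4 * A q * C q - B q ^ 2)) := by
  set G : Fin 2 → Fin 2 → Plane → ℝ := fun i j q => g.form (φ.symm q)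
      (tangentVec φ q (EuclideanSpace.single i 1))
      (tangentVec φ q (EuclideanSpace.single j 1)) with hG
  have hGs (i j) : ContDiffOn ℝ ∞ (G i j) φ.target := g.smooth φ hφ i j
  have hsymm (q) : G 1 0 q = G 0 1 q := (g.symm (φ.symm q)).eq _ _
  have hform (q v w : Plane) : g.form (φ.symm q) (tangentVec φ q v) (tangentVec φ q w) =
      v 0 * w 0 * G 0 0 q + (v 0 * w 1 + v 1 * w 0) * G 0 1 q + v 1 * w 1 * G 1 1 q := by
    rw [tangentVec_eq_add φ q v, tangentVec_eq_add φ q w]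
    simp only [map_add, map_smul, LinearMap.add_apply, LinearMap.smul_apply, smul_eq_mul]
    have := hsymm q
    simp only [hG] at this ⊢
    rw [this]
    ring
  have hdet : ∀ q ∈ φ.target, G 0 0 q * G 1 1 q - G 0 1 q ^ 2 ≠ 0 := by
    intro q hq h0
    have key (v : Plane) (hv : ∀ w : Plane, v 0 * w 0 * G 0 0 q + (v 0 * w 1 + v 1 * w 0) * G 0 1 q
        + v 1 * w 1 * G 1 1 q = 0) : v = 0 := by
      have hker : tangentVec φ q v = 0 := by
        refine (g.nondegenerate (φ.symm q)).1 _ fun w => ?_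
        rw [← tangentVec_chartDeriv hφ hq w, hform]
        exact hv _
      have := chartDeriv_tangentVec hφ hq v
      rw [hker, map_zero] at this
      exact this.symm
    -- With zero determinant the columns of the adjugate lie in the kernel of the Gram matrix. They
    -- must vanish, so the whole matrix is zero, and then every vector is in the kernel.
    have k1 := key !₂[G 1 1 q, -G 0 1 q] (fun w => by simp; linear_combination w 0 * h0)
    have k2 := key !₂[-G 0 1 q, G 0 0 q] (fun w => by simp; linear_combination w 1 * h0)
    have z11 : G 1 1 q = 0 := by simpa using congrArg (fun v : Plane => v 0) k1
    have z01 : G 0 1 q = 0 := by simpa using congrArg (fun v : Plane => v 1) k1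
    have z00 : G 0 0 q = 0 := by simpa using congrArg (fun v : Plane => v 1) k2
    have k3 := key !₂[1, 0] (fun w => by simp [z11, z01, z00])
    simpa using congrArg (fun v : Plane => v 0) k3
  set D : Plane → ℝ := fun q => G 0 0 q * G 1 1 q - G 0 1 q ^ 2 with hD
  have hG00 := hGs 0 0; have hG01 := hGs 0 1; have hG11 := hGs 1 1
  have hDs : ContDiffOn ℝ ∞ D φ.target := by fun_prop
  have hdisc (q) (hq : q ∈ φ.target) : 4 * (G 1 1 q / (2 * D q)) * (G 0 0 q / (2 * D q)) -
      (-G 0 1 q / D q) ^ 2 = 1 / D q := by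
    have h0 := hdet q hq
    have : G 0 0 q * G 1 1 q - G 0 1 q ^ 2 = D q := rfl
    rw [this] at h0
    field_simp
    linear_combination 4 * this
  -- The coefficients of ½ gⁱʲ pᵢpⱼ; the off-diagonal entry occurs twice, hence the missing 2 in the
  -- middle.
  refine ⟨fun q => G 1 1 q / (2 * D q), fun q => -G 0 1 q / D q, fun q => G 0 0 q / (2 * D q),
    .div (by fun_prop) (by fun_prop) fun q hq => mul_ne_zero two_ne_zero (hdet q hq),
    .div (by fun_prop) (by fun_prop) hdet,
    .div (by fun_prop) (by fun_prop) fun q hq => mul_ne_zero two_ne_zero (hdet q hq),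
    fun q hq => ?_, fun q hq P => ?_, fun q hq v => ?_⟩
  · rw [hdisc q hq]
    exact one_div_ne_zero (hdet q hq)
  · have h0 := hdet q hq
    have hDq : G 0 0 q * G 1 1 q - G 0 1 q ^ 2 = D q := rfl
    rw [hDq] at h0
    set w : Plane := !₂[(G 1 1 q * P 0 - G 0 1 q * P 1) / D q,
      (G 0 0 q * P 1 - G 0 1 q * P 0) / D q] with hw
    have hflat : (g.form (φ.symm q)).toDual (g.nondegenerate _) (tangentVec φ q w) =
        covec φ q P := by
      refine LinearMap.ext fun u => ?_
      obtain ⟨v, rfl⟩ : ∃ v, tangentVec φ q v = u := ⟨_, tangentVec_chartDeriv hφ hq u⟩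
      rw [LinearMap.BilinForm.toDual_def, hform, covec_tangentVec hφ hq]
      simp [hw]
      field_simp
      linear_combination (P 0 * v 0 + P 1 * v 1) * hDq
    rw [inCoords, PseudoRiemannianMetric.hamiltonian, ← hflat, LinearEquiv.symm_apply_apply,
      hflat, covec_tangentVec hφ hq]
    simp [hw]
    field_simp
    ring
  · have h0 := hdet q hq
    have hDq : G 0 0 q * G 1 1 q - G 0 1 q ^ 2 = D q := rfl
    rw [hDq] at h0
    rw [hdisc q hq, PseudoRiemannianMetric.lineElement, hform]
    field_simp
    ring

/-- A pair of functions with independent differentials defines a chart whose image is a disc, and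
functions on the cotangent bundle transform by pulling back covectors. -/
theorem exists_chart [IsManifold (𝓡 2) ∞ M] (hφ : φ ∈ IsManifold.maximalAtlas (𝓡 2) ∞ M)
    {O : Set Plane} (hO : IsOpen O)
    (hOφ : O ⊆ φ.target) {x y : Plane → ℝ} (hx : ContDiffOn ℝ ∞ x O) (hy : ContDiffOn ℝ ∞ y O)
    {p : Plane} (hp : p ∈ O) (hdet : pd 0 x p * pd 1 y p - pd 1 x p * pd 0 y p ≠ 0) :
    ∃ φ' ∈ IsManifold.maximalAtlas (𝓡 2) ∞ M, ∃ r > 0,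
      φ'.target = Metric.ball (pairMap x y p) r ∧ φ.symm p ∈ φ'.source ∧
      φ'.symm (pairMap x y p) = φ.symm p ∧
      ∃ τ : Plane → Plane, ∀ q ∈ φ'.target, τ q ∈ O ∧ x (τ q) = q 0 ∧ y (τ q) = q 1 ∧
        ∀ (F : CotangentFunction M) (P : Plane), inCoords F φ' q P = inCoords F φ (τ q)
          !₂[P 0 * pd 0 x (τ q) + P 1 * pd 0 y (τ q), P 0 * pd 1 x (τ q) + P 1 * pd 1 y (τ q)] := by
  obtain ⟨e, r, hr, heO, hpe, hcoe, het, hes⟩ := exists_local_coordinates hO hx hy hp hdet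
  have hs := contDiffOn_pairMap hx hy
  have hmap : ∀ q ∈ e.target, e.symm q ∈ φ.target := fun q hq => hOφ (heO (e.map_target hq))
  have ht : (φ.trans e).target = e.target := by
    rw [OpenPartialHomeomorph.trans_target]
    exact inter_eq_self_of_subset_left hmap
  have hmem : φ.trans e ∈ IsManifold.maximalAtlas (𝓡 2) ∞ M := by
    rw [IsManifold.mem_maximalAtlas_iff_contMDiffOn]
    constructor
    · have h1 : ContMDiffOn (𝓡 2) (𝓡 2) ∞ e e.source := by
        rw [contMDiffOn_iff_contDiffOn, hcoe]
        exact hs.mono heO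
      refine h1.comp ((contMDiffOn_of_mem_maximalAtlas hφ).mono ?_) ?_
      · exact inter_subset_left
      · exact inter_subset_right
    · have h1 : ContMDiffOn (𝓡 2) (𝓡 2) ∞ e.symm e.target := by
        rw [contMDiffOn_iff_contDiffOn]
        exact hes
      rw [ht]
      exact (contMDiffOn_symm_of_mem_maximalAtlas hφ).comp h1 hmap
  refine ⟨φ.trans e, hmem, r, hr, ht.trans het, ?_, ?_, e.symm, fun q hq => ?_⟩
  · rw [OpenPartialHomeomorph.trans_source]
    refine ⟨φ.map_target (hOφ hp), ?_⟩
    rw [mem_preimage, φ.right_inv (hOφ hp)]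
    exact hpe
  · change φ.symm (e.symm (pairMap x y p)) = φ.symm p
    rw [← hcoe, e.left_inv hpe]
  · rw [ht] at hq
    have hO' := heO (e.map_target hq)
    have hright : pairMap x y (e.symm q) = q := by rw [← hcoe]; exact e.right_inv hq
    refine ⟨hO', ?_, ?_, fun F P => ?_⟩
    · simpa [pairMap] using congrArg (fun v : Plane => v 0) hright
    · simpa [pairMap] using congrArg (fun v : Plane => v 1) hright
    change F (φ.symm (e.symm q)) (covec (φ.trans e) q P) = F (φ.symm (e.symm q)) _
    congr 1
    refine LinearMap.ext fun w => ?_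
    have hφd := (mdifferentiable_of_mem_maximalAtlas hφ).mdifferentiableAt
      (φ.map_target (hmap q hq))
    have hed : DifferentiableAt ℝ e (φ (φ.symm (e.symm q))) := by
      rw [hcoe, φ.right_inv (hmap q hq)]; exact differentiableAt_of_contDiffOn hs hO hO'
    have hc : chartDeriv (φ.trans e) (φ.symm (e.symm q)) w =
        fderiv ℝ e (φ (φ.symm (e.symm q))) (chartDeriv φ (φ.symm (e.symm q)) w) := by
      rw [← mfderiv_eq_fderiv]
      exact congrArg (fun l => l w)
        (mfderiv_comp (φ.symm (e.symm q)) hed.mdifferentiableAt hφd)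
    set v : Plane := chartDeriv φ (φ.symm (e.symm q)) w
    refine (covec_apply (φ.trans e) q P w).trans (Eq.trans ?_ (covec_apply φ _ _ w).symm)
    change P 0 * chartDeriv (φ.trans e) (φ.symm (e.symm q)) w 0 +
      P 1 * chartDeriv (φ.trans e) (φ.symm (e.symm q)) w 1 =
      (P 0 * pd 0 x (e.symm q) + P 1 * pd 0 y (e.symm q)) * v 0 +
        (P 0 * pd 1 x (e.symm q) + P 1 * pd 1 y (e.symm q)) * v 1
    rw [hc, φ.right_inv (hmap q hq), hcoe, fderiv_pairMap (differentiableAt_of_contDiffOn hx hO hO')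
        (differentiableAt_of_contDiffOn hy hO hO'), fderiv_apply_eq_pd, fderiv_apply_eq_pd]
    simp
    ring

end Manifold

/-! ### Normal forms on discs -/

/-- A disc contains the projections of its points to the two axes through its centre. Functions of
one coordinate can thus be read off along these axes. -/
lemma mem_ball_of_abs_le {p q w : Plane} {r : ℝ} (hq : q ∈ Metric.ball p r)
    (h : ∀ i, |w i - p i| ≤ |q i - p i|) : w ∈ Metric.ball p r := by
  rw [Metric.mem_ball] at hq ⊢
  refine lt_of_le_of_lt ?_ hq
  rw [EuclideanSpace.dist_eq, EuclideanSpace.dist_eq]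
  refine Real.sqrt_le_sqrt (Finset.sum_le_sum fun i _ => ?_)
  rw [Real.dist_eq, Real.dist_eq]
  exact pow_le_pow_left₀ (abs_nonneg _) (h i) 2

lemma fst_slice_mem_ball {p q : Plane} {r : ℝ} (hq : q ∈ Metric.ball p r) :
    (!₂[q 0, p 1] : Plane) ∈ Metric.ball p r :=
  mem_ball_of_abs_le hq fun i => by fin_cases i <;> simp

lemma snd_slice_mem_ball {p q : Plane} {r : ℝ} (hq : q ∈ Metric.ball p r) :
    (!₂[p 0, q 1] : Plane) ∈ Metric.ball p r :=
  mem_ball_of_abs_le hq fun i => by fin_cases i <;> simp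

lemma contDiffOn_fst_slice {f : Plane → ℝ} {p : Plane} {r : ℝ}
    (hf : ContDiffOn ℝ ∞ f (Metric.ball p r)) :
    ContDiffOn ℝ ∞ (fun t : ℝ => f !₂[t, p 1]) ((fun q : Plane => q 0) '' Metric.ball p r) := by
  have h : ContDiff ℝ ∞ (fun t : ℝ => (!₂[t, p 1] : Plane)) := by
    rw [contDiff_euclidean]
    intro i
    fin_cases i
    · change ContDiff ℝ ∞ (fun t : ℝ => t)
      exact contDiff_id
    · simpa using contDiff_const
  refine hf.comp h.contDiffOn ?_
  rintro _ ⟨q, hq, rfl⟩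
  exact fst_slice_mem_ball hq

lemma contDiffOn_snd_slice {f : Plane → ℝ} {p : Plane} {r : ℝ}
    (hf : ContDiffOn ℝ ∞ f (Metric.ball p r)) :
    ContDiffOn ℝ ∞ (fun t : ℝ => f !₂[p 0, t]) ((fun q : Plane => q 1) '' Metric.ball p r) := by
  have h : ContDiff ℝ ∞ (fun t : ℝ => (!₂[p 0, t] : Plane)) := by
    rw [contDiff_euclidean]
    intro i
    fin_cases i
    · simpa using contDiff_const
    · change ContDiff ℝ ∞ (fun t : ℝ => t)
      exact contDiff_id
  refine hf.comp h.contDiffOn ?_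
  rintro _ ⟨q, hq, rfl⟩
  exact snd_slice_mem_ball hq

/-- The line element of the metric whose Hamiltonian has coefficients `A, B, C`. -/
def IsLineElement (Ω : Set Plane) (A B C : Plane → ℝ) (ds : Plane → Plane → ℝ) : Prop :=
  ∀ q ∈ Ω, ∀ v : Plane, ds q v =
    (2 * C q * v 0 ^ 2 - 2 * B q * (v 0 * v 1) + 2 * A q * v 1 ^ 2) / (4 * A q * C q - B q ^ 2)

namespace IsKillingPair

variable {A B C a b c : Plane → ℝ} {p : Plane} {r : ℝ} {ds F : Plane → Plane → ℝ}

/-- The conformal factor of the metric is 1/(2A). With c = 1 + s a it equals X − Y for X = (1 + s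
a)/(2A) and Y = s a/(2A). The first two bracket equations say exactly that ∂_xY = 0 and ∂_yX = 0. -/
theorem isLiouville (h : IsKillingPair (Metric.ball p r) A B C a b c)
    (hds : IsLineElement (Metric.ball p r) A B C ds)
    (hF : ∀ q ∈ Metric.ball p r, ∀ P : Plane, F q P = quad (a q) (b q) (c q) (P 0) (P 1))
    {s : ℝ} (hs : s ^ 2 = 1) (hB : ∀ q ∈ Metric.ball p r, B q = 0)
    (hC : ∀ q ∈ Metric.ball p r, C q = s * A q) (hb : ∀ q ∈ Metric.ball p r, b q = 0)
    (hc : ∀ q ∈ Metric.ball p r, c q = 1 + s * a q) :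
    IsLiouville s (Metric.ball p r) ds F := by
  have hA0 : ∀ q ∈ Metric.ball p r, A q ≠ 0 := fun q hq h0 =>
    h.disc_ne q hq (by rw [hB q hq, h0]; ring)
  have h2A : ∀ q ∈ Metric.ball p r, 2 * A q ≠ 0 := fun q hq => mul_ne_zero two_ne_zero (hA0 q hq)
  have hAs := h.hA
  have has := h.ha
  have hs0 : s ≠ 0 := by rintro rfl; simp at hs
  set f : Plane → ℝ := fun q => (1 + s * a q) / (2 * A q) with hf
  set k : Plane → ℝ := fun q => (s * a q) / (2 * A q) with hk
  have hfs : ContDiffOn ℝ ∞ f (Metric.ball p r) := .div (by fun_prop) (by fun_prop) h2A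
  have hks : ContDiffOn ℝ ∞ k (Metric.ball p r) := .div (by fun_prop) (by fun_prop) h2A
  have hpd {q : Plane} (hq : q ∈ Metric.ball p r) : pd 1 f q = 0 ∧ pd 0 k q = 0 := by
    have dA := differentiableAt_of_contDiffOn hAs h.isOpen hq
    have da := differentiableAt_of_contDiffOn has h.isOpen hq
    have e1 (i) : pd i (fun x => 2 * A x) q = 2 * pd i A q := pd_const_smul dA 2
    have e2 (i) : pd i (fun x => s * a x) q = s * pd i a q := pd_const_smul da s
    have e3 (i) : pd i (fun x => 1 + s * a x) q = s * pd i a q := by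
      rw [pd_add (by fun_prop) (by fun_prop), pd_const, e2, zero_add]
    obtain ⟨h1, h2, -, -⟩ := h.commute q hq
    rw [hB q hq, hb q hq] at h1
    have eB (i) : pd i B q = 0 := (pd_congr hB h.isOpen hq i).trans (pd_const 0)
    have eb (i) : pd i b q = 0 := (pd_congr hb h.isOpen hq i).trans (pd_const 0)
    rw [eB, eB, eb, eb, hB q hq, hb q hq, hc q hq, hC q hq] at h2
    constructor
    · rw [pd_div (by fun_prop) (by fun_prop) (h2A q hq), e1, e3, div_eq_zero_iff]
      left
      linear_combination -h2
    · rw [pd_div (by fun_prop) (by fun_prop) (h2A q hq), e1, e2, div_eq_zero_iff]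
      left
      linear_combination -s * h1
  have hconv := convex_ball p r
  have valf {q : Plane} (hq : q ∈ Metric.ball p r) : f !₂[q 0, p 1] = f q :=
    eq_of_pd_eq_zero h.isOpen hconv (hfs.differentiableOn (by simp)) 1
      (fun x hx => (hpd hx).1) (fst_slice_mem_ball hq) hq
      (fun j hj => by fin_cases j <;> simp_all)
  have valk {q : Plane} (hq : q ∈ Metric.ball p r) : k !₂[p 0, q 1] = k q :=
    eq_of_pd_eq_zero h.isOpen hconv (hks.differentiableOn (by simp)) 0
      (fun x hx => (hpd hx).2) (snd_slice_mem_ball hq) hq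
      (fun j hj => by fin_cases j <;> simp_all)
  refine ⟨fun t => f !₂[t, p 1], fun t => k !₂[p 0, t], contDiffOn_fst_slice hfs,
    contDiffOn_snd_slice hks, fun q hq => ?_⟩
  have hA := hA0 q hq
  have hfk : f q - k q = 1 / (2 * A q) := by
    simp only [hf, hk]
    rw [← sub_div]
    ring
  simp only [valf hq, valk hq, hfk]
  refine ⟨one_div_ne_zero (h2A q hq), fun v => ?_, fun P => ?_⟩
  · rw [hds q hq, hB q hq, hC q hq]
    field_simp
    linear_combination (-4 * A q ^ 2 * v 1 ^ 2) * hs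
  · rw [hF q hq, hb q hq, hc q hq, quad]
    simp only [hf, hk]
    field_simp
    linear_combination (-P 0 ^ 2 * a q) * hs

/-- For H = B p_x p_y and F = p_x² + b p_x p_y + ε p_y² the metric is (2/B) dx dy. The middle
bracket equations become linear in b/B and 2/B: Cauchy–Riemann for ε = −1, while for ε = 0 the
function b/B depends on y only and 2/B is affine in x. -/
lemma null_equations (h : IsKillingPair (Metric.ball p r) A B C a b c) {ε : ℝ}
    (hA : ∀ q ∈ Metric.ball p r, A q = 0) (hC : ∀ q ∈ Metric.ball p r, C q = 0)
    (ha : ∀ q ∈ Metric.ball p r, a q = 1) (hc : ∀ q ∈ Metric.ball p r, c q = ε) :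
    (∀ q ∈ Metric.ball p r, B q ≠ 0) ∧
    ContDiffOn ℝ ∞ (fun q => b q / B q) (Metric.ball p r) ∧
    ContDiffOn ℝ ∞ (fun q => 2 / B q) (Metric.ball p r) ∧
    ∀ q ∈ Metric.ball p r,
      pd 1 (fun q => b q / B q) q = -pd 0 (fun q => 2 / B q) q ∧
      pd 0 (fun q => b q / B q) q = -ε * pd 1 (fun q => 2 / B q) q := by
  have hB0 : ∀ q ∈ Metric.ball p r, B q ≠ 0 := fun q hq h0 =>
    h.disc_ne q hq (by rw [hA q hq, h0]; ring)
  have hBs := h.hB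
  have hbs := h.hb
  refine ⟨hB0, .div (by fun_prop) (by fun_prop) hB0, .div (by fun_prop) (by fun_prop) hB0,
    fun q hq => ?_⟩
  have dB := differentiableAt_of_contDiffOn hBs h.isOpen hq
  have db := differentiableAt_of_contDiffOn hbs h.isOpen hq
  have eA (i) : pd i A q = 0 := (pd_congr hA h.isOpen hq i).trans (pd_const 0)
  have eC (i) : pd i C q = 0 := (pd_congr hC h.isOpen hq i).trans (pd_const 0)
  have ea (i) : pd i a q = 0 := (pd_congr ha h.isOpen hq i).trans (pd_const 1)
  have ec (i) : pd i c q = 0 := (pd_congr hc h.isOpen hq i).trans (pd_const ε)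
  obtain ⟨-, h2, h3, -⟩ := h.commute q hq
  rw [eA, eA, ea, ea, hA q hq, hC q hq, ha q hq] at h2
  rw [eC, eC, ec, ec, hA q hq, hC q hq, hc q hq] at h3
  have e1 (i) : pd i (fun q => 2 / B q) q = (-2 * pd i B q) / B q ^ 2 := by
    rw [pd_div (by fun_prop) dB (hB0 q hq), pd_const]
    ring
  have e2 (i) : pd i (fun q => b q / B q) q = (pd i b q * B q - b q * pd i B q) / B q ^ 2 :=
    pd_div db dB (hB0 q hq) i
  rw [e1, e1, e2, e2]
  constructor
  · rw [← neg_div]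
    congr 1
    linear_combination -h2
  · rw [← mul_div_assoc]
    congr 1
    linear_combination -h3

/-- The holomorphic function is h = b/B + i·2/B. -/
theorem isComplexLiouville (h : IsKillingPair (Metric.ball p r) A B C a b c)
    (hds : IsLineElement (Metric.ball p r) A B C ds)
    (hF : ∀ q ∈ Metric.ball p r, ∀ P : Plane, F q P = quad (a q) (b q) (c q) (P 0) (P 1))
    (hA : ∀ q ∈ Metric.ball p r, A q = 0) (hC : ∀ q ∈ Metric.ball p r, C q = 0)
    (ha : ∀ q ∈ Metric.ball p r, a q = 1) (hc : ∀ q ∈ Metric.ball p r, c q = -1) :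
    IsComplexLiouville (Metric.ball p r) ds F := by
  obtain ⟨hB0, hus, hvs, heq⟩ := h.null_equations hA hC ha hc
  set u : Plane → ℝ := fun q => b q / B q with hu
  set v : Plane → ℝ := fun q => 2 / B q with hv
  set L : ℂ →L[ℝ] Plane := Complex.reCLM.smulRight (EuclideanSpace.single 0 (1 : ℝ)) +
    Complex.imCLM.smulRight (EuclideanSpace.single 1 (1 : ℝ)) with hL
  have hLq (q : Plane) : L ⟨q 0, q 1⟩ = q := by
    ext i; fin_cases i <;> simp [hL]
  have hL1 : L 1 = EuclideanSpace.single 0 1 := by simp [hL]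
  have hLI : L Complex.I = EuclideanSpace.single 1 1 := by simp [hL]
  refine ⟨fun z => ⟨u (L z), v (L z)⟩, ?_, fun q hq => ?_⟩
  · rintro _ ⟨q, hq, rfl⟩
    refine DifferentiableAt.differentiableWithinAt ?_
    have du : HasFDerivAt u (fderiv ℝ u q) (L ⟨q 0, q 1⟩) := by
      rw [hLq]; exact (differentiableAt_of_contDiffOn hus h.isOpen hq).hasFDerivAt
    have dv : HasFDerivAt v (fderiv ℝ v q) (L ⟨q 0, q 1⟩) := by
      rw [hLq]; exact (differentiableAt_of_contDiffOn hvs h.isOpen hq).hasFDerivAt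
    have e : (fun z : ℂ => (⟨u (L z), v (L z)⟩ : ℂ)) =
        fun z => Complex.ofRealCLM (u (L z)) +
          ContinuousLinearMap.toSpanSingleton ℝ Complex.I (v (L z)) := by
      ext z
      apply Complex.ext <;> simp
    have du' := du.comp (⟨q 0, q 1⟩ : ℂ) L.hasFDerivAt
    have dv' := dv.comp (⟨q 0, q 1⟩ : ℂ) L.hasFDerivAt
    have hd := (Complex.ofRealCLM.hasFDerivAt.comp (⟨q 0, q 1⟩ : ℂ) du').add
      ((ContinuousLinearMap.toSpanSingleton ℝ Complex.I).hasFDerivAt.comp (⟨q 0, q 1⟩ : ℂ) dv')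
    have hd' := hd.congr_of_eventuallyEq (Filter.EventuallyEq.of_eq e)
    rw [differentiableAt_complex_iff_differentiableAt_real]
    refine ⟨hd'.differentiableAt, ?_⟩
    rw [hd'.fderiv]
    obtain ⟨e1, e2⟩ := heq q hq
    simp only [pd] at e1 e2
    simp only [add_apply, ContinuousLinearMap.comp_apply, hL1, hLI, e1, e2]
    apply Complex.ext <;> simp
  · have hB := hB0 q hq
    simp only [hLq]
    refine ⟨div_ne_zero two_ne_zero hB, fun w => ?_, fun P => ?_⟩
    · rw [hds q hq, hA q hq, hC q hq]
      simp only [hv]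
      field_simp
      ring
    · rw [hF q hq, ha q hq, hc q hq, quad]
      simp only [hu, hv]
      field_simp
      ring

/-- Here Y = −b/B depends on y only, and 2/B − xY' is also independent of x. The normalization B = 2
on the axis x = 0, which passes through the centre, makes this function equal to 1. -/
theorem isJordanBlock (h : IsKillingPair (Metric.ball p r) A B C a b c)
    (hds : IsLineElement (Metric.ball p r) A B C ds)
    (hF : ∀ q ∈ Metric.ball p r, ∀ P : Plane, F q P = quad (a q) (b q) (c q) (P 0) (P 1))
    (hA : ∀ q ∈ Metric.ball p r, A q = 0) (hC : ∀ q ∈ Metric.ball p r, C q = 0)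
    (ha : ∀ q ∈ Metric.ball p r, a q = 1) (hc : ∀ q ∈ Metric.ball p r, c q = 0)
    (hp : p 0 = 0) (hB : ∀ q ∈ Metric.ball p r, q 0 = 0 → B q = 2) :
    IsJordanBlock (Metric.ball p r) ds F := by
  obtain ⟨hB0, hus, hvs, heq⟩ := h.null_equations hA hC ha hc
  set u : Plane → ℝ := fun q => b q / B q with hu
  set v : Plane → ℝ := fun q => 2 / B q with hv
  have hconv := convex_ball p r
  have hΩ := h.isOpen
  have hu1 := contDiffOn_pd hus hΩ 1
  have hu0 : ∀ q ∈ Metric.ball p r, pd 0 u q = 0 := fun q hq => by simpa using (heq q hq).2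
  have hu01 : ∀ q ∈ Metric.ball p r, pd 0 (pd 1 u) q = 0 := fun q hq => by
    rw [pd_comm hus hΩ hq]
    exact (pd_congr (g := fun _ => 0) hu0 hΩ hq 1).trans (pd_const 0)
  have slice {f : Plane → ℝ} (hf : ContDiffOn ℝ ∞ f (Metric.ball p r))
      (hd : ∀ q ∈ Metric.ball p r, pd 0 f q = 0) {q : Plane} (hq : q ∈ Metric.ball p r) :
      f !₂[p 0, q 1] = f q :=
    eq_of_pd_eq_zero hΩ hconv (hf.differentiableOn (by simp)) 0 hd (snd_slice_mem_ball hq) hq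
      (fun j hj => by fin_cases j <;> simp_all)
  have hX : ContDiff ℝ ∞ (fun q : Plane => q 0) :=
    (EuclideanSpace.proj 0 : Plane →L[ℝ] ℝ).contDiff
  have dX (q : Plane) : pd 0 (fun q : Plane => q 0) q = 1 := by
    have := (EuclideanSpace.proj 0 : Plane →L[ℝ] ℝ).hasFDerivAt (x := q)
    have e : fderiv ℝ (fun q : Plane => q 0) q = (EuclideanSpace.proj 0 : Plane →L[ℝ] ℝ) :=
      this.fderiv
    simp [pd, e]
  have hZ {q : Plane} (hq : q ∈ Metric.ball p r) : v q + q 0 * pd 1 u q = 1 := by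
    have hXs := hX.contDiffOn (s := Metric.ball p r)
    have hs : ContDiffOn ℝ ∞ (fun q => v q + q 0 * pd 1 u q) (Metric.ball p r) :=
      hvs.add (hXs.mul hu1)
    rw [← slice hs (fun x hx => ?_) hq]
    · have := hB _ (snd_slice_mem_ball hq) (by simpa using hp)
      simp [hp, hv] at this ⊢
      rw [this]
      norm_num
    · have d1 := differentiableAt_of_contDiffOn hvs hΩ hx
      have d2 := differentiableAt_of_contDiffOn hXs hΩ hx
      have d3 := differentiableAt_of_contDiffOn hu1 hΩ hx
      rw [pd_add d1 (by fun_prop), pd_mul d2 d3, dX, hu01 x hx, (heq x hx).1]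
      ring
  have hder {q : Plane} (hq : q ∈ Metric.ball p r) :
      deriv (fun t : ℝ => -u !₂[p 0, t]) (q 1) = -pd 1 u q := by
    have hmem := snd_slice_mem_ball hq
    have hl : HasDerivAt (fun t : ℝ => (!₂[p 0, t] : Plane)) (EuclideanSpace.single 1 1) (q 1) := by
      have e : (fun t : ℝ => (!₂[p 0, t] : Plane)) =
          fun t => EuclideanSpace.single 0 (p 0) + t • EuclideanSpace.single 1 1 := by
        funext t
        ext i
        fin_cases i <;> simp
      rw [e]
      simpa using ((hasDerivAt_id (q 1)).smul_const
        (EuclideanSpace.single 1 1 : Plane)).const_add (EuclideanSpace.single 0 (p 0) : Plane)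
    have := ((differentiableAt_of_contDiffOn hus hΩ hmem).hasFDerivAt.comp_hasDerivAt (q 1)
      hl).neg.deriv
    refine this.trans ?_
    rw [← slice hu1 hu01 hq]
    rfl
  refine ⟨fun t => -u !₂[p 0, t], (contDiffOn_snd_slice hus).neg, fun q hq => ?_⟩
  have hBq := hB0 q hq
  have e1 : 1 + q 0 * deriv (fun t : ℝ => -u !₂[p 0, t]) (q 1) = 2 / B q := by
    rw [hder hq, ← hZ hq]
    simp only [hv]
    ring
  rw [e1]
  refine ⟨div_ne_zero two_ne_zero hBq, fun w => ?_, fun P => ?_⟩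
  · rw [hds q hq, hA q hq, hC q hq]
    field_simp
    ring
  · rw [hF q hq, ha q hq, hc q hq, quad]
    simp only [slice hus hu0 hq]
    simp only [hu]
    field_simp
    ring

end IsKillingPair

/-! ### Quadratic first integrals in charts -/

/-- The symmetric bilinear form `Q(P + P') - Q(P) - Q(P')` associated with `quad a b c`. -/
def polar (a b c u v w z : ℝ) : ℝ := 2 * a * (u * w) + b * (u * z + v * w) + 2 * c * (v * z)

lemma quad_coefficients {a b c a' b' c' x₀ x₁ y₀ y₁ : ℝ}
    (h : ∀ P₀ P₁ : ℝ, quad a' b' c' P₀ P₁ = quad a b c (P₀ * x₀ + P₁ * y₀) (P₀ * x₁ + P₁ * y₁)) :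
    a' = quad a b c x₀ x₁ ∧ b' = polar a b c x₀ x₁ y₀ y₁ ∧ c' = quad a b c y₀ y₁ := by
  have h1 := h 1 0
  have h2 := h 0 1
  have h3 := h 1 1
  simp only [quad, polar] at *
  refine ⟨?_, ?_, ?_⟩
  · linear_combination h1
  · linear_combination h3 - h1 - h2
  · linear_combination h2

lemma coefficients_eq {a b c a' b' c' : ℝ}
    (h : ∀ P₀ P₁ : ℝ, quad a' b' c' P₀ P₁ = quad a b c P₀ P₁) : a' = a ∧ b' = b ∧ c' = c := by
  have := quad_coefficients (x₀ := 1) (x₁ := 0) (y₀ := 0) (y₁ := 1) (a := a) (b := b) (c := c)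
    (a' := a') (b' := b') (c' := c') (fun P₀ P₁ => by rw [h]; simp)
  simpa [quad, polar] using this

/-- The discriminant scales by the squared Jacobian. In definite signature this shows that conformal
coordinates are independent. -/
lemma disc_transform (a b c x₀ x₁ y₀ y₁ : ℝ) :
    4 * quad a b c x₀ x₁ * quad a b c y₀ y₁ - polar a b c x₀ x₁ y₀ y₁ ^ 2 =
      (4 * a * c - b ^ 2) * (x₀ * y₁ - x₁ * y₀) ^ 2 := by
  simp only [quad, polar]
  ring

section Manifold

variable {M : Type*} [TopologicalSpace M] [ChartedSpace Plane M]

/-- The coefficients of a metric and of a quadratic first integral in a chart. -/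
structure ChartData (g : PseudoRiemannianMetric M) (F : CotangentFunction M)
    (φ : OpenPartialHomeomorph M Plane) (A B C a b c : Plane → ℝ) : Prop where
  pair : IsKillingPair φ.target A B C a b c
  hamiltonian : ∀ q ∈ φ.target, ∀ P : Plane,
    inCoords g.hamiltonian φ q P = quad (A q) (B q) (C q) (P 0) (P 1)
  integral : ∀ q ∈ φ.target, ∀ P : Plane,
    inCoords F φ q P = quad (a q) (b q) (c q) (P 0) (P 1)
  lineElement : IsLineElement φ.target A B C (g.lineElement φ)

/-- `F` is a quadratic first integral of the geodesic flow of `g`. -/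
def IsQuadraticIntegral (g : PseudoRiemannianMetric M) (F : CotangentFunction M) : Prop :=
  ∀ φ ∈ IsManifold.maximalAtlas (𝓡 2) ∞ M, ∃ A B C a b c, ChartData g F φ A B C a b c

variable {g : PseudoRiemannianMetric M} {F : CotangentFunction M}
  {φ : OpenPartialHomeomorph M Plane} {A B C a b c : Plane → ℝ}

theorem isQuadraticIntegral (hquad : IsQuadraticInMomenta F) (hint : g.IsIntegral F) :
    IsQuadraticIntegral g F := by
  intro φ hφ
  obtain ⟨A, B, C, hA, hB, hC, hD, hH, hl⟩ := exists_hamiltonian_coefficients g hφ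
  obtain ⟨a, b, c, ha, hb, hc, hF⟩ := hquad φ hφ
  exact ⟨A, B, C, a, b, c, ⟨φ.open_target, hA, hB, hC, ha, hb, hc, hD, fun q hq =>
    commute_of_poissonBracket φ.open_target hA hB hC ha hb hc hH hF hq (hint φ hφ q hq)⟩,
    hH, hF, hl⟩

lemma ChartData.const_mul (h : ChartData g F φ A B C a b c) (k : ℝ) :
    ChartData g (fun p ξ => k * F p ξ) φ A B C (fun q => k * a q) (fun q => k * b q)
      (fun q => k * c q) := by
  refine ⟨h.pair.const_mul k, h.hamiltonian, fun q hq P => ?_, h.lineElement⟩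
  have := h.integral q hq P
  simp only [inCoords, quad] at this ⊢
  rw [this]
  ring

lemma IsQuadraticIntegral.const_mul (h : IsQuadraticIntegral g F) (k : ℝ) :
    IsQuadraticIntegral g (fun p ξ => k * F p ξ) := fun φ hφ => by
  obtain ⟨A, B, C, a, b, c, hd⟩ := h φ hφ
  exact ⟨A, B, C, _, _, _, hd.const_mul k⟩

variable [IsManifold (𝓡 2) ∞ M]

/-- A quadratic integral which is a constant multiple of the Hamiltonian on a nonempty open set is
so everywhere. -/
theorem IsQuadraticIntegral.eq_of_eqOn [ConnectedSpace M] (h : IsQuadraticIntegral g F)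
    (hφ : φ ∈ IsManifold.maximalAtlas (𝓡 2) ∞ M) (hd : ChartData g F φ A B C a b c)
    {O : Set Plane} (hO : IsOpen O) (hOφ : O ⊆ φ.target) (hne : O.Nonempty) {k : ℝ}
    (hk : ∀ q ∈ O, a q = k * A q ∧ b q = k * B q ∧ c q = k * C q) :
    F = fun p ξ => k * g.hamiltonian p ξ := by
  -- Taking the interior makes `S` open at once; unique continuation makes it closed.
  set S : Set M := interior {p | ∀ ξ, F p ξ = k * g.hamiltonian p ξ} with hS
  have patch {ψ : OpenPartialHomeomorph M Plane} (hψ : ψ ∈ IsManifold.maximalAtlas (𝓡 2) ∞ M)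
      {A B C a b c : Plane → ℝ} (hd : ChartData g F ψ A B C a b c) {O : Set Plane} (hO : IsOpen O)
      (hOψ : O ⊆ ψ.target) (hk : ∀ q ∈ O, a q = k * A q ∧ b q = k * B q ∧ c q = k * C q) :
      ψ.source ∩ ψ ⁻¹' O ⊆ S := by
    refine interior_maximal ?_ (ψ.isOpen_inter_preimage hO)
    rintro p ⟨hp, hpO⟩
    have hp' : ψ.symm (ψ p) = p := ψ.left_inv hp
    change ∀ ξ, F p ξ = k * g.hamiltonian p ξ
    rw [← hp']
    intro ξ
    obtain ⟨P, rfl⟩ := covec_surjective hψ (hOψ hpO) ξ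
    have h1 := hd.integral _ (hOψ hpO) P
    have h2 := hd.hamiltonian _ (hOψ hpO) P
    obtain ⟨e1, e2, e3⟩ := hk _ hpO
    rw [inCoords] at h1 h2
    rw [h1, h2, e1, e2, e3]
    simp only [quad]
    ring
  have hSne : S.Nonempty := by
    obtain ⟨q, hq⟩ := hne
    refine ⟨φ.symm q, patch hφ hd hO hOφ hk ⟨φ.map_target (hOφ hq), ?_⟩⟩
    rwa [mem_preimage, φ.right_inv (hOφ hq)]
  have hclosed : IsClosed S := by
    refine isClosed_of_closure_subset fun p hp => ?_
    set ψ := chartAt Plane p with hψdef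
    have hψ : ψ ∈ IsManifold.maximalAtlas (𝓡 2) ∞ M := IsManifold.chart_mem_maximalAtlas p
    have hps : p ∈ ψ.source := mem_chart_source Plane p
    obtain ⟨A, B, C, a, b, c, hd⟩ := h ψ hψ
    -- A disc around the limit point is convex and meets `S` in a nonempty open set, so unique
    -- continuation applied to F − kH covers the whole disc.
    obtain ⟨r, hr, hball⟩ := Metric.isOpen_iff.1 ψ.open_target _ (ψ.map_source hps)
    have hV : IsOpen (ψ.source ∩ ψ ⁻¹' Metric.ball (ψ p) r) :=
      ψ.isOpen_inter_preimage Metric.isOpen_ball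
    obtain ⟨z, ⟨hzs, hzb⟩, hzS⟩ := mem_closure_iff.1 hp _ hV ⟨hps, Metric.mem_ball_self hr⟩
    set O' : Set Plane := Metric.ball (ψ p) r ∩ (ψ.target ∩ ψ.symm ⁻¹' S) with hO'
    have hO'o : IsOpen O' :=
      Metric.isOpen_ball.inter (ψ.symm.isOpen_inter_preimage isOpen_interior)
    have hz : ψ z ∈ O' := ⟨hzb, ψ.map_source hzs, by rwa [mem_preimage, ψ.left_inv hzs]⟩
    have hpair := (hd.pair.mono Metric.isOpen_ball hball).add_mul (-k)
    have hzero := hpair.eq_zero_of_eq_zero (convex_ball _ _) hO'o inter_subset_left ⟨_, hz⟩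
      (fun q hq => by
        have e : ∀ P₀ P₁ : ℝ, quad (a q) (b q) (c q) P₀ P₁ =
            quad (k * A q) (k * B q) (k * C q) P₀ P₁ := by
          intro P₀ P₁
          have h1 := hd.integral q hq.2.1 !₂[P₀, P₁]
          have h2 := hd.hamiltonian q hq.2.1 !₂[P₀, P₁]
          have h3 := interior_subset hq.2.2 (covec ψ q !₂[P₀, P₁])
          rw [inCoords] at h1 h2
          rw [h1, h2] at h3
          simp [quad] at h3 ⊢
          linear_combination h3
        obtain ⟨e1, e2, e3⟩ := coefficients_eq e
        refine ⟨?_, ?_, ?_⟩ <;> linarith)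
    exact patch hψ hd Metric.isOpen_ball hball (fun q hq => by
      obtain ⟨e1, e2, e3⟩ := hzero q hq
      refine ⟨?_, ?_, ?_⟩ <;> linarith) ⟨hps, Metric.mem_ball_self hr⟩
  have huniv : S = univ := IsClopen.eq_univ ⟨hclosed, isOpen_interior⟩ hSne
  funext p ξ
  have hp : p ∈ S := huniv ▸ mem_univ p
  exact interior_subset hp ξ

/-- New coordinates `x, y` define a chart on a disc, in which the coefficients are the values of
the quadratic forms on `dx` and `dy`. -/
theorem IsQuadraticIntegral.exists_chart (h : IsQuadraticIntegral g F)
    (hφ : φ ∈ IsManifold.maximalAtlas (𝓡 2) ∞ M) (hd : ChartData g F φ A B C a b c)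
    {O : Set Plane} (hO : IsOpen O) (hOφ : O ⊆ φ.target) {x y : Plane → ℝ}
    (hx : ContDiffOn ℝ ∞ x O) (hy : ContDiffOn ℝ ∞ y O) {p : Plane} (hp : p ∈ O)
    (hdet : pd 0 x p * pd 1 y p - pd 1 x p * pd 0 y p ≠ 0) :
    ∃ φ' ∈ IsManifold.maximalAtlas (𝓡 2) ∞ M, ∃ r > 0,
      φ'.target = Metric.ball (pairMap x y p) r ∧ φ.symm p ∈ φ'.source ∧
      φ'.symm (pairMap x y p) = φ.symm p ∧
      ∃ A' B' C' a' b' c' : Plane → ℝ, ChartData g F φ' A' B' C' a' b' c' ∧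
      ∃ τ : Plane → Plane, ∀ q ∈ φ'.target, τ q ∈ O ∧ x (τ q) = q 0 ∧ y (τ q) = q 1 ∧
        A' q = quad (A (τ q)) (B (τ q)) (C (τ q)) (pd 0 x (τ q)) (pd 1 x (τ q)) ∧
        B' q = polar (A (τ q)) (B (τ q)) (C (τ q)) (pd 0 x (τ q)) (pd 1 x (τ q))
          (pd 0 y (τ q)) (pd 1 y (τ q)) ∧
        C' q = quad (A (τ q)) (B (τ q)) (C (τ q)) (pd 0 y (τ q)) (pd 1 y (τ q)) ∧
        a' q = quad (a (τ q)) (b (τ q)) (c (τ q)) (pd 0 x (τ q)) (pd 1 x (τ q)) ∧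
        b' q = polar (a (τ q)) (b (τ q)) (c (τ q)) (pd 0 x (τ q)) (pd 1 x (τ q))
          (pd 0 y (τ q)) (pd 1 y (τ q)) ∧
        c' q = quad (a (τ q)) (b (τ q)) (c (τ q)) (pd 0 y (τ q)) (pd 1 y (τ q)) := by
  obtain ⟨φ', hφ', r, hr, ht, hs, hc, τ, hτ⟩ := Dini.exists_chart hφ hO hOφ hx hy hp hdet
  obtain ⟨A', B', C', a', b', c', hd'⟩ := h φ' hφ'
  refine ⟨φ', hφ', r, hr, ht, hs, hc, A', B', C', a', b', c', hd', τ, fun q hq => ?_⟩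
  obtain ⟨h1, h2, h3, h4⟩ := hτ q hq
  have e1 := quad_coefficients (a := A (τ q)) (b := B (τ q)) (c := C (τ q)) (a' := A' q)
    (b' := B' q) (c' := C' q) (x₀ := pd 0 x (τ q)) (x₁ := pd 1 x (τ q)) (y₀ := pd 0 y (τ q))
    (y₁ := pd 1 y (τ q)) (fun P₀ P₁ => by
      have e := h4 g.hamiltonian !₂[P₀, P₁]
      rw [hd'.hamiltonian q hq, hd.hamiltonian _ (hOφ h1)] at e
      simpa using e)
  have e2 := quad_coefficients (a := a (τ q)) (b := b (τ q)) (c := c (τ q)) (a' := a' q)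
    (b' := b' q) (c' := c' q) (x₀ := pd 0 x (τ q)) (x₁ := pd 1 x (τ q)) (y₀ := pd 0 y (τ q))
    (y₁ := pd 1 y (τ q)) (fun P₀ P₁ => by
      have e := h4 F !₂[P₀, P₁]
      rw [hd'.integral q hq, hd.integral _ (hOφ h1)] at e
      simpa using e)
  exact ⟨h1, h2, h3, e1.1, e1.2.1, e1.2.2, e2⟩

end Manifold

/-- An isotropic covector field on which the second function of a Killing pair is positive is,
after normalization, the differential of a function. -/
theorem IsKillingPair.exists_null_coordinate {Ω : Set Plane} {A B C a b c : Plane → ℝ}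
    (h : IsKillingPair Ω A B C a b c) (hconv : Convex ℝ Ω) {u v : Plane → ℝ}
    (hu : ContDiffOn ℝ ∞ u Ω) (hv : ContDiffOn ℝ ∞ v Ω)
    (hnull : ∀ q ∈ Ω, quad (A q) (B q) (C q) (u q) (v q) = 0)
    (hpos : ∀ q ∈ Ω, 0 < quad (a q) (b q) (c q) (u q) (v q)) :
    ∃ x : Plane → ℝ, ContDiffOn ℝ ∞ x Ω ∧ ∀ q ∈ Ω,
      quad (A q) (B q) (C q) (pd 0 x q) (pd 1 x q) = 0 ∧
      quad (a q) (b q) (c q) (pd 0 x q) (pd 1 x q) = 1 ∧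
      ∃ k : ℝ, k ≠ 0 ∧ u q = k * pd 0 x q ∧ v q = k * pd 1 x q := by
  have ha := h.ha; have hb := h.hb; have hc := h.hc
  set N : Plane → ℝ := fun q => quad (a q) (b q) (c q) (u q) (v q) with hN
  have hNs : ContDiffOn ℝ ∞ N Ω := by simp only [hN, quad]; fun_prop
  have hw : ContDiffOn ℝ ∞ (fun q => √(N q)) Ω := hNs.sqrt fun q hq => (hpos q hq).ne'
  have hw0 : ∀ q ∈ Ω, √(N q) ≠ 0 := fun q hq => (Real.sqrt_pos.2 (hpos q hq)).ne'
  have hsq : ∀ q ∈ Ω, √(N q) ^ 2 = N q := fun q hq => Real.sq_sqrt (hpos q hq).le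
  have scale (a b c u v w : ℝ) (h0 : w ≠ 0) : quad a b c (u / w) (v / w) =
      quad a b c u v / w ^ 2 := by
    simp only [quad]; field_simp
  have hu' : ContDiffOn ℝ ∞ (fun q => u q / √(N q)) Ω := hu.div hw hw0
  have hv' : ContDiffOn ℝ ∞ (fun q => v q / √(N q)) Ω := hv.div hw hw0
  have eH : ∀ q ∈ Ω, quad (A q) (B q) (C q) (u q / √(N q)) (v q / √(N q)) = 0 := fun q hq => by
    rw [scale _ _ _ _ _ _ (hw0 q hq), hnull q hq, zero_div]
  have eF : ∀ q ∈ Ω, quad (a q) (b q) (c q) (u q / √(N q)) (v q / √(N q)) = 1 := fun q hq => by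
    rw [scale _ _ _ _ _ _ (hw0 q hq), hsq q hq, div_self (hpos q hq).ne']
  obtain ⟨x, hx, hxd⟩ := exists_primitive h.isOpen hconv hu' hv' (fun q hq =>
    h.closed_of_isotropic (𝕜 := ℝ) hu' hv' one_ne_zero eH eF hq)
  refine ⟨x, hx, fun q hq => ?_⟩
  rw [(hxd q hq).1, (hxd q hq).2]
  refine ⟨eH q hq, eF q hq, √(N q), hw0 q hq, ?_, ?_⟩
  · exact (mul_div_cancel₀ _ (hw0 q hq)).symm
  · exact (mul_div_cancel₀ _ (hw0 q hq)).symm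

lemma exists_ball_subset {Ω : Set Plane} (hΩ : IsOpen Ω) {E : Type*} [TopologicalSpace E]
    {f : Plane → E} (hf : ContinuousOn f Ω) {S : Set E} (hS : IsOpen S) {p : Plane} (hp : p ∈ Ω)
    (hfp : f p ∈ S) : ∃ r > 0, Metric.ball p r ⊆ Ω ∧ ∀ q ∈ Metric.ball p r, f q ∈ S := by
  obtain ⟨r, hr, hb⟩ := Metric.isOpen_iff.1 (hf.isOpen_inter_preimage hΩ hS) p ⟨hp, hfp⟩
  exact ⟨r, hr, fun q hq => (hb hq).1, fun q hq => (hb hq).2⟩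

lemma pd_coordinate (i j : Fin 2) (q : Plane) :
    pd i (fun q : Plane => q j) q = EuclideanSpace.single i (1 : ℝ) j := by
  have e : fderiv ℝ (fun q : Plane => q j) q = (EuclideanSpace.proj j : Plane →L[ℝ] ℝ) :=
    (EuclideanSpace.proj j : Plane →L[ℝ] ℝ).hasFDerivAt.fderiv
  simp [pd, e]

lemma contDiff_coordinate (j : Fin 2) : ContDiff ℝ ∞ (fun q : Plane => q j) :=
  (EuclideanSpace.proj j : Plane →L[ℝ] ℝ).contDiff

/-! ### Existence of adapted coordinates -/

section Manifold

variable {M : Type*} [TopologicalSpace M] [ChartedSpace Plane M] [IsManifold (𝓡 2) ∞ M]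
  {g : PseudoRiemannianMetric M} {F : CotangentFunction M} {φ : OpenPartialHomeomorph M Plane}
  {A B C a b c : Plane → ℝ} {p : Plane} {r : ℝ}

/-- Two functions with isotropic differentials on which the integral takes the value `1` lead to
Liouville coordinates. -/
theorem IsQuadraticIntegral.exists_indefinite_liouville (h : IsQuadraticIntegral g F)
    (hφ : φ ∈ IsManifold.maximalAtlas (𝓡 2) ∞ M) (hd : ChartData g F φ A B C a b c)
    {O : Set Plane} (hO : IsOpen O) (hOφ : O ⊆ φ.target) {x y : Plane → ℝ}
    (hx : ContDiffOn ℝ ∞ x O) (hy : ContDiffOn ℝ ∞ y O) (hp : p ∈ O)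
    (hdet : pd 0 x p * pd 1 y p - pd 1 x p * pd 0 y p ≠ 0)
    (hHx : ∀ q ∈ O, quad (A q) (B q) (C q) (pd 0 x q) (pd 1 x q) = 0)
    (hHy : ∀ q ∈ O, quad (A q) (B q) (C q) (pd 0 y q) (pd 1 y q) = 0)
    (hFx : ∀ q ∈ O, quad (a q) (b q) (c q) (pd 0 x q) (pd 1 x q) = 1)
    (hFy : ∀ q ∈ O, quad (a q) (b q) (c q) (pd 0 y q) (pd 1 y q) = 1) :
    ∃ φ' ∈ IsManifold.maximalAtlas (𝓡 2) ∞ M, φ.symm p ∈ φ'.source ∧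
      IsLiouville (-1) φ'.target (g.lineElement φ') (inCoords F φ') := by
  -- The factor 1/2 makes F(dX) + F(dY) = (F(dx) + F(dy))/2 = 1, the normalization that
  -- `isLiouville` expects for s = −1.
  set X : Plane → ℝ := fun q => (1 / 2 : ℝ) * x q + (-1 / 2 : ℝ) * y q with hX
  set Y : Plane → ℝ := fun q => (1 / 2 : ℝ) * x q + (1 / 2 : ℝ) * y q with hY
  have lin (k l : ℝ) (i : Fin 2) (q : Plane) (hq : q ∈ O) :
      pd i (fun q => k * x q + l * y q) q = k * pd i x q + l * pd i y q := by
    have dx := differentiableAt_of_contDiffOn hx hO hq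
    have dy := differentiableAt_of_contDiffOn hy hO hq
    rw [pd_add (by fun_prop) (by fun_prop)]
    congr 1
    · exact pd_const_smul dx k
    · exact pd_const_smul dy l
  obtain ⟨φ', hφ', r, hr, ht, hs, -, A', B', C', a', b', c', hd', τ, hτ⟩ :=
    h.exists_chart hφ hd hO hOφ (x := X) (y := Y) (by fun_prop) (by fun_prop) hp (by
      rw [lin _ _ _ p hp, lin _ _ _ p hp, lin _ _ _ p hp, lin _ _ _ p hp]
      intro h0
      exact hdet (by linear_combination 2 * h0))
  refine ⟨φ', hφ', hs, ?_⟩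
  have hpair := hd'.pair
  have hint := hd'.integral
  have hle := hd'.lineElement
  rw [ht] at hpair hint hle hτ ⊢
  refine hpair.isLiouville hle hint (by norm_num) (fun q hq => ?_) (fun q hq => ?_)
    (fun q hq => ?_) (fun q hq => ?_)
  all_goals
    obtain ⟨h1, -, -, e1, e2, e3, e4, e5, e6⟩ := hτ q hq
    have k1 := hHx _ h1
    have k2 := hHy _ h1
    have k3 := hFx _ h1
    have k4 := hFy _ h1
    simp only [hX, hY, lin _ _ _ _ h1, quad, polar] at e1 e2 e3 e4 e5 e6 k1 k2 k3 k4
  · rw [e2]; linear_combination (1 / 2) * k1 - (1 / 2) * k2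
  · rw [e1, e3]; linear_combination (1 / 2) * k1 + (1 / 2) * k2
  · rw [e5]; linear_combination (1 / 2) * k3 - (1 / 2) * k4
  · rw [e4, e6]; linear_combination (1 / 2) * k3 + (1 / 2) * k4

/-- Two functions with isotropic differentials on which the integral takes the values `1` and `-1`
are complex-Liouville coordinates. -/
theorem IsQuadraticIntegral.exists_complexLiouville (h : IsQuadraticIntegral g F)
    (hφ : φ ∈ IsManifold.maximalAtlas (𝓡 2) ∞ M) (hd : ChartData g F φ A B C a b c)
    {O : Set Plane} (hO : IsOpen O) (hOφ : O ⊆ φ.target) {x y : Plane → ℝ}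
    (hx : ContDiffOn ℝ ∞ x O) (hy : ContDiffOn ℝ ∞ y O) (hp : p ∈ O)
    (hdet : pd 0 x p * pd 1 y p - pd 1 x p * pd 0 y p ≠ 0)
    (hHx : ∀ q ∈ O, quad (A q) (B q) (C q) (pd 0 x q) (pd 1 x q) = 0)
    (hHy : ∀ q ∈ O, quad (A q) (B q) (C q) (pd 0 y q) (pd 1 y q) = 0)
    (hFx : ∀ q ∈ O, quad (a q) (b q) (c q) (pd 0 x q) (pd 1 x q) = 1)
    (hFy : ∀ q ∈ O, quad (a q) (b q) (c q) (pd 0 y q) (pd 1 y q) = -1) :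
    ∃ φ' ∈ IsManifold.maximalAtlas (𝓡 2) ∞ M, φ.symm p ∈ φ'.source ∧
      IsComplexLiouville φ'.target (g.lineElement φ') (inCoords F φ') := by
  obtain ⟨φ', hφ', r, hr, ht, hs, -, A', B', C', a', b', c', hd', τ, hτ⟩ :=
    h.exists_chart hφ hd hO hOφ hx hy hp hdet
  refine ⟨φ', hφ', hs, ?_⟩
  have hpair := hd'.pair
  have hint := hd'.integral
  have hle := hd'.lineElement
  rw [ht] at hpair hint hle hτ ⊢
  refine hpair.isComplexLiouville hle hint (fun q hq => ?_) (fun q hq => ?_)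
    (fun q hq => ?_) (fun q hq => ?_)
  all_goals obtain ⟨h1, -, -, e1, e2, e3, e4, e5, e6⟩ := hτ q hq
  · rw [e1, hHx _ h1]
  · rw [e3, hHy _ h1]
  · rw [e4, hFx _ h1]
  · rw [e6, hFy _ h1]

/-- A chart whose first coordinate has isotropic differential, on which the integral takes the
value `1`, and with the integral vanishing on the second isotropic direction, can be modified to
a chart in which the pair has Jordan-block form. -/
theorem IsQuadraticIntegral.exists_jordanBlock_of_chart (h : IsQuadraticIntegral g F)
    (hφ : φ ∈ IsManifold.maximalAtlas (𝓡 2) ∞ M) (hd : ChartData g F φ A B C a b c) (hr : 0 < r)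
    (ht : φ.target = Metric.ball p r) (hp0 : p 0 = 0) (hA : ∀ q ∈ φ.target, A q = 0)
    (ha : ∀ q ∈ φ.target, a q = 1)
    (hnull : ∀ q ∈ φ.target, C q ^ 2 - b q * B q * C q + c q * B q ^ 2 = 0) :
    ∃ φ' ∈ IsManifold.maximalAtlas (𝓡 2) ∞ M, φ.symm p ∈ φ'.source ∧
      IsJordanBlock φ'.target (g.lineElement φ') (inCoords F φ') := by
  set Ω := φ.target with hΩdef
  have hΩ : IsOpen Ω := φ.open_target
  have hconv : Convex ℝ Ω := by rw [ht]; exact convex_ball p r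
  have hp : p ∈ Ω := by rw [ht]; exact Metric.mem_ball_self hr
  have hB0 : ∀ q ∈ Ω, B q ≠ 0 := fun q hq h0 => hd.pair.disc_ne q hq (by rw [hA q hq, h0]; ring)
  have hBs := hd.pair.hB; have hCs := hd.pair.hC; have hbs := hd.pair.hb; have hcs := hd.pair.hc
  -- Put ξ = p₀ + (C/B)p₁. Then H = B p₁ξ and, by `hnull`, F = lH + ξ²; `l` is the double
  -- eigenvalue. The second null form cannot be normalized by F, which vanishes on it. But θ = (u +
  -- l, v) is such a form, θ − l dx is closed, and `l` is constant along B∂₀ + C∂₁. So d(W + x l) =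
  -- θ + x dl, with dW = θ − l dx, is again in the second null direction.
  set u : Plane → ℝ := fun q => (-b q) / B q with hu
  set v : Plane → ℝ := fun q => 2 / B q with hv
  set l : Plane → ℝ := fun q => (b q * B q + (-2) * C q) / B q ^ 2 with hl
  have hB2 : ∀ q ∈ Ω, B q ^ 2 ≠ 0 := fun q hq => pow_ne_zero 2 (hB0 q hq)
  have hus : ContDiffOn ℝ ∞ u Ω := .div (by fun_prop) (by fun_prop) hB0
  have hvs : ContDiffOn ℝ ∞ v Ω := .div (by fun_prop) (by fun_prop) hB0
  have hls : ContDiffOn ℝ ∞ l Ω := .div (by fun_prop) (by fun_prop) hB2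
  have main : ∀ q ∈ Ω, pd 0 v q = pd 1 u q ∧ B q * pd 0 l q + C q * pd 1 l q = 0 := by
    intro q hq
    have dB := differentiableAt_of_contDiffOn hBs hΩ hq
    have dC := differentiableAt_of_contDiffOn hCs hΩ hq
    have db := differentiableAt_of_contDiffOn hbs hΩ hq
    have dc := differentiableAt_of_contDiffOn hcs hΩ hq
    have hB := hB0 q hq
    have eA (i) : pd i A q = 0 := (pd_congr hA hΩ hq i).trans (pd_const 0)
    have ea (i) : pd i a q = 0 := (pd_congr ha hΩ hq i).trans (pd_const 1)
    obtain ⟨-, h2, h3, -⟩ := hd.pair.commute q hq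
    rw [eA, eA, ea, ea, hA q hq, ha q hq] at h2
    rw [hA q hq, ha q hq] at h3
    have hn := hnull q hq
    have sq : (fun x => B x ^ 2) = fun x => B x * B x := by ext; ring
    -- The derivative of `hnull` in the second coordinate eliminates ∂₁c from the bracket equations.
    have hn1 : 2 * C q * pd 1 C q - (pd 1 b q * B q * C q + b q * pd 1 B q * C q +
        b q * B q * pd 1 C q) + pd 1 c q * B q ^ 2 + 2 * c q * B q * pd 1 B q = 0 := by
      have e : EqOn (fun x => C x * C x + ((-1) * (b x * (B x * C x)) + c x * (B x * B x)))
          (fun _ => 0) Ω := fun x hx => by simp only; linear_combination hnull x hx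
      have := (pd_congr e hΩ hq 1).trans (pd_const 0)
      have hneg : pd 1 (fun x => (-1 : ℝ) * (b x * (B x * C x))) q =
          (-1) * pd 1 (fun x => b x * (B x * C x)) q := pd_const_smul (by fun_prop) (-1)
      rw [pd_add (by fun_prop) (by fun_prop), pd_add (by fun_prop) (by fun_prop), pd_mul dC dC,
        hneg, pd_mul db (by fun_prop), pd_mul dB dC, pd_mul dc (by fun_prop), pd_mul dB dB] at this
      linear_combination this
    have eu (i) : pd i u q = (-pd i b q * B q + b q * pd i B q) / B q ^ 2 := by
      have e : pd i (fun x => -b x) q = -pd i b q := by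
        simpa using pd_const_smul (i := i) db (-1)
      rw [hu, pd_div (by fun_prop) dB hB, e]
      ring
    have ev (i) : pd i v q = (-2 * pd i B q) / B q ^ 2 := by
      rw [hv, pd_div (by fun_prop) dB hB, pd_const]
      ring
    have el (i) : pd i l q = (pd i b q * B q ^ 2 - b q * B q * pd i B q - 2 * pd i C q * B q +
        4 * C q * pd i B q) / B q ^ 3 := by
      have e : pd i (fun x => (-2) * C x) q = -2 * pd i C q := pd_const_smul dC (-2)
      rw [hl, pd_div (by fun_prop) (by fun_prop) (hB2 q hq), sq, pd_mul dB dB,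
        pd_add (by fun_prop) (by fun_prop), pd_mul db dB, e]
      field_simp
      ring
    refine ⟨?_, ?_⟩
    · rw [eu, ev]
      congr 1
      linear_combination -h2
    · rw [el, el, ← mul_div_assoc, ← mul_div_assoc, ← add_div, div_eq_zero_iff]
      left
      linear_combination (-B q ^ 2) * h3 + 2 * B q * C q * h2 - B q * hn1 + 4 * pd 1 B q * hn
  obtain ⟨W, hW, hWd⟩ := exists_primitive hΩ hconv hus hvs fun q hq => (main q hq).1
  set x : Plane → ℝ := fun q => q 0 with hx
  have hxs : ContDiffOn ℝ ∞ x Ω := (contDiff_coordinate 0).contDiffOn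
  set y : Plane → ℝ := fun q => W q + x q * l q with hy
  have hys : ContDiffOn ℝ ∞ y Ω := hW.add (hxs.mul hls)
  have dx0 (q : Plane) : pd 0 x q = 1 := by rw [hx, pd_coordinate]; simp
  have dx1 (q : Plane) : pd 1 x q = 0 := by rw [hx, pd_coordinate]; simp
  have dy (q : Plane) (hq : q ∈ Ω) : pd 0 y q = u q + l q + q 0 * pd 0 l q ∧
      pd 1 y q = v q + q 0 * pd 1 l q := by
    have d1 := differentiableAt_of_contDiffOn hW hΩ hq
    have d2 := differentiableAt_of_contDiffOn hxs hΩ hq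
    have d3 := differentiableAt_of_contDiffOn hls hΩ hq
    have e (i) : pd i y q = pd i W q + (pd i x q * l q + x q * pd i l q) := by
      rw [hy, pd_add d1 (by fun_prop), pd_mul d2 d3]
    rw [e, e, dx0, dx1, (hWd q hq).1, (hWd q hq).2]
    constructor <;> ring
  obtain ⟨φ', hφ', r', hr', ht', hs, -, A', B', C', a', b', c', hd', τ, hτ⟩ :=
    -- Since x(p) = 0, the Jacobian at `p` is v(p) = 2/B(p).
    h.exists_chart hφ hd hΩ subset_rfl hxs hys hp (by
      rw [dx0, dx1, (dy p hp).2, hp0]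
      simpa [hv] using hB0 p hp)
  refine ⟨φ', hφ', hs, ?_⟩
  -- dy is a multiple of (−C, B), the isotropic covector other than dx.
  have key : ∀ q ∈ Ω, B q * pd 0 y q + C q * pd 1 y q = 0 := by
    intro q hq
    have hB := hB0 q hq
    have e : B q * (u q + l q) + C q * v q = 0 := by
      simp only [hu, hv, hl]
      field_simp
      ring
    rw [(dy q hq).1, (dy q hq).2]
    linear_combination e + q 0 * (main q hq).2
  have hpair := hd'.pair
  have hint := hd'.integral
  have hle := hd'.lineElement
  rw [ht'] at hpair hint hle hτ ⊢
  refine hpair.isJordanBlock hle hint (fun q hq => ?_) (fun q hq => ?_)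
    (fun q hq => ?_) (fun q hq => ?_) (by simpa [pairMap, hx] using hp0) (fun q hq hq0 => ?_)
  all_goals
    obtain ⟨h1, h2, -, e1, e2, e3, e4, e5, e6⟩ := hτ q hq
    have hB := hB0 _ h1
    have hk := key _ h1
    have hn := hnull _ h1
    simp only [dx0, dx1, quad, polar, hA _ h1, ha _ h1] at e1 e2 e3 e4 e5 e6
  · rw [e1]; ring
  · rw [e3]; linear_combination pd 1 y (τ q) * hk
  · rw [e4]; ring
  · have : B (τ q) ^ 2 * c' q = 0 := by
      rw [e6]
      linear_combination pd 1 y (τ q) ^ 2 * hn +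
        (B (τ q) * pd 0 y (τ q) - C (τ q) * pd 1 y (τ q) +
          b (τ q) * B (τ q) * pd 1 y (τ q)) * hk
    simpa [hB] using this
  · have h0 : (τ q) 0 = 0 := h2.trans hq0
    rw [e2, (dy _ h1).2, h0]
    simp only [hv]
    field_simp
    ring

end Manifold

/-! ### The case distinction in indefinite signature. -/

section Manifold

variable {M : Type*} [TopologicalSpace M] [ChartedSpace Plane M]

/-- In the chart `φ`, the metric and the integral have one of the Liouville, complex-Liouville or
Jordan-block forms. -/
def HasNormalForm (g : PseudoRiemannianMetric M) (F : CotangentFunction M)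
    (φ : OpenPartialHomeomorph M Plane) : Prop :=
  IsLiouville 1 φ.target (g.lineElement φ) (inCoords F φ) ∨
    (∃ ε : ℝ, (ε = 1 ∨ ε = -1) ∧
      IsLiouville (-1) φ.target (g.lineElement φ) (fun q P => ε * inCoords F φ q P)) ∨
    IsComplexLiouville φ.target (g.lineElement φ) (inCoords F φ) ∨
    (∃ ε : ℝ, (ε = 1 ∨ ε = -1) ∧
      IsJordanBlock φ.target (g.lineElement φ) (fun q P => ε * inCoords F φ q P))

variable [IsManifold (𝓡 2) ∞ M]
  {g : PseudoRiemannianMetric M} {F : CotangentFunction M} {φ : OpenPartialHomeomorph M Plane}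
  {A B C a b c : Plane → ℝ} {p : Plane} {r : ℝ} {Ω : Set Plane} {u v w z : Plane → ℝ}

/-- Liouville coordinates near a point where the integral is positive on both isotropic
directions. -/
theorem IsQuadraticIntegral.exists_liouville_of_pos (h : IsQuadraticIntegral g F)
    (hφ : φ ∈ IsManifold.maximalAtlas (𝓡 2) ∞ M) (hd : ChartData g F φ A B C a b c)
    (hΩ : IsOpen Ω) (hΩφ : Ω ⊆ φ.target) (hu : ContDiffOn ℝ ∞ u Ω) (hv : ContDiffOn ℝ ∞ v Ω)
    (hw : ContDiffOn ℝ ∞ w Ω) (hz : ContDiffOn ℝ ∞ z Ω)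
    (hη : ∀ q ∈ Ω, quad (A q) (B q) (C q) (u q) (v q) = 0)
    (hζ : ∀ q ∈ Ω, quad (A q) (B q) (C q) (w q) (z q) = 0) (hp : p ∈ Ω)
    (hdet : u p * z p - v p * w p ≠ 0) (hηp : 0 < quad (a p) (b p) (c p) (u p) (v p))
    (hζp : 0 < quad (a p) (b p) (c p) (w p) (z p)) :
    ∃ φ' ∈ IsManifold.maximalAtlas (𝓡 2) ∞ M, φ.symm p ∈ φ'.source ∧
      IsLiouville (-1) φ'.target (g.lineElement φ') (inCoords F φ') := by
  have ha := (hd.pair.ha.mono hΩφ).continuousOn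
  have hb := (hd.pair.hb.mono hΩφ).continuousOn
  have hc := (hd.pair.hc.mono hΩφ).continuousOn
  have hu' := hu.continuousOn; have hv' := hv.continuousOn
  have hw' := hw.continuousOn; have hz' := hz.continuousOn
  obtain ⟨r, hr, hsub, hpos⟩ := exists_ball_subset hΩ
    (f := fun q => (quad (a q) (b q) (c q) (u q) (v q), quad (a q) (b q) (c q) (w q) (z q)))
    (by simp only [quad]; fun_prop) (isOpen_Ioi.prod isOpen_Ioi) hp
    (show _ ∈ Ioi (0 : ℝ) ×ˢ Ioi (0 : ℝ) from ⟨hηp, hζp⟩)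
  have hpair := hd.pair.mono Metric.isOpen_ball (hsub.trans hΩφ)
  obtain ⟨x, hx, hxd⟩ := hpair.exists_null_coordinate (convex_ball p r) (hu.mono hsub)
    (hv.mono hsub) (fun q hq => hη q (hsub hq)) (fun q hq => (hpos q hq).1)
  obtain ⟨y, hy, hyd⟩ := hpair.exists_null_coordinate (convex_ball p r) (hw.mono hsub)
    (hz.mono hsub) (fun q hq => hζ q (hsub hq)) (fun q hq => (hpos q hq).2)
  have hpb := Metric.mem_ball_self (x := p) hr
  refine h.exists_indefinite_liouville hφ hd Metric.isOpen_ball (hsub.trans hΩφ) hx hy hpb ?_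
    (fun q hq => (hxd q hq).1) (fun q hq => (hyd q hq).1) (fun q hq => (hxd q hq).2.1)
    (fun q hq => (hyd q hq).2.1)
  obtain ⟨-, -, k, -, e1, e2⟩ := hxd p hpb
  obtain ⟨-, -, l, -, e3, e4⟩ := hyd p hpb
  intro h0
  exact hdet (by rw [e1, e2, e3, e4]; linear_combination k * l * h0)

/-- Complex-Liouville coordinates near a point where the integral has opposite signs on the
isotropic directions. -/
theorem IsQuadraticIntegral.exists_complexLiouville_of_pos_neg (h : IsQuadraticIntegral g F)
    (hφ : φ ∈ IsManifold.maximalAtlas (𝓡 2) ∞ M) (hd : ChartData g F φ A B C a b c)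
    (hΩ : IsOpen Ω) (hΩφ : Ω ⊆ φ.target) (hu : ContDiffOn ℝ ∞ u Ω) (hv : ContDiffOn ℝ ∞ v Ω)
    (hw : ContDiffOn ℝ ∞ w Ω) (hz : ContDiffOn ℝ ∞ z Ω)
    (hη : ∀ q ∈ Ω, quad (A q) (B q) (C q) (u q) (v q) = 0)
    (hζ : ∀ q ∈ Ω, quad (A q) (B q) (C q) (w q) (z q) = 0) (hp : p ∈ Ω)
    (hdet : u p * z p - v p * w p ≠ 0) (hηp : 0 < quad (a p) (b p) (c p) (u p) (v p))
    (hζp : quad (a p) (b p) (c p) (w p) (z p) < 0) :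
    ∃ φ' ∈ IsManifold.maximalAtlas (𝓡 2) ∞ M, φ.symm p ∈ φ'.source ∧
      IsComplexLiouville φ'.target (g.lineElement φ') (inCoords F φ') := by
  have ha := (hd.pair.ha.mono hΩφ).continuousOn
  have hb := (hd.pair.hb.mono hΩφ).continuousOn
  have hc := (hd.pair.hc.mono hΩφ).continuousOn
  have hu' := hu.continuousOn; have hv' := hv.continuousOn
  have hw' := hw.continuousOn; have hz' := hz.continuousOn
  obtain ⟨r, hr, hsub, hpos⟩ := exists_ball_subset hΩ
    (f := fun q => (quad (a q) (b q) (c q) (u q) (v q), quad (a q) (b q) (c q) (w q) (z q)))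
    (by simp only [quad]; fun_prop) (isOpen_Ioi.prod isOpen_Iio) hp
    (show _ ∈ Ioi (0 : ℝ) ×ˢ Iio (0 : ℝ) from ⟨hηp, hζp⟩)
  have hpair := hd.pair.mono Metric.isOpen_ball (hsub.trans hΩφ)
  have hneg (a b c u v : ℝ) : quad (-1 * a) (-1 * b) (-1 * c) u v = -quad a b c u v := by
    simp only [quad]; ring
  obtain ⟨x, hx, hxd⟩ := hpair.exists_null_coordinate (convex_ball p r) (hu.mono hsub)
    (hv.mono hsub) (fun q hq => hη q (hsub hq)) (fun q hq => (hpos q hq).1)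
  obtain ⟨y, hy, hyd⟩ := (hpair.const_mul (-1)).exists_null_coordinate (convex_ball p r)
    (hw.mono hsub) (hz.mono hsub) (fun q hq => hζ q (hsub hq))
    (fun q hq => by rw [hneg]; exact neg_pos.2 (hpos q hq).2)
  have hpb := Metric.mem_ball_self (x := p) hr
  refine h.exists_complexLiouville hφ hd Metric.isOpen_ball (hsub.trans hΩφ) hx hy hpb ?_
    (fun q hq => (hxd q hq).1) (fun q hq => (hyd q hq).1) (fun q hq => (hxd q hq).2.1)
    (fun q hq => by
      have := (hyd q hq).2.1
      rw [hneg] at this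
      linarith)
  obtain ⟨-, -, k, -, e1, e2⟩ := hxd p hpb
  obtain ⟨-, -, l, -, e3, e4⟩ := hyd p hpb
  intro h0
  exact hdet (by rw [e1, e2, e3, e4]; linear_combination k * l * h0)

/-- Jordan-block coordinates near a point where the integral is positive on one isotropic direction
and vanishes identically on the other one. -/
theorem IsQuadraticIntegral.exists_jordanBlock_of_pos (h : IsQuadraticIntegral g F)
    (hφ : φ ∈ IsManifold.maximalAtlas (𝓡 2) ∞ M) (hd : ChartData g F φ A B C a b c)
    (hΩ : IsOpen Ω) (hΩφ : Ω ⊆ φ.target) (hu : ContDiffOn ℝ ∞ u Ω) (hv : ContDiffOn ℝ ∞ v Ω)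
    (hη : ∀ q ∈ Ω, quad (A q) (B q) (C q) (u q) (v q) = 0)
    (hζ : ∀ q ∈ Ω, quad (A q) (B q) (C q) (w q) (z q) = 0) (hp : p ∈ Ω)
    (hdet : ∀ q ∈ Ω, u q * z q - v q * w q ≠ 0)
    (hηp : 0 < quad (a p) (b p) (c p) (u p) (v p))
    (hζ0 : ∀ q ∈ Ω, quad (a q) (b q) (c q) (w q) (z q) = 0) :
    ∃ φ' ∈ IsManifold.maximalAtlas (𝓡 2) ∞ M, φ.symm p ∈ φ'.source ∧
      IsJordanBlock φ'.target (g.lineElement φ') (inCoords F φ') := by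
  have ha := (hd.pair.ha.mono hΩφ).continuousOn
  have hb := (hd.pair.hb.mono hΩφ).continuousOn
  have hc := (hd.pair.hc.mono hΩφ).continuousOn
  have hu' := hu.continuousOn; have hv' := hv.continuousOn
  obtain ⟨r, hr, hsub, hpos⟩ := exists_ball_subset hΩ
    (f := fun q => quad (a q) (b q) (c q) (u q) (v q))
    (by simp only [quad]; fun_prop) isOpen_Ioi hp hηp
  have hpair := hd.pair.mono Metric.isOpen_ball (hsub.trans hΩφ)
  obtain ⟨x₁, hx₁, hxd⟩ := hpair.exists_null_coordinate (convex_ball p r) (hu.mono hsub)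
    (hv.mono hsub) (fun q hq => hη q (hsub hq)) (fun q hq => hpos q hq)
  have hO := Metric.isOpen_ball (x := p) (ε := r)
  have hpb := Metric.mem_ball_self (x := p) hr
  -- The Jordan-block form is normalized along x = 0, so this line has to pass through `p`.
  set x : Plane → ℝ := fun q => x₁ q + -x₁ p with hx
  have hxs : ContDiffOn ℝ ∞ x (Metric.ball p r) := by fun_prop
  have ex (i) (q) (hq : q ∈ Metric.ball p r) : pd i x q = pd i x₁ q := by
    rw [hx, pd_add (differentiableAt_of_contDiffOn hx₁ hO hq) (by fun_prop), pd_const, add_zero]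
  set α := pd 0 x₁ p with hα
  set β := pd 1 x₁ p with hβ
  -- Any complementary coordinate would do; this linear one has Jacobian α² + β² at `p`.
  set t : Plane → ℝ := fun q => -β * q 0 + α * q 1 with ht
  have d0 := contDiff_coordinate 0
  have d1 := contDiff_coordinate 1
  have hts : ContDiffOn ℝ ∞ t (Metric.ball p r) := by fun_prop
  have et (i) (q) : pd i t q = -β * EuclideanSpace.single i (1 : ℝ) 0 +
      α * EuclideanSpace.single i (1 : ℝ) 1 := by
    have e0 := (d0.differentiable (by simp)).differentiableAt (x := q)
    have e1 := (d1.differentiable (by simp)).differentiableAt (x := q)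
    rw [ht, pd_add (by fun_prop) (by fun_prop), ← pd_coordinate, ← pd_coordinate]
    congr 1
    · exact pd_const_smul e0 _
    · exact pd_const_smul e1 _
  have hαβ : α ^ 2 + β ^ 2 ≠ 0 := by
    intro h0
    have h1 : α = 0 := by nlinarith
    have h2 : β = 0 := by nlinarith
    have := (hxd p hpb).2.1
    rw [← hα, ← hβ, h1, h2] at this
    simp [quad] at this
  obtain ⟨φ', hφ', r', hr', ht', hs, hcenter, A', B', C', a', b', c', hd', τ, hτ⟩ :=
    h.exists_chart hφ hd hO (hsub.trans hΩφ) hxs hts hpb (by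
      rw [ex _ _ hpb, ex _ _ hpb, et, et, ← hα, ← hβ]
      intro h0
      simp at h0
      exact hαβ (by linear_combination h0))
  have hA' : ∀ q ∈ φ'.target, A' q = 0 := fun q hq => by
    obtain ⟨h1, -, -, e1, -⟩ := hτ q hq
    rw [e1, ex _ _ h1, ex _ _ h1, (hxd _ h1).1]
  have ha' : ∀ q ∈ φ'.target, a' q = 1 := fun q hq => by
    obtain ⟨h1, -, -, -, -, -, e1, -⟩ := hτ q hq
    rw [e1, ex _ _ h1, ex _ _ h1, (hxd _ h1).2.1]
  obtain ⟨φ₂, hφ₂, hs₂, hJ⟩ := h.exists_jordanBlock_of_chart hφ' hd' hr' ht'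
    (by simp [pairMap, hx]) hA' ha' (fun q hq => by
      obtain ⟨h1, -, -, e1, e2, e3, e4, e5, e6⟩ := hτ q hq
      have hAq := hA' q hq
      have haq := ha' q hq
      obtain ⟨-, -, k, hk, f1, f2⟩ := hxd _ h1
      have hH := hζ _ (hsub h1)
      have hF := hζ0 _ (hsub h1)
      have hdt := hdet _ (hsub h1)
      rw [f1, f2] at hdt
      rw [← ex _ _ h1, ← ex _ _ h1] at hdt
      set x0 := pd 0 x (τ q)
      set x1 := pd 1 x (τ q)
      set t0 := pd 0 t (τ q)
      set t1 := pd 1 t (τ q)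
      have hP₁ : x0 * z (τ q) - x1 * w (τ q) ≠ 0 := fun h0 =>
        hdt (by linear_combination k * h0)
      set P₁ := x0 * z (τ q) - x1 * w (τ q) with hP₁def
      -- Cramer's rule: P₀ dx + P₁ dt is the Jacobian times `(w, z)`, so both forms vanish on it. P₁
      -- ≠ 0 because `(w, z)` is independent of dx.
      set P₀ := w (τ q) * t1 - z (τ q) * t0 with hP₀def
      have g1 : quad (A' q) (B' q) (C' q) P₀ P₁ = 0 := by
        rw [e1, e2, e3]
        simp only [quad, polar] at hH ⊢
        linear_combination (x0 * t1 - x1 * t0) ^ 2 * hH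
      have g2 : quad (a' q) (b' q) (c' q) P₀ P₁ = 0 := by
        rw [e4, e5, e6]
        simp only [quad, polar] at hF ⊢
        linear_combination (x0 * t1 - x1 * t0) ^ 2 * hF
      rw [hAq, quad] at g1
      rw [haq, quad] at g2
      have g3 : B' q * P₀ + C' q * P₁ = 0 := by
        have : P₁ * (B' q * P₀ + C' q * P₁) = 0 := by linear_combination g1
        simpa [hP₁] using this
      have g4 : P₁ ^ 2 * (C' q ^ 2 - b' q * B' q * C' q + c' q * B' q ^ 2) = 0 := by
        linear_combination B' q ^ 2 * g2 +
          (C' q * P₁ - B' q * P₀ - b' q * B' q * P₁) * g3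
      simpa [hP₁] using g4)
  refine ⟨φ₂, hφ₂, ?_, hJ⟩
  rwa [hcenter] at hs₂

/-- Normal forms in indefinite signature, given the two isotropic directions. -/
theorem IsQuadraticIntegral.exists_normalForm_of_isotropic (h : IsQuadraticIntegral g F)
    (hφ : φ ∈ IsManifold.maximalAtlas (𝓡 2) ∞ M) (hd : ChartData g F φ A B C a b c)
    (hΩ : IsOpen Ω) (hΩφ : Ω ⊆ φ.target) (hu : ContDiffOn ℝ ∞ u Ω) (hv : ContDiffOn ℝ ∞ v Ω)
    (hw : ContDiffOn ℝ ∞ w Ω) (hz : ContDiffOn ℝ ∞ z Ω)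
    (hη : ∀ q ∈ Ω, quad (A q) (B q) (C q) (u q) (v q) = 0)
    (hζ : ∀ q ∈ Ω, quad (A q) (B q) (C q) (w q) (z q) = 0) (hp : p ∈ Ω)
    (hdet : ∀ q ∈ Ω, u q * z q - v q * w q ≠ 0)
    (hηp : quad (a p) (b p) (c p) (u p) (v p) ≠ 0) :
    ∃ φ' ∈ IsManifold.maximalAtlas (𝓡 2) ∞ M, (∃ q ∈ Ω, φ.symm q ∈ φ'.source) ∧
      HasNormalForm g F φ' := by
  have ha := (hd.pair.ha.mono hΩφ).continuousOn
  have hb := (hd.pair.hb.mono hΩφ).continuousOn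
  have hc := (hd.pair.hc.mono hΩφ).continuousOn
  have hu' := hu.continuousOn; have hv' := hv.continuousOn
  obtain ⟨r, hr, hsub, hne⟩ := exists_ball_subset hΩ
    (f := fun q => quad (a q) (b q) (c q) (u q) (v q))
    (by simp only [quad]; fun_prop) isOpen_ne hp hηp
  have hscale (k a b c u v : ℝ) : quad (k * a) (k * b) (k * c) u v = k * quad a b c u v := by
    simp only [quad]; ring
  have hO := Metric.isOpen_ball (x := p) (ε := r)
  have hpb := Metric.mem_ball_self (x := p) hr
  by_cases hall : ∀ q ∈ Metric.ball p r, quad (a q) (b q) (c q) (w q) (z q) = 0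
  · obtain ⟨ε, hε, hpos⟩ : ∃ ε : ℝ, (ε = 1 ∨ ε = -1) ∧
        0 < ε * quad (a p) (b p) (c p) (u p) (v p) := by
      rcases lt_or_gt_of_ne hηp with h0 | h0
      · exact ⟨-1, Or.inr rfl, by linarith⟩
      · exact ⟨1, Or.inl rfl, by linarith⟩
    obtain ⟨φ', hφ', hs, hJ⟩ := (h.const_mul ε).exists_jordanBlock_of_pos hφ (hd.const_mul ε) hO
      (hsub.trans hΩφ) (hu.mono hsub) (hv.mono hsub) (fun q hq => hη q (hsub hq))
      (fun q hq => hζ q (hsub hq)) hpb (fun q hq => hdet q (hsub hq))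
      (by rw [hscale]; exact hpos) (fun q hq => by rw [hscale, hall q hq, mul_zero])
    exact ⟨φ', hφ', ⟨p, hp, hs⟩, Or.inr (Or.inr (Or.inr ⟨ε, hε, hJ⟩))⟩
  · push Not at hall
    -- The base point moves to `q`, where F is nonzero on both directions. Only density is wanted,
    -- so any point of `Ω` serves.
    obtain ⟨q, hqb, hq⟩ := hall
    have hqη := hne q hqb
    have hqΩ := hsub hqb
    have hdq := hdet q hqΩ
    have liouville (ε : ℝ) (hε : ε = 1 ∨ ε = -1)
        (h1 : 0 < ε * quad (a q) (b q) (c q) (u q) (v q))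
        (h2 : 0 < ε * quad (a q) (b q) (c q) (w q) (z q)) :
        ∃ φ' ∈ IsManifold.maximalAtlas (𝓡 2) ∞ M, (∃ q ∈ Ω, φ.symm q ∈ φ'.source) ∧
          HasNormalForm g F φ' := by
      obtain ⟨φ', hφ', hs, hL⟩ := (h.const_mul ε).exists_liouville_of_pos hφ (hd.const_mul ε) hΩ
        hΩφ hu hv hw hz hη hζ hqΩ hdq (by rw [hscale]; exact h1) (by rw [hscale]; exact h2)
      exact ⟨φ', hφ', ⟨q, hqΩ, hs⟩, Or.inr (Or.inl ⟨ε, hε, hL⟩)⟩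
    rcases lt_or_gt_of_ne hqη with h1 | h1 <;> rcases lt_or_gt_of_ne hq with h2 | h2
    · exact liouville (-1) (Or.inr rfl) (by linarith) (by linarith)
    · obtain ⟨φ', hφ', hs, hL⟩ := h.exists_complexLiouville_of_pos_neg hφ hd hΩ hΩφ hw hz hu hv
        hζ hη hqΩ (fun h0 => hdq (by linear_combination -h0)) h2 h1
      exact ⟨φ', hφ', ⟨q, hqΩ, hs⟩, Or.inr (Or.inr (Or.inl hL))⟩
    · obtain ⟨φ', hφ', hs, hL⟩ := h.exists_complexLiouville_of_pos_neg hφ hd hΩ hΩφ hu hv hw hz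
        hη hζ hqΩ hdq h1 h2
      exact ⟨φ', hφ', ⟨q, hqΩ, hs⟩, Or.inr (Or.inr (Or.inl hL))⟩
    · exact liouville 1 (Or.inl rfl) (by linarith) (by linarith)

/-- Normal forms in indefinite signature. -/
theorem IsQuadraticIntegral.exists_normalForm_of_indefinite (h : IsQuadraticIntegral g F)
    (hφ : φ ∈ IsManifold.maximalAtlas (𝓡 2) ∞ M) (hd : ChartData g F φ A B C a b c)
    (hΩ : IsOpen Ω) (hΩφ : Ω ⊆ φ.target) (hp : p ∈ Ω) (hdisc : 4 * A p * C p - B p ^ 2 < 0)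
    (hnp : ∀ O ⊆ φ.target, IsOpen O → O.Nonempty → ∀ k : ℝ,
      ¬ ∀ q ∈ O, a q = k * A q ∧ b q = k * B q ∧ c q = k * C q) :
    ∃ φ' ∈ IsManifold.maximalAtlas (𝓡 2) ∞ M, (∃ q ∈ Ω, φ.symm q ∈ φ'.source) ∧
      HasNormalForm g F φ' := by
  have hA := hd.pair.hA.mono hΩφ; have hB := hd.pair.hB.mono hΩφ; have hC := hd.pair.hC.mono hΩφ
  have hAc := hA.continuousOn; have hBc := hB.continuousOn; have hCc := hC.continuousOn
  -- The sign of the root is chosen to avoid cancellation with B. Then (−(B+s), 2A) and (2C, −(B+s))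
  -- are isotropic with determinant 2s(B+s) ≠ 0, even where A or C vanishes.
  obtain ⟨σ, hσ, hσp⟩ : ∃ σ : ℝ, σ ^ 2 = 1 ∧ B p + σ * √(B p ^ 2 - 4 * A p * C p) ≠ 0 := by
    have hs : 0 < √(B p ^ 2 - 4 * A p * C p) := Real.sqrt_pos.2 (by linarith)
    rcases le_or_gt 0 (B p) with h0 | h0
    · exact ⟨1, by norm_num, by positivity⟩
    · exact ⟨-1, by norm_num, by nlinarith⟩
  obtain ⟨r, hr, hsub, hpos⟩ := exists_ball_subset hΩ
    (f := fun q => (4 * A q * C q - B q ^ 2, B q + σ * √(B q ^ 2 - 4 * A q * C q)))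
    (by fun_prop) (isOpen_Iio.prod isOpen_ne) hp
    (show _ ∈ Iio (0 : ℝ) ×ˢ {y : ℝ | y ≠ 0} from ⟨hdisc, hσp⟩)
  set s : Plane → ℝ := fun q => σ * √(B q ^ 2 - 4 * A q * C q) with hs
  have hO := Metric.isOpen_ball (x := p) (ε := r)
  have hpb := Metric.mem_ball_self (x := p) hr
  have hA := hA.mono hsub; have hB := hB.mono hsub; have hC := hC.mono hsub
  have hneg : ∀ q ∈ Metric.ball p r, 0 < B q ^ 2 - 4 * A q * C q := fun q hq => by
    have : 4 * A q * C q - B q ^ 2 < 0 := (hpos q hq).1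
    linarith
  have ht0 : ∀ q ∈ Metric.ball p r, B q + s q ≠ 0 := fun q hq => (hpos q hq).2
  have hss : ContDiffOn ℝ ∞ s (Metric.ball p r) :=
    contDiffOn_const.mul (ContDiffOn.sqrt (by fun_prop) fun q hq => (hneg q hq).ne')
  have hs2 : ∀ q ∈ Metric.ball p r, s q ^ 2 = B q ^ 2 - 4 * A q * C q := fun q hq => by
    rw [hs, mul_pow, hσ, one_mul, Real.sq_sqrt (hneg q hq).le]
  have hs0 : ∀ q ∈ Metric.ball p r, s q ≠ 0 := fun q hq h0 => by
    have := hs2 q hq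
    rw [h0] at this
    linarith [hneg q hq]
  set u : Plane → ℝ := fun q => -(B q + s q) with hu
  set v : Plane → ℝ := fun q => 2 * A q with hv
  set w : Plane → ℝ := fun q => 2 * C q with hw
  have hus : ContDiffOn ℝ ∞ u (Metric.ball p r) := by fun_prop
  have hvs : ContDiffOn ℝ ∞ v (Metric.ball p r) := by fun_prop
  have hws : ContDiffOn ℝ ∞ w (Metric.ball p r) := by fun_prop
  have hη : ∀ q ∈ Metric.ball p r, quad (A q) (B q) (C q) (u q) (v q) = 0 := fun q hq => by
    simp only [quad, hu, hv]
    linear_combination A q * hs2 q hq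
  have hζ : ∀ q ∈ Metric.ball p r, quad (A q) (B q) (C q) (w q) (u q) = 0 := fun q hq => by
    simp only [quad, hu, hw]
    linear_combination C q * hs2 q hq
  have hdet : ∀ q ∈ Metric.ball p r, u q * u q - v q * w q ≠ 0 := fun q hq h0 => by
    have : 2 * s q * (B q + s q) = 0 := by
      simp only [hu, hv, hw] at h0
      linear_combination h0 + hs2 q hq
    simp [hs0 q hq, ht0 q hq] at this
  by_cases h1 : ∃ q ∈ Metric.ball p r, quad (a q) (b q) (c q) (u q) (v q) ≠ 0
  · obtain ⟨q, hq, hne⟩ := h1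
    obtain ⟨φ', hφ', ⟨x, hx, hxs⟩, hN⟩ := h.exists_normalForm_of_isotropic hφ hd hO
      (hsub.trans hΩφ) hus hvs hws hus hη hζ hq hdet hne
    exact ⟨φ', hφ', ⟨x, hsub hx, hxs⟩, hN⟩
  by_cases h2 : ∃ q ∈ Metric.ball p r, quad (a q) (b q) (c q) (w q) (u q) ≠ 0
  · obtain ⟨q, hq, hne⟩ := h2
    obtain ⟨φ', hφ', ⟨x, hx, hxs⟩, hN⟩ := h.exists_normalForm_of_isotropic hφ hd hO
      (hsub.trans hΩφ) hws hus hus hvs hζ hη hq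
      (fun q hq h0 => hdet q hq (by linear_combination -h0)) hne
    exact ⟨φ', hφ', ⟨x, hsub hx, hxs⟩, hN⟩
  push Not at h1 h2
  obtain ⟨k, hk⟩ := (hd.pair.mono hO (hsub.trans hΩφ)).exists_const_of_proportional
    (convex_ball p r) (fun q hq => by
      have e1 := h1 q hq
      have e2 := h2 q hq
      simp only [quad, hu, hv, hw] at e1 e2
      exact proportional_of_isotropic (hs2 q hq) (hs0 q hq) (ht0 q hq)
        (by linear_combination e1) (by linear_combination e2))
  exact (hnp _ (hsub.trans hΩφ) hO ⟨p, hpb⟩ k hk).elim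

end Manifold

/-- A nowhere zero smooth complex function has a smooth square root near each point. -/
lemma exists_smooth_sqrt {N : Plane → ℂ} {Ω : Set Plane} (hΩ : IsOpen Ω)
    (hN : ContDiffOn ℝ ∞ N Ω) {p : Plane} (hp : p ∈ Ω) (hNp : N p ≠ 0) :
    ∃ r > 0, Metric.ball p r ⊆ Ω ∧ ∃ w : Plane → ℂ, ContDiffOn ℝ ∞ w (Metric.ball p r) ∧
      ∀ q ∈ Metric.ball p r, w q ≠ 0 ∧ w q ^ 2 = N q := by
  have hNc := hN.continuousOn
  -- Dividing by N(p) brings the values near 1, where the principal logarithm is smooth.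
  obtain ⟨r, hr, hsub, hslit⟩ := exists_ball_subset hΩ (f := fun q => N q / N p)
    (by fun_prop) Complex.isOpen_slitPlane hp
    (by rw [div_self hNp]; exact Complex.one_mem_slitPlane)
  obtain ⟨c₀, hc₀⟩ := IsAlgClosed.exists_pow_nat_eq (N p) (n := 2) (by norm_num)
  have hc0 : c₀ ≠ 0 := by rintro rfl; exact hNp (by rw [← hc₀]; simp)
  refine ⟨r, hr, hsub, fun q => c₀ * Complex.exp (Complex.log (N q / N p) / 2), ?_, ?_⟩
  · have h1 : ContDiffOn ℝ ∞ (fun q => N q / N p) (Metric.ball p r) :=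
      (hN.mono hsub).div_const _
    have h2 : ContDiffOn ℝ ∞ (fun q => Complex.log (N q / N p)) (Metric.ball p r) :=
      fun q hq => ContDiffAt.comp_contDiffWithinAt (g := Complex.log) q
        ((Complex.contDiffAt_log (hslit q hq)).restrict_scalars ℝ) (h1 q hq)
    have h3 : ContDiff ℝ ∞ Complex.exp := Complex.contDiff_exp
    exact contDiffOn_const.mul (h3.comp_contDiffOn (h2.div_const 2))
  · intro q hq
    refine ⟨mul_ne_zero hc0 (Complex.exp_ne_zero _), ?_⟩
    rw [mul_pow, hc₀, ← Complex.exp_nat_mul]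
    have : ((2 : ℕ) : ℂ) * (Complex.log (N q / N p) / 2) = Complex.log (N q / N p) := by
      push_cast; ring
    rw [this, Complex.exp_log (Complex.slitPlane_ne_zero (hslit q hq))]
    field_simp

/-- The real and imaginary parts of the value of a real quadratic form at a complex vector. -/
lemma quad_complex (a b c y₀ x₀ y₁ x₁ : ℝ) :
    quad (a : ℂ) b c (y₀ + x₀ * Complex.I) (y₁ + x₁ * Complex.I) =
      ((quad a b c y₀ y₁ - quad a b c x₀ x₁ : ℝ) : ℂ) +
        (polar a b c x₀ x₁ y₀ y₁ : ℝ) * Complex.I := by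
  simp only [quad, polar]
  push_cast
  linear_combination (a * x₀ ^ 2 + b * (x₀ * x₁) + c * x₁ ^ 2 : ℂ) * Complex.I_sq

/-! ### Liouville coordinates in definite signature. -/

section Manifold

variable {M : Type*} [TopologicalSpace M] [ChartedSpace Plane M] [IsManifold (𝓡 2) ∞ M]
  {g : PseudoRiemannianMetric M} {F : CotangentFunction M} {φ : OpenPartialHomeomorph M Plane}
  {A B C a b c : Plane → ℝ} {p : Plane} {Ω : Set Plane}

/-- The real and imaginary parts of a normalized primitive of a complex isotropic form are
Liouville coordinates. -/
theorem IsQuadraticIntegral.exists_definite_liouville (h : IsQuadraticIntegral g F)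
    (hφ : φ ∈ IsManifold.maximalAtlas (𝓡 2) ∞ M) (hd : ChartData g F φ A B C a b c)
    (hΩ : IsOpen Ω) (hΩφ : Ω ⊆ φ.target) {x y : Plane → ℝ}
    (hx : ContDiffOn ℝ ∞ x Ω) (hy : ContDiffOn ℝ ∞ y Ω) (hp : p ∈ Ω)
    (hdisc : 0 < 4 * A p * C p - B p ^ 2)
    (hH : ∀ q ∈ Ω, quad (A q) (B q) (C q) (pd 0 y q) (pd 1 y q) =
      quad (A q) (B q) (C q) (pd 0 x q) (pd 1 x q))
    (hHxy : ∀ q ∈ Ω, polar (A q) (B q) (C q) (pd 0 x q) (pd 1 x q) (pd 0 y q) (pd 1 y q) = 0)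
    (hF : ∀ q ∈ Ω, quad (a q) (b q) (c q) (pd 0 y q) (pd 1 y q) =
      1 + quad (a q) (b q) (c q) (pd 0 x q) (pd 1 x q))
    (hFxy : ∀ q ∈ Ω, polar (a q) (b q) (c q) (pd 0 x q) (pd 1 x q) (pd 0 y q) (pd 1 y q) = 0) :
    ∃ φ' ∈ IsManifold.maximalAtlas (𝓡 2) ∞ M, φ.symm p ∈ φ'.source ∧
      IsLiouville 1 φ'.target (g.lineElement φ') (inCoords F φ') := by
  have zero (u v : ℝ) (h0 : quad (A p) (B p) (C p) u v = 0) : u = 0 ∧ v = 0 := by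
    have hA : A p ≠ 0 := fun h0 => by rw [h0] at hdisc; nlinarith
    have e : (2 * A p * u + B p * v) ^ 2 + (4 * A p * C p - B p ^ 2) * v ^ 2 = 0 := by
      rw [quad] at h0
      linear_combination 4 * A p * h0
    have hv : v = 0 := by
      by_contra hv
      have : 0 < v ^ 2 := by positivity
      nlinarith [sq_nonneg (2 * A p * u + B p * v)]
    refine ⟨?_, hv⟩
    rw [hv] at h0
    simpa [quad, hA] using h0
  obtain ⟨φ', hφ', r, hr, ht, hs, -, A', B', C', a', b', c', hd', τ, hτ⟩ :=
    h.exists_chart hφ hd hΩ hΩφ hx hy hp (fun h0 => by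
      have e := disc_transform (A p) (B p) (C p) (pd 0 x p) (pd 1 x p) (pd 0 y p) (pd 1 y p)
      rw [hH p hp, hHxy p hp, h0] at e
      have e' : quad (A p) (B p) (C p) (pd 0 x p) (pd 1 x p) = 0 := by nlinarith
      have k := hF p hp
      obtain ⟨h1, h2⟩ := zero _ _ e'
      obtain ⟨h3, h4⟩ := zero _ _ ((hH p hp).trans e')
      rw [h1, h2, h3, h4] at k
      simp [quad] at k)
  refine ⟨φ', hφ', hs, ?_⟩
  have hpair := hd'.pair
  have hint := hd'.integral
  have hle := hd'.lineElement
  rw [ht] at hpair hint hle hτ ⊢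
  refine hpair.isLiouville hle hint (by norm_num) (fun q hq => ?_) (fun q hq => ?_)
    (fun q hq => ?_) (fun q hq => ?_)
  all_goals obtain ⟨h1, -, -, e1, e2, e3, e4, e5, e6⟩ := hτ q hq
  · rw [e2, hHxy _ h1]
  · rw [e3, e1, hH _ h1, one_mul]
  · rw [e5, hFxy _ h1]
  · rw [e6, e4, hF _ h1, one_mul]

/-- Normal forms in definite signature. -/
theorem IsQuadraticIntegral.exists_normalForm_of_definite (h : IsQuadraticIntegral g F)
    (hφ : φ ∈ IsManifold.maximalAtlas (𝓡 2) ∞ M) (hd : ChartData g F φ A B C a b c)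
    (hΩ : IsOpen Ω) (hΩφ : Ω ⊆ φ.target) (hp : p ∈ Ω)
    (hdisc : 0 < 4 * A p * C p - B p ^ 2)
    (hnp : ∀ O ⊆ φ.target, IsOpen O → O.Nonempty → ∀ k : ℝ,
      ¬ ∀ q ∈ O, a q = k * A q ∧ b q = k * B q ∧ c q = k * C q) :
    ∃ φ' ∈ IsManifold.maximalAtlas (𝓡 2) ∞ M, (∃ q ∈ Ω, φ.symm q ∈ φ'.source) ∧
      HasNormalForm g F φ' := by
  have hA := hd.pair.hA.mono hΩφ; have hB := hd.pair.hB.mono hΩφ; have hC := hd.pair.hC.mono hΩφ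
  have hAc := hA.continuousOn; have hBc := hB.continuousOn; have hCc := hC.continuousOn
  obtain ⟨r, hr, hsub, hpos⟩ := exists_ball_subset hΩ
    (f := fun q => 4 * A q * C q - B q ^ 2) (by fun_prop) isOpen_Ioi hp hdisc
  replace hpos : ∀ q ∈ Metric.ball p r, 0 < 4 * A q * C q - B q ^ 2 := hpos
  set s : Plane → ℝ := fun q => √(4 * A q * C q - B q ^ 2) with hs
  have hO := Metric.isOpen_ball (x := p) (ε := r)
  have hpb := Metric.mem_ball_self (x := p) hr
  have hA := hA.mono hsub; have hB := hB.mono hsub; have hC := hC.mono hsub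
  have hss : ContDiffOn ℝ ∞ s (Metric.ball p r) :=
    ContDiffOn.sqrt (by fun_prop) fun q hq => (hpos q hq).ne'
  have hs2 : ∀ q ∈ Metric.ball p r, s q ^ 2 = 4 * A q * C q - B q ^ 2 := fun q hq =>
    Real.sq_sqrt (hpos q hq).le
  have hs0 : ∀ q ∈ Metric.ball p r, s q ≠ 0 := fun q hq => (Real.sqrt_pos.2 (hpos q hq)).ne'
  have ofReal {f : Plane → ℝ} {S : Set Plane} (hf : ContDiffOn ℝ ∞ f S) :
      ContDiffOn ℝ ∞ (fun q => (f q : ℂ)) S := Complex.ofRealCLM.contDiff.comp_contDiffOn hf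
  set u : Plane → ℂ := fun q => -(B q + s q * Complex.I) with hu
  set v : Plane → ℂ := fun q => 2 * A q with hv
  have hus : ContDiffOn ℝ ∞ u (Metric.ball p r) :=
    ((ofReal hB).add ((ofReal hss).mul contDiffOn_const)).neg
  have hvs : ContDiffOn ℝ ∞ v (Metric.ball p r) := contDiffOn_const.mul (ofReal hA)
  have hη : ∀ q ∈ Metric.ball p r, quad (A q : ℂ) (B q) (C q) (u q) (v q) = 0 := fun q hq => by
    have e : (s q : ℂ) ^ 2 = 4 * A q * C q - B q ^ 2 := by exact_mod_cast hs2 q hq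
    simp only [quad, hu, hv]
    linear_combination (A q * s q ^ 2 : ℂ) * Complex.I_sq - A q * e
  by_cases hall : ∀ q ∈ Metric.ball p r, quad (a q : ℂ) (b q) (c q) (u q) (v q) = 0
  · obtain ⟨k, hk⟩ := (hd.pair.mono hO (hsub.trans hΩφ)).exists_const_of_proportional
      (convex_ball p r) (fun q hq => proportional_of_complex_isotropic (hs2 q hq) (hs0 q hq) (by
        have e := hall q hq
        simp only [quad, hu, hv] at e
        linear_combination e))
    exact (hnp _ (hsub.trans hΩφ) hO ⟨p, hpb⟩ k hk).elim
  push Not at hall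
  obtain ⟨p₁, hp₁, hne⟩ := hall
  have has := ofReal ((hd.pair.ha.mono hΩφ).mono hsub)
  have hbs := ofReal ((hd.pair.hb.mono hΩφ).mono hsub)
  have hcs := ofReal ((hd.pair.hc.mono hΩφ).mono hsub)
  obtain ⟨r₁, hr₁, hsub₁, w, hw, hw2⟩ := exists_smooth_sqrt hO
    (N := fun q => quad (a q : ℂ) (b q) (c q) (u q) (v q))
    ((has.mul (hus.pow 2)).add (hbs.mul (hus.mul hvs)) |>.add (hcs.mul (hvs.pow 2))) hp₁ hne
  have hO₁ := Metric.isOpen_ball (x := p₁) (ε := r₁)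
  have hpb₁ := Metric.mem_ball_self (x := p₁) hr₁
  set θ₀ : Plane → ℂ := fun q => u q / w q with hθ₀
  set θ₁ : Plane → ℂ := fun q => v q / w q with hθ₁
  have hθ₀s : ContDiffOn ℝ ∞ θ₀ (Metric.ball p₁ r₁) :=
    ((hus.mono hsub₁).mul (hw.inv fun q hq => (hw2 q hq).1)).congr
      fun q _ => div_eq_mul_inv _ _
  have hθ₁s : ContDiffOn ℝ ∞ θ₁ (Metric.ball p₁ r₁) :=
    ((hvs.mono hsub₁).mul (hw.inv fun q hq => (hw2 q hq).1)).congr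
      fun q _ => div_eq_mul_inv _ _
  have hscale (a b c u v w : ℂ) : quad a b c (u / w) (v / w) = quad a b c u v / w ^ 2 := by
    simp only [quad]; ring
  have hθH : ∀ q ∈ Metric.ball p₁ r₁, quad (A q : ℂ) (B q) (C q) (θ₀ q) (θ₁ q) = 0 :=
    fun q hq => by rw [hθ₀, hθ₁, hscale, hη q (hsub₁ hq), zero_div]
  have hθF : ∀ q ∈ Metric.ball p₁ r₁, quad (a q : ℂ) (b q) (c q) (θ₀ q) (θ₁ q) = 1 :=
    fun q hq => by
      obtain ⟨h0, e⟩ := hw2 q hq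
      rw [hθ₀, hθ₁, hscale, e, div_self]
      rw [← e]
      exact pow_ne_zero 2 h0
  have hsubφ : Metric.ball p₁ r₁ ⊆ φ.target := hsub₁.trans (hsub.trans hΩφ)
  have hclosed : ∀ q ∈ Metric.ball p₁ r₁, pd 0 θ₁ q = pd 1 θ₀ q := fun q hq =>
    (hd.pair.mono hO₁ hsubφ).closed_of_isotropic hθ₀s hθ₁s one_ne_zero hθH hθF hq
  have primitive (l : ℂ →L[ℝ] ℝ) : ∃ W, ContDiffOn ℝ ∞ W (Metric.ball p₁ r₁) ∧
      ∀ q ∈ Metric.ball p₁ r₁, pd 0 W q = l (θ₀ q) ∧ pd 1 W q = l (θ₁ q) :=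
    exists_primitive hO₁ (convex_ball p₁ r₁) (l.contDiff.comp_contDiffOn hθ₀s)
      (l.contDiff.comp_contDiffOn hθ₁s) (fun q hq => by
        have e0 := pd_clm l (i := 1) (differentiableAt_of_contDiffOn hθ₀s hO₁ hq)
        have e1 := pd_clm l (i := 0) (differentiableAt_of_contDiffOn hθ₁s hO₁ hq)
        exact e1.trans ((congrArg l (hclosed q hq)).trans e0.symm))
  -- θ = dy + i dx, with the real part named y: the real part of F(θ) = 1 then reads F(dy) = 1 +
  -- F(dx), which is the normalization of `isLiouville` for s = 1. The real and imaginary parts of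
  -- H(θ) = 0 are the conformality relations.
  obtain ⟨y, hy, hyd⟩ := primitive Complex.reCLM
  obtain ⟨x, hx, hxd⟩ := primitive Complex.imCLM
  have split (q) (hq : q ∈ Metric.ball p₁ r₁) : θ₀ q = pd 0 y q + pd 0 x q * Complex.I ∧
      θ₁ q = pd 1 y q + pd 1 x q * Complex.I := by
    rw [(hyd q hq).1, (hyd q hq).2, (hxd q hq).1, (hxd q hq).2]
    exact ⟨(Complex.re_add_im _).symm, (Complex.re_add_im _).symm⟩
  have parts (a b c : ℝ) (n : ℝ) (q) (hq : q ∈ Metric.ball p₁ r₁)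
      (e : quad (a : ℂ) b c (θ₀ q) (θ₁ q) = n) :
      quad a b c (pd 0 y q) (pd 1 y q) = n + quad a b c (pd 0 x q) (pd 1 x q) ∧
        polar a b c (pd 0 x q) (pd 1 x q) (pd 0 y q) (pd 1 y q) = 0 := by
    rw [(split q hq).1, (split q hq).2, quad_complex] at e
    have e1 := congrArg Complex.re e
    have e2 := congrArg Complex.im e
    simp only [Complex.add_re, Complex.ofReal_re, Complex.re_ofReal_mul, Complex.I_re, mul_zero,
      add_zero, Complex.add_im, Complex.ofReal_im, Complex.im_ofReal_mul, Complex.I_im, mul_one,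
      zero_add] at e1 e2
    exact ⟨by linarith, e2⟩
  have hHp (q) (hq : q ∈ Metric.ball p₁ r₁) := parts _ _ _ 0 q hq (by simpa using hθH q hq)
  have hFp (q) (hq : q ∈ Metric.ball p₁ r₁) := parts _ _ _ 1 q hq (by simpa using hθF q hq)
  obtain ⟨φ', hφ', hs', hL⟩ := h.exists_definite_liouville hφ hd hO₁ hsubφ hx hy hpb₁
    (hpos p₁ hp₁) (fun q hq => by rw [(hHp q hq).1, zero_add]) (fun q hq => (hHp q hq).2)
    (fun q hq => (hFp q hq).1) (fun q hq => (hFp q hq).2)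
  exact ⟨φ', hφ', ⟨p₁, hsub hp₁, hs'⟩, Or.inl hL⟩

end Manifold

end Dini

/-! ### The open dense set of points that have a normal form. -/

theorem theoremB {M : Type*} [TopologicalSpace M] [ChartedSpace Dini.Plane M]
    [IsManifold (𝓡 2) ∞ M] [ConnectedSpace M]
    (g : Dini.PseudoRiemannianMetric M) (F : Dini.CotangentFunction M)
    (hquad : Dini.IsQuadraticInMomenta F) (hint : g.IsIntegral F) (hnontriv : g.IsNontrivial F) :
    ∃ U : Set M, IsOpen U ∧ Dense U ∧ ∀ p ∈ U,
      ∃ φ ∈ IsManifold.maximalAtlas (𝓡 2) ∞ M, p ∈ φ.source ∧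
        (Dini.IsLiouville 1 φ.target (g.lineElement φ) (Dini.inCoords F φ) ∨
          (∃ ε : ℝ, (ε = 1 ∨ ε = -1) ∧
            Dini.IsLiouville (-1) φ.target (g.lineElement φ)
              (fun q P => ε * Dini.inCoords F φ q P)) ∨
          Dini.IsComplexLiouville φ.target (g.lineElement φ) (Dini.inCoords F φ) ∨
          (∃ ε : ℝ, (ε = 1 ∨ ε = -1) ∧
            Dini.IsJordanBlock φ.target (g.lineElement φ)
              (fun q P => ε * Dini.inCoords F φ q P))) := by
  have h := Dini.isQuadraticIntegral hquad hint
  refine ⟨{p | ∃ φ ∈ IsManifold.maximalAtlas (𝓡 2) ∞ M, p ∈ φ.source ∧ Dini.HasNormalForm g F φ},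
    ?_, ?_, fun p hp => hp⟩
  · refine isOpen_iff_forall_mem_open.2 fun p hp => ?_
    obtain ⟨φ, hφ, hpφ, hN⟩ := hp
    exact ⟨φ.source, fun q hq => ⟨φ, hφ, hq, hN⟩, φ.open_source, hpφ⟩
  · refine dense_iff_inter_open.2 fun V hV ⟨m, hm⟩ => ?_
    set φ := chartAt Dini.Plane m with hφdef
    have hφ : φ ∈ IsManifold.maximalAtlas (𝓡 2) ∞ M := IsManifold.chart_mem_maximalAtlas m
    have hmφ : m ∈ φ.source := mem_chart_source _ m
    obtain ⟨A, B, C, a, b, c, hd⟩ := h φ hφ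
    have hΩ := φ.symm.isOpen_inter_preimage hV
    have hΩφ : φ.symm.source ∩ φ.symm ⁻¹' V ⊆ φ.target := inter_subset_left
    have hp : φ m ∈ φ.symm.source ∩ φ.symm ⁻¹' V :=
      ⟨φ.map_source hmφ, by rw [mem_preimage, φ.left_inv hmφ]; exact hm⟩
    -- Global nontriviality becomes nontriviality on every nonempty open set; this is the only use
    -- of connectedness.
    have hnp : ∀ O ⊆ φ.target, IsOpen O → O.Nonempty → ∀ k : ℝ,
        ¬ ∀ q ∈ O, a q = k * A q ∧ b q = k * B q ∧ c q = k * C q :=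
      fun O hOφ hO hne k hk => hnontriv k (h.eq_of_eqOn hφ hd hO hOφ hne hk)
    obtain ⟨φ', hφ', ⟨q, hq, hqs⟩, hN⟩ : ∃ φ' ∈ IsManifold.maximalAtlas (𝓡 2) ∞ M,
        (∃ q ∈ φ.symm.source ∩ φ.symm ⁻¹' V, φ.symm q ∈ φ'.source) ∧
          Dini.HasNormalForm g F φ' := by
      rcases lt_or_gt_of_ne (hd.pair.disc_ne _ (hΩφ hp)) with h0 | h0
      · exact h.exists_normalForm_of_indefinite hφ hd hΩ hΩφ hp h0 hnp
      · exact h.exists_normalForm_of_definite hφ hd hΩ hΩφ hp h0 hnp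
    exact ⟨φ.symm q, hq.2, φ', hφ', hqs, hN⟩
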